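/- Let $d\ge 1$, $z,C,b,\beta>0$. Let $\Gamma=\Gamma^C$ be the set of signed measures $\eta=\sum_y s_y\delta_y$ on $\mathbb R^d$ having finitely many support points in each compact set, with $|s_y|\le C$ for all $y$ and $\int(1+|x|^2)^{-(d+\epsilon)/2}\,d|\eta|(x)<\infty$ for all $\epsilon>0$; equip it with the $\sigma$-algebra $\mathcal B^\Gamma$ generated by the maps $\eta\mapsto\langle\eta,f\rangle$, $f\in\mathcal S(\mathbb R^d)$ (the trace of the Borel $\sigma$-algebra of $\mathcal S'(\mathbb R^d)$). For a probability measure $r$ on $\mathbb R$ with $\operatorname{supp} r\subseteq[-C,C]$ and $r\{0\}=0$ put $\psi(t)=z\int_{\mathbb R}(e^{ist}-1)\,dr(s)$, and let $\mu_0$ be the probability measure on $(\Gamma,\mathcal B^\Gamma)$ with $$\int_\Gamma e^{i\langle\eta,f\rangle}\,d\mu_0(\eta)=e^{\int_{\mathbb R^d}\psi(f)\,dx}\qquad\text{for all real } f\in\mathcal S(\mathbb R^d).$$ Let $G\ge 0$ be a symmetric function ($G(-x)=G(x)$) in $L^1(\mathbb R^d)$, and let $v\in C^2(\mathbb R)$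 be concave and monotonically falling ($v'\le 0$), with $v(0)=0$ and $|v'|<b$. For a continuous compactly supported $g:\mathbb R^d\to\mathbb R$ with $0\le g\le\beta$ put $$U_g(\eta)=\int_{\mathbb R^d}v(G*\eta)\,g\,dx,\qquad d\mu_g=\frac{e^{-U_g}}{\int_\Gamma e^{-U_g}\,d\mu_0}\,d\mu_0,$$ and let $\mu_{0,g}$ be the measure obtained by replacing $v(\phi)$ with $-b\phi$ in the definition of $\mu_g$. Let $F$ be a monotonically increasing observable: $F(\eta)=H(\langle\eta,h_1\rangle,\dots,\langle\eta,h_n\rangle)$ with $H:\mathbb R^n\to\mathbb R$ continuous, increasing in each argument and exponentially bounded ($|H(x)|\le Ke^{\kappa(|x_1|+\dots+|x_n|)}$ for some $\kappa,K>0$), and with $h_1,\dots,h_n\ge 0$ continuous and fast falling ($\sup_x|(1+|x|^2)^Nh_l(x)|<\infty$ for all $N\in\mathbb N$). Then the measure $\mu_0$ exists and is unique, $\mu_g$ and $\mu_{0,g}$ are well-defined probability measures for which $F$ is integrable, and $$\int_\Gamma F\,d\mu_g\le\int_\Gamma F\,d\mu_{0,g}<M\qquad\text{for all continuous compactly supported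 } g \text{ with } 0\le g\le\beta,$$ where $M$ is finite and depends only on $F$, $z$, $C$, $b$, $\|G\|_{L^1(\mathbb R^d)}$ and $\beta$ (and the dimension $d$), but not on $g$. -/

import Mathlib

open MeasureTheory
open scoped SchwartzMap

noncomputable section

namespace WeakGas

/-- The Euclidean space `ℝ^d`. -/
abbrev E (d : ℕ) : Type := EuclideanSpace ℝ (Fin d)

/-- The configuration space `Γ = Γ^C`: signed measures `η = ∑ y, s_y δ_y` on `ℝ^d`, given by the
function `y ↦ s_y = η {y}`, with finitely many support points in every compact set, with
`|s_y| ≤ C` for all `y`, and with `∫ (1 + |x|²)^(-(d + ε) / 2) d|η|(x) < ∞` for all `ε > 0`. -/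
@[ext]
structure Config (d : ℕ) (C : ℝ) where
  /-- the charge `s_y = η {y}` sitting at the point `y` (zero where there is no particle) -/
  charge : E d → ℝ
  finite_inter : ∀ K : Set (E d), IsCompact K → (K ∩ Function.support charge).Finite
  abs_charge_le : ∀ y, |charge y| ≤ C
  summable_weight : ∀ ε : ℝ, 0 < ε →
    Summable fun y => (1 + ‖y‖ ^ 2) ^ (-((d : ℝ) + ε) / 2) * |charge y|

variable {d : ℕ} {C : ℝ}

/-- The pairing `⟨η, h⟩ = ∫ h dη = ∑ y, s_y h(y)`. -/
def Config.pair (η : Config d C) (h : E d → ℝ) : ℝ :=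
  ∑' y, η.charge y * h y

/-- The trace on `Γ` of the Borel sigma algebra of the space of tempered distributions. The latter
is generated by the evaluations `η ↦ ⟨η, f⟩` at the real Schwartz functions `f`. -/
instance Config.instMeasurableSpace : MeasurableSpace (Config d C) :=
  ⨆ f : 𝓢(E d, ℝ), MeasurableSpace.comap (fun η : Config d C => η.pair f) inferInstance

/-- `r` is a probability measure on `ℝ` with support in `[-C, C]` and `r {0} = 0`. -/
structure IsChargeLaw (C : ℝ) (r : Measure ℝ) : Prop where
  prob : IsProbabilityMeasure r
  supp : r (Set.Icc (-C) C)ᶜ = 0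
  zero : r {0} = 0

/-- The Lévy characteristic `ψ(t) = z ∫ (e^{ist} - 1) dr(s)`. -/
def levyChar (z : ℝ) (r : Measure ℝ) (t : ℝ) : ℂ :=
  (z : ℂ) * ∫ s, (Complex.exp (Complex.I * (s : ℂ) * (t : ℂ)) - 1) ∂r

/-- `μ₀` is the law of the free gas with activity `z` and charge distribution `r`: the
probability measure with characteristic functional `f ↦ exp (∫ ψ(f(x)) dx)`. -/
structure IsFreeGas (z : ℝ) (r : Measure ℝ) (μ₀ : Measure (Config d C)) : Prop where
  prob : IsProbabilityMeasure μ₀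
  charFun_eq : ∀ f : 𝓢(E d, ℝ),
    ∫ η, Complex.exp (Complex.I * (η.pair f : ℂ)) ∂μ₀
      = Complex.exp (∫ x, levyChar z r (f x))

/-- The static field `φ = G * η`, that is `φ(x) = ∑ y, s_y G(x - y)`. -/
def field (G : E d → ℝ) (η : Config d C) (x : E d) : ℝ :=
  η.pair fun y => G (x - y)

/-- The interaction `U_g(η) = ∫ v(φ(x)) g(x) dx` with `φ = G * η`. -/
def potential (G : E d → ℝ) (v : ℝ → ℝ) (g : E d → ℝ) (η : Config d C) : ℝ :=
  ∫ x, v (field G η x) * g x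

/-- The Gibbs measure `dμ_g = e^{-U_g} dμ₀ / ∫ e^{-U_g} dμ₀`. -/
def gibbs (μ₀ : Measure (Config d C)) (G : E d → ℝ) (v : ℝ → ℝ) (g : E d → ℝ) :
    Measure (Config d C) :=
  μ₀.tilted fun η => -potential G v g η

/-- The measure `μ_{0,g}`: the Gibbs measure with energy density `v(φ) = -bφ`. -/
def linearGibbs (μ₀ : Measure (Config d C)) (G : E d → ℝ) (b : ℝ) (g : E d → ℝ) :
    Measure (Config d C) :=
  gibbs μ₀ G (fun φ => -b * φ) g

/-- The interaction kernels: symmetric non-negative integrable functions. -/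
structure IsKernel (G : E d → ℝ) : Prop where
  symm : ∀ x, G (-x) = G x
  nonneg : ∀ x, 0 ≤ G x
  integrable : Integrable G

/-- The energy densities: `v ∈ C²(ℝ)` concave and monotonically falling, with `v(0) = 0` and
`|v'| < b`. -/
structure IsEnergyDensity (b : ℝ) (v : ℝ → ℝ) : Prop where
  contDiff : ContDiff ℝ 2 v
  zero : v 0 = 0
  abs_deriv_lt : ∀ φ, |deriv v φ| < b
  concave : ConcaveOn ℝ Set.univ v
  deriv_nonpos : ∀ φ, deriv v φ ≤ 0

/-- The cut-off functions: `g ∈ C_0(ℝ^d)` (continuous with compact support), `0 ≤ g ≤ β`. -/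
structure IsCutoff (β : ℝ) (g : E d → ℝ) : Prop where
  continuous : Continuous g
  compactSupport : HasCompactSupport g
  nonneg : ∀ x, 0 ≤ g x
  le : ∀ x, g x ≤ β

/-- The continuous fast falling functions `C_f.f.(ℝ^d)`. -/
def FastFalling (h : E d → ℝ) : Prop :=
  Continuous h ∧ ∀ N : ℕ, ∃ B : ℝ, ∀ x, |(1 + ‖x‖ ^ 2) ^ N * h x| ≤ B

/-- Exponentially bounded functions on `ℝ^n`. -/
def ExpBounded {n : ℕ} (H : (Fin n → ℝ) → ℝ) : Prop :=
  ∃ κ K : ℝ, 0 < κ ∧ 0 < K ∧ ∀ x, |H x| ≤ K * Real.exp (κ * ∑ i, |x i|)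

/-- The monotonically increasing observables: `F(η) = H(⟨η, h_1⟩, …, ⟨η, h_n⟩)` with `H`
continuous, exponentially bounded and increasing in each argument, and with non-negative fast
falling `h_l`. -/
def IsIncreasingObservable (F : Config d C → ℝ) : Prop :=
  ∃ (n : ℕ) (H : (Fin n → ℝ) → ℝ) (h : Fin n → E d → ℝ),
    Continuous H ∧ ExpBounded H ∧
    (∀ (x : Fin n → ℝ) (i : Fin n), Monotone fun t => H (Function.update x i t)) ∧
    (∀ l, FastFalling (h l)) ∧ (∀ l x, 0 ≤ h l x) ∧
    ∀ η, F η = H fun l => η.pair (h l)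

end WeakGas

end

/-! Under `μ₀` the atoms `(s_y, y)` form a Poisson random measure with intensity `z r ⊗ dy`. Write
`v(φ) = q(φ) - bφ` with `q(φ) = v(φ) + bφ`; since `|v'| < b`, the function `q` is increasing.

The linear part is harmless. By Fubini `b ∫ (G * η) g dx = b ⟨η, u⟩` with `u(y) = ∫ G(x - y) g(x)
dx`, and tilting a Poisson random measure by the exponential of a linear functional gives a Poisson
random measure again, here with intensity `e^{b s u(y)} z r(ds) dy` (`IsPoisson.tilted`). So
`μ_{0,g}` is Poissonian, and `μ_g` is its tilt by `e^{-∫ q(G * η) g dx}`.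

As `G`, `g` and the `h_l` are nonnegative, `F` increases and this last factor decreases in the
charges. Such functionals are negatively correlated (`IsPoisson.integral_mul_le`), and dividing by
the normalisation gives the comparison. Charges have both signs, so the order is not that of adding
particles. Instead, space is cut into cells. Total charges of disjoint cells are independent real
variables (`IsPoisson.iIndepFun_integral`), monotone functions of independent real variables are
associated (`integral_mul_le_of_iIndepFun`), and the general case follows by dominated convergence
(`Envelope.integral_mul_le_of_tendsto`), where exponentials of linear functionals dominate.

For the uniform bound, `|F| ≤ K exp(κ n C ∑ ∑_l h_l(y))`, the outer sum running over the particles,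
and the Laplace functional gives its expectation. The cutoff enters only through `u ≤ β ‖G‖₁`, which
bounds the density of the tilted intensity by `e^{b C β ‖G‖₁}`.

Everything uses `IsPoisson`: the Laplace formula together with almost sure finiteness of the
relevant sums, without which a Bochner integral could be a meaningless zero. One Poisson law on
`Config` is built from independent finite configurations in shells; the characteristic functional
determines the measure, so every free gas is that law (`IsFreeGas.isPoisson`). -/

noncomputable section

namespace WeakGas

open ProbabilityTheory Filter Topology
open scoped ENNReal

set_option linter.unusedSectionVars false

/-! ### Finite Poisson configurations. -/

section PoissonCell

variable {X : Type*} [MeasurableSpace X]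

/-- Finite sequences of points. -/
abbrev FinSeq (X : Type*) : Type _ := Σ n : ℕ, Fin n → X

/-- The inclusion of the sequences of length `n` into all finite sequences. -/
abbrev FinSeq.mk (n : ℕ) (x : Fin n → X) : FinSeq X := ⟨n, x⟩

lemma measurable_sigma_mk (n : ℕ) : Measurable (FinSeq.mk (X := X) n) := by
  intro s hs
  exact (MeasurableSpace.measurableSet_iInf.1 hs) n

lemma measurable_of_comp_sigma_mk {Y : Type*} [MeasurableSpace Y] {F : FinSeq X → Y}
    (hF : ∀ n, Measurable fun x : Fin n → X => F (FinSeq.mk n x)) : Measurable F := by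
  intro s hs
  exact MeasurableSpace.measurableSet_iInf.2 fun n => hF n hs

/-- The law of a finite Poisson configuration with intensity `m`: it has `n` points with
unnormalised law `m ^ n / n!`. -/
def poissonCell (m : Measure X) : Measure (FinSeq X) :=
  ENNReal.ofReal (Real.exp (-(m.real Set.univ))) • Measure.sum fun n : ℕ =>
    ENNReal.ofReal ((n.factorial : ℝ)⁻¹) • (Measure.pi fun _ : Fin n => m).map (FinSeq.mk n)

lemma lintegral_poissonCell (m : Measure X) {F : FinSeq X → ℝ≥0∞}
    (hF : Measurable F) :
    ∫⁻ c, F c ∂poissonCell m = ENNReal.ofReal (Real.exp (-(m.real Set.univ))) *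
      ∑' n : ℕ, ENNReal.ofReal ((n.factorial : ℝ)⁻¹) *
        ∫⁻ x, F (FinSeq.mk n x) ∂(Measure.pi fun _ : Fin n => m) := by
  rw [poissonCell, lintegral_smul_measure, lintegral_sum_measure, smul_eq_mul]
  congr 1
  refine tsum_congr fun n => ?_
  rw [lintegral_smul_measure, lintegral_map hF (measurable_sigma_mk n), smul_eq_mul]

lemma measurable_prod_cell {M : Type*} [CommMonoid M] [MeasurableSpace M] [MeasurableMul₂ M]
    {g : X → M} (hg : Measurable g) :
    Measurable fun c : FinSeq X => ∏ i, g (c.2 i) := by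
  refine measurable_of_comp_sigma_mk fun n => ?_
  exact Finset.measurable_prod (f := fun i (x : Fin n → X) => g (x i)) Finset.univ
    fun i _ => hg.comp (measurable_pi_apply i)

lemma measurable_sum_cell {M : Type*} [AddCommMonoid M] [MeasurableSpace M] [MeasurableAdd₂ M]
    {g : X → M} (hg : Measurable g) :
    Measurable fun c : FinSeq X => ∑ i, g (c.2 i) := by
  refine measurable_of_comp_sigma_mk fun n => ?_
  exact Finset.measurable_sum (f := fun i (x : Fin n → X) => g (x i)) Finset.univ
    fun i _ => hg.comp (measurable_pi_apply i)

variable (m : Measure X) [IsFiniteMeasure m]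

/-- With `a = ∫ ‖g‖ dm`, the sector of `n` points contributes `a ^ n / n!`, an exponential series.
-/
lemma integrable_prod_cell {𝕜 : Type*} [RCLike 𝕜] {g : X → 𝕜} (hg : Measurable g)
    (hgi : Integrable g m) :
    Integrable (fun c : FinSeq X => ∏ i, g (c.2 i)) (poissonCell m) := by
  refine ⟨(measurable_prod_cell hg).aestronglyMeasurable, ?_⟩
  rw [HasFiniteIntegral, lintegral_poissonCell m (measurable_prod_cell hg).enorm]
  refine ENNReal.mul_lt_top ENNReal.ofReal_lt_top ?_
  have key : ∀ n : ℕ, ∫⁻ x, ‖∏ i, g (x i)‖ₑ ∂(Measure.pi fun _ : Fin n => m)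
      = ENNReal.ofReal ((∫ x, ‖g x‖ ∂m) ^ n) := by
    intro n
    have h1 : Integrable (fun x : Fin n → X => ∏ i, g (x i)) (Measure.pi fun _ : Fin n => m) :=
      Integrable.fintype_prod (f := fun _ => g) (fun _ => hgi)
    rw [← ofReal_integral_norm_eq_lintegral_enorm h1]
    congr 1
    simp_rw [norm_prod]
    rw [integral_fintype_prod_eq_pow (fun x => ‖g x‖), Fintype.card_fin]
  simp_rw [key]
  set a := ∫ x, ‖g x‖ ∂m
  have ha : 0 ≤ a := integral_nonneg fun _ => norm_nonneg _
  have : ∀ n : ℕ, ENNReal.ofReal ((n.factorial : ℝ)⁻¹) * ENNReal.ofReal (a ^ n)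
      = ENNReal.ofReal (a ^ n / n.factorial) := by
    intro n
    rw [← ENNReal.ofReal_mul (by positivity)]
    congr 1
    ring
  simp_rw [this]
  rw [← ENNReal.ofReal_tsum_of_nonneg (fun n => by positivity) (Real.summable_pow_div_factorial a)]
  exact ENNReal.ofReal_lt_top

/-- The series `∑ (∫ g dm) ^ n / n!` is an exponential, and the normalisation `e^{-m(X)}` turns `g`
into `g - 1`. The real case serves for domination, the complex one for the Laplace functional. -/
lemma integral_prod_cell {𝕜 : Type*} [RCLike 𝕜] {g : X → 𝕜} (hg : Measurable g)
    (hgi : Integrable g m) :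
    ∫ c, ∏ i, g (c.2 i) ∂(poissonCell m) = NormedSpace.exp (∫ x, (g x - 1) ∂m) := by
  have hint := integrable_prod_cell m hg hgi
  have hpos : ENNReal.ofReal (Real.exp (-(m.real Set.univ))) ≠ 0 := by
    simp [Real.exp_pos]
  have hint' := (integrable_smul_measure hpos ENNReal.ofReal_ne_top).1 hint
  rw [poissonCell, integral_smul_measure]
  have hs := hasSum_integral_measure hint'
  have key : ∀ n : ℕ, ∫ c : FinSeq X, ∏ i, g (c.2 i) ∂(ENNReal.ofReal ((n.factorial : ℝ)⁻¹) •
      (Measure.pi fun _ : Fin n => m).map (FinSeq.mk n)) = ((n.factorial : 𝕜)⁻¹) * (∫ x, g x ∂m) ^ n := by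
    intro n
    rw [integral_smul_measure, integral_map (measurable_sigma_mk n).aemeasurable
      (measurable_prod_cell hg).aestronglyMeasurable]
    rw [integral_fintype_prod_eq_pow g, Fintype.card_fin, ENNReal.toReal_ofReal (by positivity),
      RCLike.real_smul_eq_coe_mul]
    push_cast
    rfl
  simp_rw [key] at hs
  have he := NormedSpace.exp_series_hasSum_exp' (𝕂 := 𝕜) (∫ x, g x ∂m)
  simp_rw [smul_eq_mul] at he
  rw [hs.unique he, integral_sub hgi (integrable_const _), integral_const, sub_eq_add_neg,
    NormedSpace.exp_add, ENNReal.toReal_ofReal (by positivity), RCLike.real_smul_eq_coe_mul,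
    mul_comm]
  congr 1
  rw [RCLike.real_smul_eq_coe_mul, mul_one, ← RCLike.ofReal_neg, Real.exp_eq_exp_ℝ]
  exact (NormedSpace.algebraMap_exp_comm (𝕂 := ℝ) (𝔸 := 𝕜) _)

instance : IsProbabilityMeasure (poissonCell m) := by
  have h1 := integrable_prod_cell m (g := fun _ => (1 : ℝ)) measurable_const (integrable_const _)
  have h2 := integral_prod_cell m (g := fun _ => (1 : ℝ)) measurable_const (integrable_const _)
  simp only [Finset.prod_const_one, sub_self, integral_zero, NormedSpace.exp_zero] at h1 h2
  have : IsFiniteMeasure (poissonCell m) := by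
    have := (integrable_const_iff (c := (1:ℝ))).1 h1
    simpa [isFiniteMeasure_iff, lt_top_iff_ne_top] using this
  rw [integral_const, smul_eq_mul, mul_one] at h2
  constructor
  rw [← ENNReal.ofReal_toReal (measure_ne_top (poissonCell m) Set.univ)]
  rw [Measure.real] at h2
  rw [h2, ENNReal.ofReal_one]

/-- Campbell's formula. Each of the `n` points contributes `m(X) ^ (n - 1) ∫ f dm`, and `n / n! = 1
/ (n - 1)!` restores the exponential series that the normalisation cancels. -/
lemma lintegral_sum_poissonCell {f : X → ℝ≥0∞} (hf : Measurable f) :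
    ∫⁻ c, ∑ i, f (c.2 i) ∂poissonCell m = ∫⁻ x, f x ∂m := by
  rw [lintegral_poissonCell m (measurable_sum_cell hf)]
  have key : ∀ n : ℕ, ∫⁻ x, ∑ i, f (x i) ∂(Measure.pi fun _ : Fin n => m)
      = n * m Set.univ ^ (n - 1) * ∫⁻ x, f x ∂m := by
    intro n
    rw [lintegral_finsetSum (f := fun i (x : Fin n → X) => f (x i)) _
      fun i _ => hf.comp (measurable_pi_apply i)]
    have : ∀ i : Fin n, ∫⁻ x, f (x i) ∂(Measure.pi fun _ : Fin n => m)
        = m Set.univ ^ (n - 1) * ∫⁻ x, f x ∂m := by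
      intro i
      have h := lintegral_map (μ := Measure.pi fun _ : Fin n => m) hf (measurable_pi_apply i)
      change ∫⁻ x, f x ∂((Measure.pi fun _ : Fin n => m).map (Function.eval i)) = _ at h
      rw [Measure.pi_map_eval, lintegral_smul_measure, smul_eq_mul] at h
      rw [← h]
      simp [Finset.card_erase_of_mem]
    simp [this, mul_assoc]
  simp_rw [key]
  rw [tsum_eq_zero_add' ENNReal.summable]
  simp only [Nat.factorial_zero, Nat.cast_zero, zero_mul, mul_zero, zero_add]
  have h2 : ∀ n : ℕ, ENNReal.ofReal (((n + 1).factorial : ℝ)⁻¹) *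
      (((n + 1 : ℕ) : ℝ≥0∞) * m Set.univ ^ (n + 1 - 1) * ∫⁻ x, f x ∂m)
      = ENNReal.ofReal (m.real Set.univ ^ n / n.factorial) * ∫⁻ x, f x ∂m := by
    intro n
    have : m Set.univ = ENNReal.ofReal (m.real Set.univ) := by simp
    rw [this, ← ENNReal.ofReal_natCast, ← ENNReal.ofReal_pow measureReal_nonneg, ← mul_assoc,
      ← ENNReal.ofReal_mul (by positivity), ← ENNReal.ofReal_mul (by positivity)]
    congr 2
    rw [Nat.factorial_succ, Nat.add_sub_cancel]
    push_cast
    field_simp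
  simp_rw [h2]
  rw [ENNReal.tsum_mul_right, ← ENNReal.ofReal_tsum_of_nonneg (fun n => by positivity)
    (Real.summable_pow_div_factorial _), ← mul_assoc, ← ENNReal.ofReal_mul (by positivity)]
  have : ∑' n : ℕ, m.real Set.univ ^ n / n.factorial = Real.exp (m.real Set.univ) := by
    rw [Real.exp_eq_exp_ℝ, NormedSpace.exp_eq_tsum_div]
  rw [this, ← Real.exp_add]
  simp

end PoissonCell

/-! ### Poisson processes as sequences of independent finite configurations. -/

section PoissonProcess

variable {X : Type*} [MeasurableSpace X]

/-- The point measure of a sequence of finite configurations. -/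
def points (ω : ℕ → FinSeq X) : Measure X :=
  Measure.sum fun k => Measure.sum fun i : Fin (ω k).1 => Measure.dirac ((ω k).2 i)

lemma lintegral_points (ω : ℕ → FinSeq X) {f : X → ℝ≥0∞} (hf : Measurable f) :
    ∫⁻ x, f x ∂points ω = ∑' k, ∑ i, f ((ω k).2 i) := by
  rw [points, lintegral_sum_measure]
  refine tsum_congr fun k => ?_
  rw [lintegral_sum_measure, tsum_fintype]
  exact Finset.sum_congr rfl fun i _ => lintegral_dirac' _ hf

lemma measurable_lintegral_points {f : X → ℝ≥0∞} (hf : Measurable f) :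
    Measurable fun ω : ℕ → FinSeq X => ∫⁻ x, f x ∂points ω := by
  simp_rw [fun ω => lintegral_points ω hf]
  exact Measurable.tsum fun k => (measurable_sum_cell hf).comp (measurable_pi_apply k)

lemma integral_finSeq {E : Type*} [NormedAddCommGroup E] [NormedSpace ℝ E] [CompleteSpace E]
    (c : FinSeq X) {f : X → E} (hf : StronglyMeasurable f) :
    ∫ x, f x ∂(Measure.sum fun i : Fin c.1 => Measure.dirac (c.2 i)) = ∑ i, f (c.2 i) := by
  rw [Measure.sum_fintype, integral_finsetSum_measure]
  · exact Finset.sum_congr rfl fun i _ => integral_dirac' _ _ hf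
  · intro i _
    exact ⟨hf.aestronglyMeasurable, by
      rw [HasFiniteIntegral, lintegral_dirac' _ hf.enorm]; exact enorm_lt_top⟩

lemma hasSum_integral_points {E : Type*} [NormedAddCommGroup E] [NormedSpace ℝ E] [CompleteSpace E]
    (ω : ℕ → FinSeq X) {f : X → E} (hf : StronglyMeasurable f)
    (hi : Integrable f (points ω)) :
    HasSum (fun k => ∑ i, f ((ω k).2 i)) (∫ x, f x ∂points ω) := by
  have := hasSum_integral_measure hi
  simp only [integral_finSeq _ hf] at this
  exact this

variable (m : ℕ → Measure X) [∀ k, IsFiniteMeasure (m k)]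

/-- The law of independent finite Poisson configurations with intensities `m k`. -/
def poissonLaw : Measure (ℕ → FinSeq X) :=
  Measure.infinitePi fun k => poissonCell (m k)

instance : IsProbabilityMeasure (poissonLaw m) := by
  unfold poissonLaw; infer_instance

lemma lintegral_lintegral_points {f : X → ℝ≥0∞} (hf : Measurable f) :
    ∫⁻ ω, ∫⁻ x, f x ∂points ω ∂poissonLaw m = ∫⁻ x, f x ∂Measure.sum m := by
  simp_rw [fun ω => lintegral_points ω hf]
  rw [lintegral_tsum (f := fun k (ω : ℕ → FinSeq X) => ∑ i, f ((ω k).2 i)) fun k =>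
    ((measurable_sum_cell hf).comp (measurable_pi_apply k)).aemeasurable, lintegral_sum_measure]
  refine tsum_congr fun k => ?_
  rw [← lintegral_sum_poissonCell (m k) hf]
  exact (measurePreserving_eval_infinitePi (fun k => poissonCell (m k)) k).lintegral_comp
    (measurable_sum_cell hf)

lemma integrable_prod_poissonLaw {𝕜 : Type*} [RCLike 𝕜] {g : X → 𝕜} (hg : Measurable g)
    (hgi : ∀ k, Integrable g (m k)) (n : ℕ) :
    Integrable (fun ω : ℕ → FinSeq X => ∏ k ∈ Finset.range n, ∏ i, g ((ω k).2 i))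
      (poissonLaw m) := by
  have h := Integrable.fintype_prod_dep (ι := Finset.range n)
    (μ := fun k => poissonCell (m k)) (f := fun _ (c : FinSeq X) => ∏ i, g (c.2 i))
    fun k => integrable_prod_cell (m k) hg (hgi k)
  rw [← Measure.infinitePi_map_restrict (fun k => poissonCell (m k))] at h
  have h2 := h.comp_measurable (Finset.measurable_restrict _)
  refine h2.congr (ae_of_all _ fun ω => ?_)
  exact Finset.prod_coe_sort (Finset.range n) fun k => ∏ i, g ((ω k).2 i)

lemma integral_prod_poissonLaw {𝕜 : Type*} [RCLike 𝕜] {g : X → 𝕜} (hg : Measurable g)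
    (hgi : ∀ k, Integrable g (m k)) (n : ℕ) :
    ∫ ω, ∏ k ∈ Finset.range n, ∏ i, g ((ω k).2 i) ∂poissonLaw m
      = ∏ k ∈ Finset.range n, NormedSpace.exp (∫ x, (g x - 1) ∂m k) := by
  have h := Integrable.fintype_prod_dep (ι := Finset.range n)
    (μ := fun k => poissonCell (m k)) (f := fun _ (c : FinSeq X) => ∏ i, g (c.2 i))
    fun k => integrable_prod_cell (m k) hg (hgi k)
  have h2 := integral_restrict_infinitePi (μ := fun k => poissonCell (m k))
    h.aestronglyMeasurable
  rw [integral_fintype_prod_eq_prod (ι := Finset.range n)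
    (f := fun _ (c : FinSeq X) => ∏ i, g (c.2 i))] at h2
  simp_rw [integral_prod_cell _ hg (hgi _)] at h2
  rw [Finset.prod_coe_sort (Finset.range n)
    fun k => NormedSpace.exp (∫ x, (g x - 1) ∂m k)] at h2
  rw [← h2]
  refine integral_congr_ae (ae_of_all _ fun ω => ?_)
  exact (Finset.prod_coe_sort (Finset.range n) fun k => ∏ i, g ((ω k).2 i)).symm

lemma norm_cexp_sub_one_le (w : ℂ) : ‖Complex.exp w - 1‖ ≤ Real.exp ‖w‖ - 1 := by
  simpa using Complex.norm_exp_sub_sum_le_exp_norm_sub_sum w 1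

lemma _root_.MeasureTheory.Integrable.of_exp_norm_sub_one {μ : Measure X} {f : X → ℂ}
    (hf : Measurable f) (hi : Integrable (fun x => Real.exp ‖f x‖ - 1) μ) : Integrable f μ := by
  refine hi.mono' hf.aestronglyMeasurable (ae_of_all _ fun x => ?_)
  linarith [Real.add_one_le_exp ‖f x‖]

lemma _root_.MeasureTheory.Integrable.cexp_sub_one {μ : Measure X} {f : X → ℂ}
    (hf : Measurable f) (hi : Integrable (fun x => Real.exp ‖f x‖ - 1) μ) :
    Integrable (fun x => Complex.exp (f x) - 1) μ :=
  hi.mono' (hf.cexp.sub_const 1).aestronglyMeasurable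
    (ae_of_all _ fun x => norm_cexp_sub_one_le (f x))

/-- The Laplace functional of the Poisson process. -/
theorem integral_cexp_points {f : X → ℂ} (hf : Measurable f)
    (hi : Integrable (fun x => Real.exp ‖f x‖ - 1) (Measure.sum m)) :
    ∫ ω, Complex.exp (∫ x, f x ∂points ω) ∂poissonLaw m
      = Complex.exp (∫ x, (Complex.exp (f x) - 1) ∂Measure.sum m) := by
  have h0 := Integrable.of_exp_norm_sub_one hf hi
  have h1 := Integrable.cexp_sub_one hf hi
  have hle : ∀ k, m k ≤ Measure.sum m := Measure.le_sum m
  have hek : ∀ k, Integrable (fun x => Real.exp ‖f x‖) (m k) := fun k =>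
    ((hi.mono_measure (hle k)).add (integrable_const (1 : ℝ))).congr
      (ae_of_all _ fun x => by simp)
  have hck : ∀ k, Integrable (fun x => Complex.exp (f x)) (m k) := fun k =>
    ((h1.mono_measure (hle k)).add (integrable_const (1 : ℂ))).congr
      (ae_of_all _ fun x => by simp)
  -- By Campbell's formula the sum of `‖f‖` over the points has finite mean.
  have hA : ∀ᵐ ω ∂poissonLaw m, Integrable f (points ω) := by
    have := lintegral_lintegral_points m hf.enorm
    have hlt : ∫⁻ ω, ∫⁻ x, ‖f x‖ₑ ∂points ω ∂poissonLaw m ≠ ∞ := by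
      rw [this]; exact h0.2.ne
    filter_upwards [ae_lt_top (measurable_lintegral_points hf.enorm) hlt] with ω hω
    exact ⟨hf.aestronglyMeasurable, hω⟩
  -- `B n` bounds the product over the first `n` cells, and its limit `L` will dominate all of them.
  set B : ℕ → (ℕ → FinSeq X) → ℝ := fun n ω =>
    ∏ k ∈ Finset.range n, ∏ i, Real.exp ‖f ((ω k).2 i)‖ with hB
  set L : (ℕ → FinSeq X) → ℝ := fun ω => Real.exp (∫ x, ‖f x‖ ∂points ω) with hL
  have hBsum : ∀ n ω, B n ω = Real.exp (∑ k ∈ Finset.range n, ∑ i, ‖f ((ω k).2 i)‖) := by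
    intro n ω
    simp only [hB, Real.exp_sum]
  have hBL : ∀ᵐ ω ∂poissonLaw m, Tendsto (fun n => B n ω) atTop (𝓝 (L ω)) := by
    filter_upwards [hA] with ω hω
    simp_rw [hBsum]
    exact (Real.continuous_exp.tendsto _).comp
      (hasSum_integral_points ω hf.norm.stronglyMeasurable hω.norm).tendsto_sum_nat
  have hBle : ∀ᵐ ω ∂poissonLaw m, ∀ n, B n ω ≤ L ω := by
    filter_upwards [hA] with ω hω n
    rw [hBsum]
    have hs := hasSum_integral_points ω hf.norm.stronglyMeasurable hω.norm
    exact Real.exp_le_exp.2 (sum_le_hasSum (Finset.range n)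
      (fun k _ => Finset.sum_nonneg fun i _ => norm_nonneg _) hs)
  have hBint : ∀ n, Integrable (B n) (poissonLaw m) := fun n =>
    integrable_prod_poissonLaw m (g := fun x => Real.exp ‖f x‖) (hf.norm.exp) hek n
  have hLmeas : AEStronglyMeasurable L (poissonLaw m) :=
    aestronglyMeasurable_of_tendsto_ae atTop (fun n => (hBint n).1) hBL
  -- Fatou: the means of `B n` are explicit and bounded by `exp (∫ (e^{‖f‖} - 1))`.
  have hLint : Integrable L (poissonLaw m) := by
    refine ⟨hLmeas, ?_⟩
    rw [HasFiniteIntegral]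
    have hfat : ∫⁻ ω, ‖L ω‖ₑ ∂poissonLaw m
        ≤ liminf (fun n => ∫⁻ ω, ‖B n ω‖ₑ ∂poissonLaw m) atTop := by
      refine le_trans (lintegral_mono_ae ?_)
        (lintegral_liminf_le' fun n => (hBint n).1.enorm)
      filter_upwards [hBL] with ω hω
      exact ((hω.enorm).liminf_eq).ge
    refine lt_of_le_of_lt hfat (lt_of_le_of_lt (b := ENNReal.ofReal
      (Real.exp (∫ x, (Real.exp ‖f x‖ - 1) ∂Measure.sum m))) ?_ ENNReal.ofReal_lt_top)
    refine liminf_le_of_le (by isBoundedDefault) fun b hb => ?_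
    obtain ⟨n, hn⟩ := hb.exists
    refine hn.trans ?_
    rw [← ofReal_integral_norm_eq_lintegral_enorm (hBint n)]
    refine ENNReal.ofReal_le_ofReal ?_
    have : ∀ ω, ‖B n ω‖ = B n ω := fun ω => by
      rw [hBsum]; exact Real.norm_of_nonneg (Real.exp_pos _).le
    simp_rw [this]
    rw [hB, integral_prod_poissonLaw m (g := fun x => Real.exp ‖f x‖) (hf.norm.exp) hek n]
    simp_rw [← Real.exp_eq_exp_ℝ]
    rw [← Real.exp_sum]
    have hs := hasSum_integral_measure hi
    exact Real.exp_le_exp.2 (sum_le_hasSum (Finset.range n)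
      (fun k _ => integral_nonneg fun x => by simp) hs)
  have hG : ∀ n, ∀ ω : ℕ → FinSeq X, ∏ k ∈ Finset.range n, ∏ i, Complex.exp (f ((ω k).2 i))
      = Complex.exp (∑ k ∈ Finset.range n, ∑ i, f ((ω k).2 i)) := by
    intro n ω
    simp only [Complex.exp_sum]
  have hlim : Tendsto (fun n => ∫ ω, ∏ k ∈ Finset.range n, ∏ i, Complex.exp (f ((ω k).2 i))
      ∂poissonLaw m) atTop (𝓝 (∫ ω, Complex.exp (∫ x, f x ∂points ω) ∂poissonLaw m)) := by
    refine tendsto_integral_of_dominated_convergence L (fun n => ?_) hLint (fun n => ?_) ?_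
    · exact (integrable_prod_poissonLaw m (g := fun x => Complex.exp (f x)) hf.cexp hck n).1
    · filter_upwards [hBle] with ω hω
      refine le_trans ?_ (hω n)
      simp only [hB, norm_prod]
      gcongr with k _ i _
      exact Complex.norm_exp_le_exp_norm _
    · filter_upwards [hA] with ω hω
      simp_rw [hG]
      exact (Complex.continuous_exp.tendsto _).comp
        (hasSum_integral_points ω hf.stronglyMeasurable hω).tendsto_sum_nat
  refine tendsto_nhds_unique hlim ?_
  have : ∀ n, ∫ ω, ∏ k ∈ Finset.range n, ∏ i, Complex.exp (f ((ω k).2 i)) ∂poissonLaw m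
      = Complex.exp (∑ k ∈ Finset.range n, ∫ x, (Complex.exp (f x) - 1) ∂m k) := by
    intro n
    rw [integral_prod_poissonLaw m (g := fun x => Complex.exp (f x)) hf.cexp hck n,
      Complex.exp_sum]
    simp_rw [← Complex.exp_eq_exp_ℂ]
  simp_rw [this]
  exact (Complex.continuous_exp.tendsto _).comp
    (hasSum_integral_measure h1).tendsto_sum_nat

end PoissonProcess

/-! ### Poisson random measures: almost sure properties, exponential moments, tilting. -/

section IsPoisson

variable {Ω X : Type*} [MeasurableSpace Ω] [MeasurableSpace X]

/-- Under `P` the random measure `N` is a Poisson random measure with intensity `m`. -/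
structure IsPoisson (N : Kernel Ω X) (m : Measure X) (P : Measure Ω) : Prop where
  prob : IsProbabilityMeasure P
  ae_lintegral_lt_top : ∀ f : X → ℝ≥0∞, Measurable f → ∫⁻ x, f x ∂m < ∞ →
    ∀ᵐ ω ∂P, ∫⁻ x, f x ∂N ω < ∞
  laplace : ∀ f : X → ℂ, Measurable f → Integrable (fun x => Real.exp ‖f x‖ - 1) m →
    ∫ ω, Complex.exp (∫ x, f x ∂N ω) ∂P = Complex.exp (∫ x, (Complex.exp (f x) - 1) ∂m)

/-- From `e^t (1 - t) ≤ 1` one gets `e^t - 1 ≤ t e^t ≤ e^B t` for `0 ≤ t ≤ B`. -/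
lemma integrable_exp_norm_sub_one {E : Type*} [NormedAddCommGroup E] {m : Measure X} {f : X → E}
    {B : ℝ} (hB : ∀ᵐ x ∂m, ‖f x‖ ≤ B) (hi : Integrable f m) :
    Integrable (fun x => Real.exp ‖f x‖ - 1) m := by
  refine (hi.norm.const_mul (Real.exp B)).mono'
    ((Real.continuous_exp.sub continuous_const).comp_aestronglyMeasurable hi.1.norm) ?_
  filter_upwards [hB] with x hx
  rw [Real.norm_of_nonneg (by simp)]
  have h1 : Real.exp ‖f x‖ * (1 - ‖f x‖) ≤ 1 := by
    have := Real.add_one_le_exp (-‖f x‖)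
    calc Real.exp ‖f x‖ * (1 - ‖f x‖) ≤ Real.exp ‖f x‖ * Real.exp (-‖f x‖) := by
          gcongr; linarith
      _ = 1 := by rw [← Real.exp_add]; simp
  have h2 : Real.exp ‖f x‖ * ‖f x‖ ≤ Real.exp B * ‖f x‖ := by gcongr
  linarith

namespace IsPoisson

variable {N : Kernel Ω X} {m : Measure X} {P : Measure Ω}

/-- Almost sure finiteness is applied to the function `∞ · 1_A`, whose `m`-integral is zero; its `N
ω`-integral is finite only if `N ω A = 0`. -/
lemma ae_measure_eq_zero (h : IsPoisson N m P) {A : Set X} (hA : m A = 0) :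
    ∀ᵐ ω ∂P, N ω A = 0 := by
  have hm := measurableSet_toMeasurable m A
  have := h.ae_lintegral_lt_top ((toMeasurable m A).indicator fun _ => ∞)
    (measurable_const.indicator hm) (by simp [lintegral_indicator hm, measure_toMeasurable, hA])
  filter_upwards [this] with ω hω
  rw [lintegral_indicator_const hm] at hω
  refine measure_mono_null (subset_toMeasurable m A) ?_
  by_contra hne
  rw [ENNReal.top_mul hne] at hω
  exact lt_irrefl _ hω

lemma ae_ae (h : IsPoisson N m P) {p : X → Prop} (hp : ∀ᵐ x ∂m, p x) :
    ∀ᵐ ω ∂P, ∀ᵐ x ∂N ω, p x :=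
  h.ae_measure_eq_zero hp

lemma ae_integrable (h : IsPoisson N m P) {E : Type*} [NormedAddCommGroup E]
    {f : X → E} (hf : Integrable f m) : ∀ᵐ ω ∂P, Integrable f (N ω) := by
  obtain ⟨g, hg, hfg⟩ := hf.1
  have h1 := h.ae_lintegral_lt_top (fun x => ‖g x‖ₑ) hg.enorm
    ((integrable_congr hfg).1 hf).2
  filter_upwards [h1, h.ae_ae hfg] with ω hω hω'
  exact (integrable_congr hω').2 ⟨hg.aestronglyMeasurable, hω⟩

/-- A non-integrable function has Bochner integral `0`, but the Laplace formula gives an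
exponential, which never vanishes. -/
lemma integrable_cexp (h : IsPoisson N m P) {f : X → ℂ} (hf : Measurable f)
    (hi : Integrable (fun x => Real.exp ‖f x‖ - 1) m) :
    Integrable (fun ω => Complex.exp (∫ x, f x ∂N ω)) P := by
  by_contra hn
  have := h.laplace f hf hi
  rw [integral_undef hn] at this
  exact Complex.exp_ne_zero _ this.symm

lemma cexp_integral_ofReal (N : Measure X) (f : X → ℝ) :
    Complex.exp (∫ x, (f x : ℂ) ∂N) = ((Real.exp (∫ x, f x ∂N) : ℝ) : ℂ) := by
  rw [integral_complex_ofReal, Complex.ofReal_exp]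

lemma integrable_exp (h : IsPoisson N m P) {f : X → ℝ} (hf : Measurable f)
    (hi : Integrable (fun x => Real.exp ‖f x‖ - 1) m) :
    Integrable (fun ω => Real.exp (∫ x, f x ∂N ω)) P := by
  have := h.integrable_cexp (f := fun x => (f x : ℂ)) (Complex.measurable_ofReal.comp hf)
    (by simpa using hi)
  simp_rw [cexp_integral_ofReal] at this
  exact this.re

lemma integral_exp (h : IsPoisson N m P) {f : X → ℝ} (hf : Measurable f)
    (hi : Integrable (fun x => Real.exp ‖f x‖ - 1) m) :
    ∫ ω, Real.exp (∫ x, f x ∂N ω) ∂P = Real.exp (∫ x, (Real.exp (f x) - 1) ∂m) := by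
  have := h.laplace (fun x => (f x : ℂ)) (Complex.measurable_ofReal.comp hf)
    (by simpa using hi)
  simp_rw [cexp_integral_ofReal] at this
  rw [integral_complex_ofReal] at this
  have h2 : ∀ x, Complex.exp (f x) - 1 = ((Real.exp (f x) - 1 : ℝ) : ℂ) := fun x => by
    push_cast; rfl
  simp_rw [h2, cexp_integral_ofReal] at this
  exact_mod_cast this

/-- Tilting by the exponential of a linear functional gives a Poisson random measure again. -/
theorem tilted (h : IsPoisson N m P) {w : X → ℝ} (hw : Measurable w) {B : ℝ}
    (hB : ∀ᵐ x ∂m, ‖w x‖ ≤ B) (hwi : Integrable w m) :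
    IsPoisson N (m.withDensity fun x => ENNReal.ofReal (Real.exp (w x)))
      (P.tilted fun ω => ∫ x, w x ∂N ω) := by
  have hwe := integrable_exp_norm_sub_one hB hwi
  have hexp := h.integrable_exp hw hwe
  have := h.prob
  have hdm : Measurable fun x => ENNReal.ofReal (Real.exp (w x)) := hw.exp.ennreal_ofReal
  have hlow : ∀ᵐ x ∂m, Real.exp (-B) ≤ Real.exp (w x) := by
    filter_upwards [hB] with x hx
    exact Real.exp_le_exp.2 (neg_le_of_abs_le hx)
  refine ⟨isProbabilityMeasure_tilted hexp, fun f hf hfi => ?_, fun f hf hfi => ?_⟩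
  · refine (tilted_absolutelyContinuous P _).ae_le (h.ae_lintegral_lt_top f hf ?_)
    rw [lintegral_withDensity_eq_lintegral_mul _ hdm hf] at hfi
    -- The density `e^w` is at least `e^{-B}`, so integrability for the new intensity implies it for
    -- the old one.
    have : ENNReal.ofReal (Real.exp (-B)) * ∫⁻ x, f x ∂m < ∞ := by
      rw [← lintegral_const_mul _ hf]
      refine lt_of_le_of_lt (lintegral_mono_ae ?_) hfi
      filter_upwards [hlow] with x hx
      simp only [Pi.mul_apply]
      gcongr
    by_contra hn
    rw [not_lt_top_iff.1 hn, ENNReal.mul_top (by simp [Real.exp_pos])] at this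
    exact lt_irrefl _ this
  · have hfi' : Integrable (fun x => Real.exp ‖f x‖ - 1) m := by
      have h1 := (integrable_withDensity_iff_integrable_smul' hdm (by simp)).1 hfi
      refine (h1.norm.const_mul (Real.exp B)).mono'
        ((hf.norm.exp.sub_const 1).aestronglyMeasurable) ?_
      filter_upwards [hlow] with x hx
      rw [ENNReal.toReal_ofReal (Real.exp_pos _).le, norm_smul, ← mul_assoc]
      refine le_mul_of_one_le_left (norm_nonneg _) ?_
      rw [Real.norm_of_nonneg (Real.exp_pos _).le]
      calc (1 : ℝ) = Real.exp B * Real.exp (-B) := by rw [← Real.exp_add]; simp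
        _ ≤ _ := by gcongr
    have hfint := Integrable.of_exp_norm_sub_one hf hfi'
    -- `e^{‖f + w‖} - 1 ≤ e^{‖w‖} (e^{‖f‖} - 1) + (e^{‖w‖} - 1)`, and `‖w‖ ≤ B`.
    have hsum : Integrable (fun x => Real.exp ‖f x + w x‖ - 1) m := by
      have h1 : Integrable (fun x => Real.exp B * (Real.exp ‖f x‖ - 1) + (Real.exp ‖w x‖ - 1)) m :=
        (hfi'.const_mul _).add hwe
      refine h1.mono' ((hf.add (Complex.measurable_ofReal.comp hw)).norm.exp.sub_const
        1).aestronglyMeasurable ?_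
      filter_upwards [hB] with x hx
      rw [Real.norm_of_nonneg (by simp)]
      have h2 : Real.exp ‖f x + w x‖ ≤ Real.exp ‖w x‖ * Real.exp ‖f x‖ := by
        rw [← Real.exp_add]
        refine Real.exp_le_exp.2 ((norm_add_le _ _).trans ?_)
        rw [Complex.norm_real, add_comm]
      have h3 : Real.exp ‖w x‖ * (Real.exp ‖f x‖ - 1) ≤ Real.exp B * (Real.exp ‖f x‖ - 1) := by
        gcongr
        simp
      linarith
    have hL := h.laplace (fun x => f x + w x) (hf.add (Complex.measurable_ofReal.comp hw)) hsum
    have hZ := h.integral_exp hw hwe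
    rw [integral_tilted, hZ]
    have hcongr : ∀ᵐ ω ∂P, (Real.exp (∫ x, w x ∂N ω) / Real.exp (∫ x, (Real.exp (w x) - 1) ∂m)) •
        Complex.exp (∫ x, f x ∂N ω)
        = (Complex.exp (∫ x, ((Real.exp (w x) - 1 : ℝ) : ℂ) ∂m))⁻¹ *
          Complex.exp (∫ x, (f x + w x) ∂N ω) := by
      filter_upwards [h.ae_integrable hfint, h.ae_integrable hwi] with ω h1 h2
      have h3 : ∫ x, (f x + w x) ∂N ω = ∫ x, f x ∂N ω + ∫ x, (w x : ℂ) ∂N ω :=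
        integral_add h1 h2.ofReal
      rw [h3, Complex.exp_add, cexp_integral_ofReal, cexp_integral_ofReal,
        Complex.real_smul]
      push_cast
      ring
    -- The quotient of the Laplace functionals at `f + w` and `w` has exponent `∫ (e^{f + w} - e^w)
    -- dm = ∫ (e^f - 1) e^w dm`.
    rw [integral_congr_ae hcongr, integral_const_mul, hL, ← Complex.exp_neg, ← Complex.exp_add]
    congr 1
    rw [integral_withDensity_eq_integral_toReal_smul hdm (by simp), neg_add_eq_sub,
      ← integral_sub]
    · refine integral_congr_ae (ae_of_all _ fun x => ?_)
      simp only
      rw [ENNReal.toReal_ofReal (Real.exp_pos _).le, Complex.real_smul, Complex.exp_add]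
      push_cast
      ring
    · exact Integrable.cexp_sub_one (hf.add (Complex.measurable_ofReal.comp hw)) hsum
    · refine (hwe.mono' (hw.exp.sub_const 1).aestronglyMeasurable (ae_of_all _ fun x => ?_)).ofReal
      have := norm_cexp_sub_one_le (w x : ℂ)
      rw [← Complex.ofReal_exp, Complex.norm_real] at this
      refine le_trans (le_of_eq ?_) this
      rw [← Complex.norm_real]
      push_cast
      rfl

end IsPoisson
end IsPoisson

/-! ### Association of independent real random variables. -/

section Harris

lemma integrable_of_abs_le {Ω : Type*} [MeasurableSpace Ω] {P : Measure Ω} [IsFiniteMeasure P]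
    {f : Ω → ℝ} (hf : Measurable f) {B : ℝ} (hB : ∀ x, |f x| ≤ B) : Integrable f P :=
  (integrable_const B).mono' hf.aestronglyMeasurable (ae_of_all _ hB)

lemma abs_integral_le_of_abs_le {Ω : Type*} [MeasurableSpace Ω] {P : Measure Ω}
    [IsProbabilityMeasure P] {f : Ω → ℝ} {B : ℝ} (hB : ∀ x, |f x| ≤ B) : |∫ x, f x ∂P| ≤ B := by
  have := norm_integral_le_of_norm_le_const (μ := P) (f := f) (ae_of_all _ hB)
  simpa using this

/-- Chebyshev's association inequality on the line. -/
lemma integral_mul_le_of_monotone_of_antitone (ν : Measure ℝ) [IsProbabilityMeasure ν]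
    {f k : ℝ → ℝ} (hf : Monotone f) (hk : Antitone k) {B : ℝ} (hfB : ∀ x, |f x| ≤ B)
    (hkB : ∀ x, |k x| ≤ B) : ∫ x, f x * k x ∂ν ≤ (∫ x, f x ∂ν) * ∫ x, k x ∂ν := by
  have hfi : Integrable f ν := integrable_of_abs_le hf.measurable hfB
  have hki : Integrable k ν := integrable_of_abs_le hk.measurable hkB
  have hfk : Integrable (fun x => f x * k x) ν :=
    integrable_of_abs_le (B := B * B) (hf.measurable.mul hk.measurable) fun x => by
      rw [abs_mul]
      exact mul_le_mul (hfB x) (hkB x) (abs_nonneg _) ((abs_nonneg _).trans (hfB x))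
  -- This is `(f x - f y) (k x - k y) ≤ 0`; it is integrated over two independent copies.
  have h1 : ∀ x y, f x * k x + f y * k y ≤ f x * k y + f y * k x := by
    intro x y
    rcases le_total x y with h | h
    · nlinarith [mul_nonneg (sub_nonneg.2 (hf h)) (sub_nonneg.2 (hk h))]
    · nlinarith [mul_nonneg (sub_nonneg.2 (hf h)) (sub_nonneg.2 (hk h))]
  have h2 : ∀ x, f x * k x + ∫ y, f y * k y ∂ν ≤ f x * ∫ y, k y ∂ν + (∫ y, f y ∂ν) * k x := by
    intro x
    have := integral_mono ((integrable_const (f x * k x)).add hfk)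
      ((hki.const_mul (f x)).add (hfi.mul_const (k x))) (h1 x)
    simp only [Pi.add_apply] at this
    rw [integral_add (integrable_const _) hfk, integral_const,
      integral_add (hki.const_mul (f x)) (hfi.mul_const (k x)), integral_const_mul,
      integral_mul_const] at this
    simpa using this
  have h3 := integral_mono (hfk.add (integrable_const (∫ y, f y * k y ∂ν)))
      ((hfi.mul_const (∫ y, k y ∂ν)).add (hki.const_mul (∫ y, f y ∂ν))) h2
  simp only [Pi.add_apply] at h3
  rw [integral_add hfk (integrable_const _), integral_const,
      integral_add (hfi.mul_const _) (hki.const_mul _), integral_const_mul,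
      integral_mul_const] at h3
  simp at h3
  linarith

/-- The Harris inequality for bounded functions. -/
lemma integral_pi_mul_le_of_bounded : ∀ (n : ℕ) (ν : Fin n → Measure ℝ)
    [∀ i, IsProbabilityMeasure (ν i)] (f k : (Fin n → ℝ) → ℝ) (B : ℝ), Measurable f →
    Measurable k → Monotone f → Antitone k → (∀ x, |f x| ≤ B) → (∀ x, |k x| ≤ B) →
    ∫ x, f x * k x ∂Measure.pi ν ≤ (∫ x, f x ∂Measure.pi ν) * ∫ x, k x ∂Measure.pi ν := by
  intro n
  induction n with
  | zero =>
    intro ν _ f k B hfm hkm hf hk hfB hkB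
    have : ∀ g : (Fin 0 → ℝ) → ℝ, ∫ x, g x ∂Measure.pi ν = g default := fun g => by
      have : (fun x => g x) = fun _ => g default := by
        funext x; rw [Subsingleton.elim x default]
      rw [this]; simp
    simp only [this, le_refl]
  | succ n ih =>
    intro ν _ f k B hfm hkm hf hk hfB hkB
    set e := (MeasurableEquiv.piFinSuccAbove (fun _ : Fin (n + 1) => ℝ) 0).symm with he
    set π := Measure.pi fun j : Fin n => ν (Fin.succAbove 0 j)
    have hmp := (measurePreserving_piFinSuccAbove ν 0).symm
    have hmono : ∀ {x x' : ℝ} {y y' : Fin n → ℝ}, x ≤ x' → y ≤ y' → e (x, y) ≤ e (x', y') := by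
      intro x x' y y' hx hy
      simp only [he, MeasurableEquiv.piFinSuccAbove_symm_apply]
      intro i
      refine Fin.cases ?_ (fun j => ?_) i
      · simpa using hx
      · simpa using hy j
    have key : ∀ g : (Fin (n + 1) → ℝ) → ℝ, Measurable g → (∃ B, ∀ x, |g x| ≤ B) →
        ∫ x, g x ∂Measure.pi ν = ∫ x, ∫ y, g (e (x, y)) ∂π ∂ν 0 := by
      intro g hg ⟨B, hB⟩
      rw [← hmp.integral_comp e.measurableEmbedding g]
      refine integral_prod _ (integrable_of_abs_le (hg.comp e.measurable) fun x => hB _)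
    have hBB : ∀ x, |f x * k x| ≤ B * B := fun x => by
      rw [abs_mul]
      exact mul_le_mul (hfB x) (hkB x) (abs_nonneg _) ((abs_nonneg _).trans (hfB x))
    rw [key (fun x => f x * k x) (hfm.mul hkm) ⟨B * B, hBB⟩, key f hfm ⟨B, hfB⟩, key k hkm ⟨B, hkB⟩]
    have hsec : ∀ {g : (Fin (n + 1) → ℝ) → ℝ}, Measurable g → ∀ x,
        Measurable fun y => g (e (x, y)) :=
      fun hg x => hg.comp (e.measurable.comp measurable_prodMk_left)
    have hFm : ∀ {g : (Fin (n + 1) → ℝ) → ℝ}, Measurable g →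
        Measurable fun x => ∫ y, g (e (x, y)) ∂π := fun hg =>
      ((hg.comp e.measurable).stronglyMeasurable.integral_prod_right' (ν := π)).measurable
    -- The induction hypothesis with the first coordinate frozen. The two averages over the other
    -- coordinates stay monotone in the first one, so the inequality on the line finishes.
    have h1 : ∀ x, ∫ y, f (e (x, y)) * k (e (x, y)) ∂π
        ≤ (∫ y, f (e (x, y)) ∂π) * ∫ y, k (e (x, y)) ∂π := fun x =>
      ih (fun j => ν (Fin.succAbove 0 j)) (fun y => f (e (x, y))) (fun y => k (e (x, y))) B
        (hsec hfm x) (hsec hkm x) (fun _ _ h => hf (hmono le_rfl h))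
        (fun _ _ h => hk (hmono le_rfl h)) (fun y => hfB _) (fun y => hkB _)
    have hF : ∀ x, |∫ y, f (e (x, y)) ∂π| ≤ B := fun x =>
      abs_integral_le_of_abs_le fun y => hfB _
    have hK : ∀ x, |∫ y, k (e (x, y)) ∂π| ≤ B := fun x =>
      abs_integral_le_of_abs_le fun y => hkB _
    have h2 := integral_mul_le_of_monotone_of_antitone (ν 0)
      (f := fun x => ∫ y, f (e (x, y)) ∂π) (k := fun x => ∫ y, k (e (x, y)) ∂π)
      (fun x x' h => integral_mono (integrable_of_abs_le (hsec hfm x) fun y => hfB _)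
        (integrable_of_abs_le (hsec hfm x') fun y => hfB _) fun y => hf (hmono h le_rfl))
      (fun x x' h => integral_mono (integrable_of_abs_le (hsec hkm x') fun y => hkB _)
        (integrable_of_abs_le (hsec hkm x) fun y => hkB _) fun y => hk (hmono h le_rfl))
      hF hK
    refine le_trans (integral_mono ?_ ?_ h1) h2
    · exact integrable_of_abs_le (hFm (hfm.mul hkm)) fun x =>
        abs_integral_le_of_abs_le fun y => hBB _
    · refine integrable_of_abs_le (B := B * B) ((hFm hfm).mul (hFm hkm)) fun x => ?_
      rw [abs_mul]
      exact mul_le_mul (hF x) (hK x) (abs_nonneg _) ((abs_nonneg _).trans (hF x))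

/-- Truncation of a real number at the levels `± M`. -/
def truncate (M t : ℝ) : ℝ := max (-M) (min t M)

lemma monotone_truncate (M : ℝ) : Monotone (truncate M) := fun _ _ h =>
  max_le_max le_rfl (min_le_min h le_rfl)

lemma abs_truncate_le {M : ℝ} (hM : 0 ≤ M) (t : ℝ) : |truncate M t| ≤ M := by
  rw [abs_le, truncate]
  exact ⟨le_max_left _ _, max_le (by linarith) (min_le_right _ _)⟩

lemma abs_truncate_le_abs {M : ℝ} (hM : 0 ≤ M) (t : ℝ) : |truncate M t| ≤ |t| := by
  rw [abs_le, truncate]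
  refine ⟨?_, max_le (by linarith [abs_nonneg t]) ((min_le_left _ _).trans (le_abs_self t))⟩
  rcases le_total t M with h | h
  · rw [min_eq_left h]; exact (neg_abs_le t).trans (le_max_right _ _)
  · rw [min_eq_right h]
    exact le_max_of_le_right (by linarith [abs_nonneg t])

lemma tendsto_truncate (t : ℝ) : Tendsto (fun n : ℕ => truncate n t) atTop (𝓝 t) := by
  refine tendsto_const_nhds.congr' ?_
  obtain ⟨n, hn⟩ := exists_nat_ge |t|
  filter_upwards [eventually_ge_atTop n] with m hm
  have hm' : |t| ≤ m := hn.trans (by exact_mod_cast hm)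
  rw [truncate, min_eq_left ((le_abs_self t).trans hm'), max_eq_right]
  linarith [neg_abs_le t]

/-- Independent real random variables are associated. -/
theorem integral_mul_le_of_iIndepFun {Ω : Type*} [MeasurableSpace Ω] {P : Measure Ω}
    [IsProbabilityMeasure P] {ι : Type*} [Fintype ι] {X : ι → Ω → ℝ} (hX : ∀ i, Measurable (X i))
    (hind : iIndepFun X P) {f k : (ι → ℝ) → ℝ} (hfm : Measurable f) (hkm : Measurable k)
    (hf : Monotone f) (hk : Antitone k) (hfi : Integrable (fun ω => f fun i => X i ω) P)
    (hki : Integrable (fun ω => k fun i => X i ω) P)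
    (hfk : Integrable (fun ω => (f fun i => X i ω) * k fun i => X i ω) P) :
    ∫ ω, (f fun i => X i ω) * (k fun i => X i ω) ∂P
      ≤ (∫ ω, f fun i => X i ω ∂P) * ∫ ω, k fun i => X i ω ∂P := by
  classical
  set e := (Fintype.equivFin ι).symm
  have hind' : iIndepFun (fun j => X (e j)) P := hind.precomp e.injective
  have hlaw := (iIndepFun_iff_map_fun_eq_pi_map fun j => (hX (e j)).aemeasurable).1 hind'
  have hXm : Measurable fun ω => fun j => X (e j) ω := measurable_pi_lambda _ fun j => hX (e j)
  have hXm' : Measurable fun ω => fun i => X i ω := measurable_pi_lambda _ hX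
  set re : (Fin (Fintype.card ι) → ℝ) → ι → ℝ := fun x i => x (e.symm i)
  have hre : Measurable re := measurable_pi_lambda _ fun i => measurable_pi_apply _
  have hrem : Monotone re := fun x y h i => h _
  have hreX : ∀ ω, (re fun j => X (e j) ω) = fun i => X i ω := fun ω => by
    funext i; simp [re]
  have : ∀ j, IsProbabilityMeasure (P.map (X (e j))) := fun j =>
    Measure.isProbabilityMeasure_map (hX _).aemeasurable
  -- Truncation preserves monotonicity and does not increase absolute values, so the bounded case
  -- applies and the untruncated functions dominate the limit.
  have hb : ∀ n : ℕ, ∫ ω, truncate n (f fun i => X i ω) * truncate n (k fun i => X i ω) ∂P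
      ≤ (∫ ω, truncate n (f fun i => X i ω) ∂P) * ∫ ω, truncate n (k fun i => X i ω) ∂P := by
    intro n
    have hn : (0 : ℝ) ≤ n := n.cast_nonneg
    have hfn : Measurable fun x => truncate n (f (re x)) :=
      (monotone_truncate n).measurable.comp (hfm.comp hre)
    have hkn : Measurable fun x => truncate n (k (re x)) :=
      (monotone_truncate n).measurable.comp (hkm.comp hre)
    have hfkn : Measurable fun x => truncate n (f (re x)) * truncate n (k (re x)) := hfn.mul hkn
    have := integral_pi_mul_le_of_bounded _ (fun j => P.map (X (e j)))
      (fun x => truncate n (f (re x))) (fun x => truncate n (k (re x))) n hfn hkn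
      (fun x y h => monotone_truncate n (hf (hrem h)))
      (fun x y h => monotone_truncate n (hk (hrem h)))
      (fun x => abs_truncate_le hn _) (fun x => abs_truncate_le hn _)
    rw [← hlaw, integral_map hXm.aemeasurable hfkn.aestronglyMeasurable,
      integral_map hXm.aemeasurable hfn.aestronglyMeasurable,
      integral_map hXm.aemeasurable hkn.aestronglyMeasurable] at this
    simpa only [hreX] using this
  have hmeas : ∀ {g : (ι → ℝ) → ℝ}, Measurable g → ∀ n : ℕ,
      Measurable fun ω => truncate n (g fun i => X i ω) := fun hg n =>
    (monotone_truncate n).measurable.comp (hg.comp hXm')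
  refine le_of_tendsto_of_tendsto' (b := atTop) ?_ (Tendsto.mul ?_ ?_) hb
  · refine tendsto_integral_of_dominated_convergence _
      (fun n => ((hmeas hfm n).mul (hmeas hkm n)).aestronglyMeasurable) hfk.norm
      (fun n => ae_of_all _ fun ω => ?_) (ae_of_all _ fun ω =>
        (tendsto_truncate _).mul (tendsto_truncate _))
    rw [norm_mul, norm_mul]
    exact mul_le_mul (abs_truncate_le_abs n.cast_nonneg _) (abs_truncate_le_abs n.cast_nonneg _)
      (norm_nonneg _) (norm_nonneg _)
  · exact tendsto_integral_of_dominated_convergence _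
      (fun n => (hmeas hfm n).aestronglyMeasurable) hfi.norm
      (fun n => ae_of_all _ fun ω => abs_truncate_le_abs n.cast_nonneg _)
      (ae_of_all _ fun ω => tendsto_truncate _)
  · exact tendsto_integral_of_dominated_convergence _
      (fun n => (hmeas hkm n).aestronglyMeasurable) hki.norm
      (fun n => ae_of_all _ fun ω => abs_truncate_le_abs n.cast_nonneg _)
      (ae_of_all _ fun ω => tendsto_truncate _)

end Harris

/-! ### Independence of charges in disjoint regions. -/

section Independence

variable {Ω X : Type*} [MeasurableSpace Ω] [MeasurableSpace X]
  {N : Kernel Ω X} {m : Measure X} {P : Measure Ω}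

/-- Integrals of functions with disjoint supports against a Poisson random measure are
independent. -/
theorem IsPoisson.iIndepFun_integral (h : IsPoisson N m P) {ι : Type*} [Fintype ι]
    {J : ι → X → ℝ} (hJm : ∀ i, Measurable (J i)) {B : ℝ} (hJB : ∀ i, ∀ᵐ x ∂m, ‖J i x‖ ≤ B)
    (hJi : ∀ i, Integrable (J i) m) (hdisj : ∀ x i j, J i x ≠ 0 → J j x ≠ 0 → i = j) :
    iIndepFun (fun i ω => ∫ x, J i x ∂N ω) P := by
  classical
  have := h.prob
  have hXm : ∀ i, Measurable fun ω => ∫ x, J i x ∂N ω := fun i =>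
    ((hJm i).stronglyMeasurable.integral_kernel).measurable
  -- At most one `J i x` is nonzero. For `F r = e^{ir} - 1` this makes the exponent of the joint
  -- characteristic function a sum, so that the function factorises.
  have hsum : ∀ (t : ι → ℝ) (F : ℝ → ℂ), F 0 = 0 → ∀ x,
      F (∑ i, t i * J i x) = ∑ i, F (t i * J i x) := by
    intro t F hF x
    by_cases hx : ∃ i, J i x ≠ 0
    · obtain ⟨i, hi⟩ := hx
      have hj : ∀ j, j ≠ i → J j x = 0 := fun j hj => by
        by_contra hne
        exact hj (hdisj x j i hne hi)
      rw [Finset.sum_eq_single i, Finset.sum_eq_single i]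
      · intro j _ hne; rw [hj j hne, mul_zero, hF]
      · simp
      · intro j _ hne; rw [hj j hne, mul_zero]
      · simp
    · push Not at hx
      simp [hx, hF]
  have hexpi : ∀ (f : X → ℝ) (B : ℝ), Measurable f → (∀ᵐ x ∂m, ‖f x‖ ≤ B) → Integrable f m →
      Integrable (fun x => Real.exp ‖(f x : ℂ) * Complex.I‖ - 1) m := fun f B hf hB hi => by
    simpa using integrable_exp_norm_sub_one hB hi
  rw [iIndepFun_iff_charFun_pi fun i => (hXm i).aemeasurable]
  intro t
  have hBt : ∀ᵐ x ∂m, ‖∑ i, t i * J i x‖ ≤ ∑ i, |t i| * B := by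
    filter_upwards [ae_all_iff.2 hJB] with x hx
    refine (norm_sum_le _ _).trans (Finset.sum_le_sum fun i _ => ?_)
    rw [norm_mul]
    exact mul_le_mul_of_nonneg_left (hx i) (norm_nonneg _)
  have hint : Integrable (fun x => ∑ i, t i * J i x) m :=
    integrable_finsetSum _ fun i _ => (hJi i).const_mul _
  have hmeasS : Measurable fun x => ∑ i, t i * J i x :=
    Finset.measurable_sum _ fun i _ => (hJm i).const_mul _
  have hLsum := h.laplace (fun x => ((∑ i, t i * J i x : ℝ) : ℂ) * Complex.I)
    ((Complex.measurable_ofReal.comp hmeasS).mul_const _) (hexpi _ _ hmeasS hBt hint)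
  have hL : ∀ i, charFun (P.map fun ω => ∫ x, J i x ∂N ω) (t i)
      = Complex.exp (∫ x, (Complex.exp (((t i * J i x : ℝ) : ℂ) * Complex.I) - 1) ∂m) := by
    intro i
    have hm : Measurable fun x => t i * J i x := (hJm i).const_mul _
    rw [← h.laplace (fun x => ((t i * J i x : ℝ) : ℂ) * Complex.I)
      ((Complex.measurable_ofReal.comp hm).mul_const _)
      (hexpi _ (|t i| * B) hm (by
        filter_upwards [hJB i] with x hx
        rw [norm_mul]
        exact mul_le_mul_of_nonneg_left hx (norm_nonneg _)) ((hJi i).const_mul _)),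
      charFun_apply_real, integral_map (hXm i).aemeasurable (by fun_prop)]
    refine integral_congr_ae (ae_of_all _ fun ω => ?_)
    simp only
    rw [integral_mul_const, integral_complex_ofReal, integral_const_mul]
    push_cast
    ring_nf
  simp_rw [hL, ← Complex.exp_sum]
  rw [← integral_finsetSum]
  · have : ∀ x, ∑ i, (Complex.exp (((t i * J i x : ℝ) : ℂ) * Complex.I) - 1)
        = Complex.exp (((∑ i, t i * J i x : ℝ) : ℂ) * Complex.I) - 1 := fun x =>
      (hsum t (fun r => Complex.exp ((r : ℂ) * Complex.I) - 1) (by simp) x).symm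
    simp_rw [this]
    rw [← hLsum, charFun_apply, integral_map]
    · refine integral_congr_ae ?_
      filter_upwards [ae_all_iff.2 fun i => h.ae_integrable (hJi i)] with ω hω
      rw [integral_mul_const, integral_complex_ofReal, integral_finsetSum _ fun i _ =>
        (hω i).const_mul _]
      simp only [integral_const_mul, PiLp.inner_apply]
      simp
    · exact (WithLp.measurable_toLp 2 _).comp_aemeasurable
        (measurable_pi_lambda _ hXm).aemeasurable
    · fun_prop
  · intro i _
    have hm : Measurable fun x => t i * J i x := (hJm i).const_mul _
    exact Integrable.cexp_sub_one ((Complex.measurable_ofReal.comp hm).mul_const _)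
      (hexpi _ (|t i| * B) hm (by
        filter_upwards [hJB i] with x hx
        rw [norm_mul]
        exact mul_le_mul_of_nonneg_left hx (norm_nonneg _)) ((hJi i).const_mul _))

end Independence

/-! ### Dominated convergence for observables and Boltzmann factors. -/

section Observables

variable {Ω Y Z : Type*} [MeasurableSpace Ω] [MeasurableSpace Y] [MeasurableSpace Z]

/-- The observable `H (∫ s h₁(y) dN, …, ∫ s hₙ(y) dN)`. -/
def observable (N : Kernel Ω (ℝ × Y)) {n : ℕ} (H : (Fin n → ℝ) → ℝ) (h : Fin n → Y → ℝ) (ω : Ω) : ℝ :=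
  H fun l => ∫ p, p.1 * h l p.2 ∂N ω

/-- The Boltzmann factor `exp (-∫ q(∫ s Γ(x, y) dN) dγ(x))`. -/
def boltzmann (N : Kernel Ω (ℝ × Y)) (γ : Measure Z) (q : ℝ → ℝ) (Γ : Z → Y → ℝ) (ω : Ω) : ℝ :=
  Real.exp (-∫ x, q (∫ p, p.1 * Γ x p.2 ∂N ω) ∂γ)

variable {N : Kernel Ω (ℝ × Y)} [IsSFiniteKernel N] {γ : Measure Z} [IsFiniteMeasure γ]

lemma measurable_observable {n : ℕ} {H : (Fin n → ℝ) → ℝ} (hH : Continuous H)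
    {h : Fin n → Y → ℝ} (hh : ∀ l, Measurable (h l)) : Measurable (observable N H h) := by
  refine hH.measurable.comp (measurable_pi_lambda _ fun l => ?_)
  have : Measurable fun p : ℝ × Y => p.1 * h l p.2 :=
    measurable_fst.mul ((hh l).comp measurable_snd)
  exact (this.stronglyMeasurable.integral_kernel).measurable

lemma stronglyMeasurable_field {Γ : Z → Y → ℝ} (hΓ : Measurable (Function.uncurry Γ)) :
    StronglyMeasurable fun a : Ω × Z => ∫ p, p.1 * Γ a.2 p.2 ∂N a.1 := by
  have h1 : StronglyMeasurable (Function.uncurry fun (a : Ω × Z) (p : ℝ × Y) => p.1 * Γ a.2 p.2) := by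
    refine Measurable.stronglyMeasurable ?_
    have : Measurable fun b : (Ω × Z) × ℝ × Y => Function.uncurry Γ (b.1.2, b.2.2) :=
      hΓ.comp (by fun_prop)
    exact (measurable_fst.comp measurable_snd).mul this
  exact StronglyMeasurable.integral_kernel_prod_right (κ := N.comap Prod.fst measurable_fst) h1

lemma measurable_boltzmann {q : ℝ → ℝ} (hq : Continuous q) {Γ : Z → Y → ℝ}
    (hΓ : Measurable (Function.uncurry Γ)) : Measurable (boltzmann N γ q Γ) := by
  have h1 := hq.comp_stronglyMeasurable (stronglyMeasurable_field (N := N) hΓ)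
  exact (h1.integral_prod_right' (ν := γ)).measurable.neg.exp

/-- Domination of the data of an observable and a Boltzmann factor. -/
structure Envelope (m : Measure (ℝ × Y)) (γ : Measure Z) (C : ℝ) (hbar : Y → ℝ)
    (Γbar : Z → Y → ℝ) : Prop where
  abs_le : ∀ᵐ p ∂m, |p.1| ≤ C
  meas_h : Measurable hbar
  nonneg_h : ∀ y, 0 ≤ hbar y
  int_h : Integrable (fun p => hbar p.2) m
  bdd_h : ∃ B, ∀ y, hbar y ≤ B
  meas_Γ : Measurable (Function.uncurry Γbar)
  nonneg_Γ : ∀ x y, 0 ≤ Γbar x y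
  int_Γ : ∀ᵐ p ∂m, Integrable (fun x => Γbar x p.2) γ
  int_u : Integrable (fun p => ∫ x, Γbar x p.2 ∂γ) m
  bdd_u : ∃ B, ∀ y, ∫ x, Γbar x y ∂γ ≤ B

variable {m : Measure (ℝ × Y)} {P : Measure Ω} {C : ℝ} {hbar : Y → ℝ} {Γbar : Z → Y → ℝ}

namespace Envelope

lemma ae_integrable_prod (e : Envelope m γ C hbar Γbar) (hP : IsPoisson N m P) :
    ∀ᵐ ω ∂P, Integrable (fun a : (ℝ × Y) × Z => Γbar a.2 a.1.2) ((N ω).prod γ) := by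
  filter_upwards [hP.ae_ae e.int_Γ, hP.ae_integrable e.int_u] with ω h1 h2
  have hm : Measurable fun a : (ℝ × Y) × Z => Γbar a.2 a.1.2 :=
    e.meas_Γ.comp (f := fun a : (ℝ × Y) × Z => (a.2, a.1.2)) (by fun_prop)
  refine (integrable_prod_iff hm.aestronglyMeasurable).2 ⟨h1, ?_⟩
  simpa only [Real.norm_of_nonneg (e.nonneg_Γ _ _)] using h2

/-- The exponent of the dominating function. -/
def weight (_ : Envelope m γ C hbar Γbar) (a L : ℝ) (p : ℝ × Y) : ℝ :=
  a * C * hbar p.2 + L * C * ∫ x, Γbar x p.2 ∂γ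

/-- The weight is bounded and integrable, so its exponential moment is finite. This gives one
dominating function for the observable, the Boltzmann factor and their product. -/
lemma integrable_exp_weight (e : Envelope m γ C hbar Γbar) (hP : IsPoisson N m P) (a L : ℝ) :
    Integrable (fun ω => Real.exp (∫ p, e.weight a L p ∂N ω)) P := by
  obtain ⟨B, hB⟩ := e.bdd_h
  obtain ⟨B', hB'⟩ := e.bdd_u
  have hu : Measurable fun y => ∫ x, Γbar x y ∂γ :=
    ((e.meas_Γ.comp measurable_swap).stronglyMeasurable.integral_prod_right' (ν := γ)).measurable
  refine hP.integrable_exp ?_ (integrable_exp_norm_sub_one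
    (B := |a * C| * B + |L * C| * B') (ae_of_all _ fun p => ?_)
    ((e.int_h.const_mul (a * C)).add (e.int_u.const_mul (L * C))))
  · exact ((e.meas_h.comp measurable_snd).const_mul _).add ((hu.comp measurable_snd).const_mul _)
  · refine (norm_add_le _ _).trans ?_
    rw [norm_mul (a * C), norm_mul (L * C), Real.norm_of_nonneg (e.nonneg_h _),
      Real.norm_of_nonneg (integral_nonneg fun x => e.nonneg_Γ x _)]
    exact add_le_add (mul_le_mul_of_nonneg_left (hB _) (abs_nonneg _))
      (mul_le_mul_of_nonneg_left (hB' _) (abs_nonneg _))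

variable {n : ℕ} {H : (Fin n → ℝ) → ℝ} {q : ℝ → ℝ} {κ K L : ℝ}

lemma ae_abs_observable_le (e : Envelope m γ C hbar Γbar) (hP : IsPoisson N m P)
    (hκ : 0 ≤ κ) (hK : 0 ≤ K) (hH : ∀ x, |H x| ≤ K * Real.exp (κ * ∑ i, |x i|))
    {h : Fin n → Y → ℝ} (hh : ∀ᵐ p ∂m, ∀ l, |h l p.2| ≤ hbar p.2) :
    ∀ᵐ ω ∂P, |observable N H h ω| ≤ K * Real.exp (∫ p, (κ * n) * C * hbar p.2 ∂N ω) := by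
  filter_upwards [hP.ae_ae hh, hP.ae_ae e.abs_le, hP.ae_integrable e.int_h] with ω h1 h2 h3
  refine (hH _).trans ?_
  gcongr
  have : ∀ l, |∫ p, p.1 * h l p.2 ∂N ω| ≤ ∫ p, C * hbar p.2 ∂N ω := fun l => by
    refine norm_integral_le_of_norm_le (f := fun p : ℝ × Y => p.1 * h l p.2) (h3.const_mul C) ?_
    filter_upwards [h1, h2] with p hp1 hp2
    rw [norm_mul]
    exact mul_le_mul hp2 (hp1 l) (abs_nonneg _) ((abs_nonneg _).trans hp2)
  calc κ * ∑ l, |∫ p, p.1 * h l p.2 ∂N ω| ≤ κ * ∑ _l : Fin n, ∫ p, C * hbar p.2 ∂N ω := by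
        gcongr with l _; exact this l
    _ = _ := by
        simp only [Finset.sum_const, Finset.card_univ, Fintype.card_fin, nsmul_eq_mul, mul_assoc,
          integral_const_mul]

lemma ae_integral_abs_field_le (e : Envelope m γ C hbar Γbar) (hP : IsPoisson N m P)
    (hqL : ∀ t, |q t| ≤ L * |t|) (hL : 0 ≤ L) {Γ : Z → Y → ℝ}
    (hΓ : ∀ᵐ p ∂m, ∀ᵐ x ∂γ, |Γ x p.2| ≤ Γbar x p.2) (hΓm : Measurable (Function.uncurry Γ)) :
    ∀ᵐ ω ∂P, ∀ᵐ x ∂γ, |q (∫ p, p.1 * Γ x p.2 ∂N ω)| ≤ L * (C * ∫ p, Γbar x p.2 ∂N ω) := by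
  filter_upwards [hP.ae_ae hΓ, hP.ae_ae e.abs_le, e.ae_integrable_prod hP] with ω h1 h2 h3
  have hms : MeasurableSet {a : (ℝ × Y) × Z | |Γ a.2 a.1.2| ≤ Γbar a.2 a.1.2} := by
    refine measurableSet_le ?_ ?_
    · exact (hΓm.comp (f := fun a : (ℝ × Y) × Z => (a.2, a.1.2)) (by fun_prop)).abs
    · exact e.meas_Γ.comp (f := fun a : (ℝ × Y) × Z => (a.2, a.1.2)) (by fun_prop)
  filter_upwards [(Measure.ae_ae_comm hms).1 h1, h3.prod_left_ae] with x hx1 hx3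
  refine (hqL _).trans ?_
  gcongr
  rw [← integral_const_mul]
  refine norm_integral_le_of_norm_le (f := fun p : ℝ × Y => p.1 * Γ x p.2) (hx3.const_mul C) ?_
  filter_upwards [hx1, h2] with p hp1 hp2
  rw [norm_mul]
  exact mul_le_mul hp2 hp1 (abs_nonneg _) ((abs_nonneg _).trans hp2)

/-- The linear bound on `q` controls the energy by an integral of the field, and Fubini rewrites
this as a linear functional of the atoms. -/
lemma ae_boltzmann_le (e : Envelope m γ C hbar Γbar) (hP : IsPoisson N m P)
    (hqL : ∀ t, |q t| ≤ L * |t|) (hL : 0 ≤ L) {Γ : Z → Y → ℝ}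
    (hΓ : ∀ᵐ p ∂m, ∀ᵐ x ∂γ, |Γ x p.2| ≤ Γbar x p.2) (hΓm : Measurable (Function.uncurry Γ)) :
    ∀ᵐ ω ∂P, boltzmann N γ q Γ ω ≤ Real.exp (∫ p, L * C * ∫ x, Γbar x p.2 ∂γ ∂N ω) := by
  filter_upwards [e.ae_integral_abs_field_le hP hqL hL hΓ hΓm, e.ae_integrable_prod hP]
    with ω h1 h2
  refine Real.exp_le_exp.2 ?_
  have h3 := norm_integral_le_of_norm_le
    (f := fun x => q (∫ p, p.1 * Γ x p.2 ∂N ω)) ((h2.integral_prod_right.const_mul C).const_mul L) h1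
  refine (neg_le_abs _).trans (h3.trans (le_of_eq ?_))
  have h4 := integral_integral_swap (f := fun (p : ℝ × Y) x => Γbar x p.2) h2
  rw [integral_const_mul, integral_const_mul, integral_const_mul, mul_assoc]
  exact congrArg (fun t => L * (C * t)) h4.symm

/-- All bounds that are needed for dominated convergence. -/
lemma ae_bounds (e : Envelope m γ C hbar Γbar) (hP : IsPoisson N m P) (hC : 0 ≤ C)
    (hκ : 0 ≤ κ) (hK : 0 ≤ K) (hH : ∀ x, |H x| ≤ K * Real.exp (κ * ∑ i, |x i|))
    (hqL : ∀ t, |q t| ≤ L * |t|) (hL : 0 ≤ L)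
    {h : Fin n → Y → ℝ} (hh : ∀ᵐ p ∂m, ∀ l, |h l p.2| ≤ hbar p.2) {Γ : Z → Y → ℝ}
    (hΓ : ∀ᵐ p ∂m, ∀ᵐ x ∂γ, |Γ x p.2| ≤ Γbar x p.2) (hΓm : Measurable (Function.uncurry Γ)) :
    ∀ᵐ ω ∂P, |observable N H h ω| ≤ K * Real.exp (∫ p, e.weight (κ * n) L p ∂N ω) ∧
      |boltzmann N γ q Γ ω| ≤ Real.exp (∫ p, e.weight (κ * n) L p ∂N ω) ∧
      |observable N H h ω * boltzmann N γ q Γ ω|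
        ≤ K * Real.exp (∫ p, e.weight (κ * n) L p ∂N ω) := by
  filter_upwards [e.ae_abs_observable_le hP hκ hK hH hh, e.ae_boltzmann_le hP hqL hL hΓ hΓm,
    hP.ae_integrable e.int_h, hP.ae_integrable e.int_u] with ω h1 h2 h3 h4
  have hsum : ∫ p, e.weight (κ * n) L p ∂N ω
      = ∫ p, (κ * n) * C * hbar p.2 ∂N ω + ∫ p, L * C * ∫ x, Γbar x p.2 ∂γ ∂N ω :=
    integral_add (h3.const_mul _) (h4.const_mul _)
  have hb : |boltzmann N γ q Γ ω| = boltzmann N γ q Γ ω := abs_of_pos (Real.exp_pos _)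
  have n1 : 0 ≤ ∫ p, (κ * n) * C * hbar p.2 ∂N ω :=
    integral_nonneg fun p => mul_nonneg (by positivity) (e.nonneg_h _)
  have n2 : 0 ≤ ∫ p, L * C * ∫ x, Γbar x p.2 ∂γ ∂N ω :=
    integral_nonneg fun p => mul_nonneg (by positivity) (integral_nonneg fun x => e.nonneg_Γ _ _)
  rw [abs_mul, hb, hsum]
  refine ⟨h1.trans ?_, h2.trans ?_, ?_⟩
  · gcongr; linarith
  · gcongr; linarith
  · rw [Real.exp_add, ← mul_assoc]
    exact mul_le_mul h1 h2 (Real.exp_pos _).le (by positivity)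

lemma integrable_observable_boltzmann (e : Envelope m γ C hbar Γbar) (hP : IsPoisson N m P)
    (hC : 0 ≤ C) (hκ : 0 ≤ κ) (hK : 0 ≤ K) (hHc : Continuous H)
    (hH : ∀ x, |H x| ≤ K * Real.exp (κ * ∑ i, |x i|)) (hqc : Continuous q)
    (hqL : ∀ t, |q t| ≤ L * |t|) (hL : 0 ≤ L) {h : Fin n → Y → ℝ} (hhm : ∀ l, Measurable (h l))
    (hh : ∀ᵐ p ∂m, ∀ l, |h l p.2| ≤ hbar p.2) {Γ : Z → Y → ℝ}
    (hΓ : ∀ᵐ p ∂m, ∀ᵐ x ∂γ, |Γ x p.2| ≤ Γbar x p.2) (hΓm : Measurable (Function.uncurry Γ)) :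
    Integrable (observable N H h) P ∧ Integrable (boltzmann N γ q Γ) P ∧
      Integrable (fun ω => observable N H h ω * boltzmann N γ q Γ ω) P := by
  have hb := e.ae_bounds hP hC hκ hK hH hqL hL hh hΓ hΓm
  have hi := e.integrable_exp_weight hP (κ * n) L
  have m1 := measurable_observable (N := N) hHc hhm
  have m2 := measurable_boltzmann (N := N) (γ := γ) hqc hΓm
  exact ⟨(hi.const_mul K).mono' m1.aestronglyMeasurable (hb.mono fun _ h => h.1),
    hi.mono' m2.aestronglyMeasurable (hb.mono fun _ h => h.2.1),
    (hi.const_mul K).mono' (m1.mul m2).aestronglyMeasurable (hb.mono fun _ h => h.2.2)⟩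

/-- The correlation inequality is stable under dominated convergence of the data. -/
theorem integral_mul_le_of_tendsto (e : Envelope m γ C hbar Γbar) (hP : IsPoisson N m P)
    (hC : 0 ≤ C) (hκ : 0 ≤ κ) (hK : 0 ≤ K) (hHc : Continuous H)
    (hH : ∀ x, |H x| ≤ K * Real.exp (κ * ∑ i, |x i|)) (hqc : Continuous q)
    (hqL : ∀ t, |q t| ≤ L * |t|) (hL : 0 ≤ L)
    {h : Fin n → Y → ℝ} {h' : ℕ → Fin n → Y → ℝ} (hhm : ∀ j l, Measurable (h' j l))
    (hh : ∀ j, ∀ᵐ p ∂m, ∀ l, |h' j l p.2| ≤ hbar p.2)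
    (hht : ∀ᵐ p ∂m, ∀ l, Tendsto (fun j => h' j l p.2) atTop (𝓝 (h l p.2)))
    {Γ : Z → Y → ℝ} {Γ' : ℕ → Z → Y → ℝ}
    (hΓm : Measurable (Function.uncurry Γ)) (hΓm' : ∀ j, Measurable (Function.uncurry (Γ' j)))
    (hΓ : ∀ j, ∀ᵐ p ∂m, ∀ᵐ x ∂γ, |Γ' j x p.2| ≤ Γbar x p.2)
    (hΓt : ∀ᵐ p ∂m, ∀ᵐ x ∂γ, Tendsto (fun j => Γ' j x p.2) atTop (𝓝 (Γ x p.2)))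
    (hle : ∀ j, ∫ ω, observable N H (h' j) ω * boltzmann N γ q (Γ' j) ω ∂P
      ≤ (∫ ω, observable N H (h' j) ω ∂P) * ∫ ω, boltzmann N γ q (Γ' j) ω ∂P) :
    ∫ ω, observable N H h ω * boltzmann N γ q Γ ω ∂P
      ≤ (∫ ω, observable N H h ω ∂P) * ∫ ω, boltzmann N γ q Γ ω ∂P := by
  have hb : ∀ j, _ := fun j => e.ae_bounds hP hC hκ hK hH hqL hL (hh j) (hΓ j) (hΓm' j)
  have hi := e.integrable_exp_weight hP (κ * n) L
  have m1 : ∀ j, Measurable (observable N H (h' j)) := fun j => measurable_observable hHc (hhm j)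
  have m2 : ∀ j, Measurable (boltzmann N γ q (Γ' j)) := fun j => measurable_boltzmann hqc (hΓm' j)
  have t1 : ∀ᵐ ω ∂P, Tendsto (fun j => observable N H (h' j) ω) atTop
      (𝓝 (observable N H h ω)) := by
    filter_upwards [hP.ae_ae hht, hP.ae_integrable e.int_h, hP.ae_ae e.abs_le,
      ae_all_iff.2 fun j => hP.ae_ae (hh j)] with ω w1 w2 w3 w4
    refine (hHc.tendsto _).comp (tendsto_pi_nhds.2 fun l => ?_)
    refine tendsto_integral_of_dominated_convergence (fun p => C * hbar p.2) (fun j => ?_)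
      (w2.const_mul C) (fun j => ?_) ?_
    · exact (measurable_fst.mul ((hhm j l).comp measurable_snd)).aestronglyMeasurable
    · filter_upwards [w4 j, w3] with p hp1 hp2
      rw [norm_mul]
      exact mul_le_mul hp2 (hp1 l) (abs_nonneg _) ((abs_nonneg _).trans hp2)
    · filter_upwards [w1] with p hp
      exact (hp l).const_mul _
  -- Dominated convergence twice: for the field at almost every `x`, then for the energy as an
  -- integral over `x`.
  have t2 : ∀ᵐ ω ∂P, Tendsto (fun j => boltzmann N γ q (Γ' j) ω) atTop
      (𝓝 (boltzmann N γ q Γ ω)) := by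
    filter_upwards [hP.ae_ae hΓt, e.ae_integrable_prod hP, hP.ae_ae e.abs_le,
      ae_all_iff.2 fun j => hP.ae_ae (hΓ j),
      ae_all_iff.2 fun j => e.ae_integral_abs_field_le hP hqL hL (hΓ j) (hΓm' j)]
      with ω w1 w2 w3 w4 w5
    refine (Real.continuous_exp.tendsto _).comp (Tendsto.neg ?_)
    have hcp : Measurable fun a : (ℝ × Y) × Z => (a.2, a.1.2) := by fun_prop
    -- The hypotheses say "for almost every `p`, for almost every `x`", but the field at fixed `x`
    -- needs the other order; the exchange requires a measurable set.
    have hms : MeasurableSet {a : (ℝ × Y) × Z |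
        Tendsto (fun j => Γ' j a.2 a.1.2) atTop (𝓝 (Γ a.2 a.1.2))} := by
      have : {a : (ℝ × Y) × Z | Tendsto (fun j => Γ' j a.2 a.1.2) atTop (𝓝 (Γ a.2 a.1.2))}
          = {a | Tendsto (fun j => Γ' j a.2 a.1.2 - Γ a.2 a.1.2) atTop (𝓝 0)} := by
        ext a
        exact tendsto_sub_nhds_zero_iff.symm
      rw [this]
      exact measurableSet_tendsto _ fun j => ((hΓm' j).comp hcp).sub (hΓm.comp hcp)
    have hms' : ∀ j, MeasurableSet {a : (ℝ × Y) × Z | |Γ' j a.2 a.1.2| ≤ Γbar a.2 a.1.2} :=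
      fun j => measurableSet_le ((hΓm' j).comp hcp).abs (e.meas_Γ.comp hcp)
    refine tendsto_integral_of_dominated_convergence
      (fun x => L * (C * ∫ p, Γbar x p.2 ∂N ω)) (fun j => ?_)
      ((w2.integral_prod_right.const_mul C).const_mul L) w5 ?_
    · exact ((hqc.comp_stronglyMeasurable (stronglyMeasurable_field (N := N) (hΓm' j))).comp_measurable
        measurable_prodMk_left).aestronglyMeasurable
    · filter_upwards [(Measure.ae_ae_comm hms).1 w1, w2.prod_left_ae,
        ae_all_iff.2 fun j => (Measure.ae_ae_comm (hms' j)).1 (w4 j)] with x x1 x2 x3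
      refine (hqc.tendsto _).comp ?_
      refine tendsto_integral_of_dominated_convergence (fun p => C * Γbar x p.2) (fun j => ?_)
        (x2.const_mul C) (fun j => ?_) ?_
      · exact (measurable_fst.mul ((hΓm' j).comp
          (measurable_prodMk_left.comp measurable_snd))).aestronglyMeasurable
      · filter_upwards [x3 j, w3] with p hp1 hp2
        rw [norm_mul]
        exact mul_le_mul hp2 hp1 (abs_nonneg _) ((abs_nonneg _).trans hp2)
      · filter_upwards [x1] with p hp
        exact hp.const_mul _
  refine le_of_tendsto_of_tendsto' (b := atTop) ?_ (Tendsto.mul ?_ ?_) hle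
  · exact tendsto_integral_of_dominated_convergence _
      (fun j => ((m1 j).mul (m2 j)).aestronglyMeasurable) (hi.const_mul K)
      (fun j => (hb j).mono fun _ h => h.2.2) (by
        filter_upwards [t1, t2] with ω a b using a.mul b)
  · exact tendsto_integral_of_dominated_convergence _
      (fun j => (m1 j).aestronglyMeasurable) (hi.const_mul K) (fun j => (hb j).mono fun _ h => h.1) t1
  · exact tendsto_integral_of_dominated_convergence _
      (fun j => (m2 j).aestronglyMeasurable) hi (fun j => (hb j).mono fun _ h => h.2.1) t2

end Envelope
end Observables

/-- The coordinates of `x` are replaced by those of `y` one at a time. -/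
lemma monotone_of_monotone_update {n : ℕ} {H : (Fin n → ℝ) → ℝ}
    (hH : ∀ (x : Fin n → ℝ) (i : Fin n), Monotone fun t => H (Function.update x i t)) :
    Monotone H := by
  intro x y hxy
  have key : ∀ s : Finset (Fin n), H x ≤ H (s.piecewise y x) := by
    intro s
    induction s using Finset.induction_on with
    | empty => simp
    | insert i s hi ih =>
      refine ih.trans ?_
      rw [Finset.piecewise_insert]
      have h1 := hH (s.piecewise y x) i (hxy i)
      simp only at h1
      rwa [show Function.update (s.piecewise y x) i (x i) = s.piecewise y x by
        rw [Function.update_eq_self_iff, Finset.piecewise_eq_of_notMem _ _ _ hi]] at h1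
  simpa using key Finset.univ

/-! ### The correlation inequality for data constant on finitely many cells. -/

section Discrete

variable {Ω Y Z : Type*} [MeasurableSpace Ω] [MeasurableSpace Y] [MeasurableSpace Z]
variable {N : Kernel Ω (ℝ × Y)} [IsSFiniteKernel N] {γ : Measure Z} [IsFiniteMeasure γ]
variable {m : Measure (ℝ × Y)} {P : Measure Ω} {C : ℝ}

/-- The correlation inequality for functionals of finitely many independent total charges. -/
theorem IsPoisson.integral_mul_le_of_simpleFunc (hP : IsPoisson N m P)
    (habs : ∀ᵐ p ∂m, |p.1| ≤ C) (c : SimpleFunc Y Y) {Λ : Set Y} (hΛ : MeasurableSet Λ)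
    (hΛm : m (Prod.snd ⁻¹' Λ) < ∞) {n : ℕ} {H : (Fin n → ℝ) → ℝ} (hHc : Continuous H)
    (hH : Monotone H) {h : Fin n → Y → ℝ} (hh : ∀ l y, 0 ≤ h l y) {q : ℝ → ℝ}
    (hqc : Continuous q) (hq : Monotone q) {L : ℝ} (hqL : ∀ t, |q t| ≤ L * |t|) {Γ : Z → Y → ℝ}
    (hΓ : ∀ x y, 0 ≤ Γ x y) (hΓm : Measurable (Function.uncurry Γ))
    (hΓi : ∀ y, Integrable (fun x => Γ x y) γ)
    (hint1 : Integrable (observable N H fun l => Λ.indicator fun y => h l (c y)) P)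
    (hint2 : Integrable (boltzmann N γ q fun x => Λ.indicator fun y => Γ x (c y)) P)
    (hint3 : Integrable (fun ω => observable N H (fun l => Λ.indicator fun y => h l (c y)) ω *
      boltzmann N γ q (fun x => Λ.indicator fun y => Γ x (c y)) ω) P) :
    ∫ ω, observable N H (fun l => Λ.indicator fun y => h l (c y)) ω *
      boltzmann N γ q (fun x => Λ.indicator fun y => Γ x (c y)) ω ∂P
      ≤ (∫ ω, observable N H (fun l => Λ.indicator fun y => h l (c y)) ω ∂P) *
        ∫ ω, boltzmann N γ q (fun x => Λ.indicator fun y => Γ x (c y)) ω ∂P := by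
  classical
  have := hP.prob
  -- Integrating `J i` against the atoms yields the total charge in the cell of `Λ` where `c` takes
  -- the value `i`.
  set J : c.range → ℝ × Y → ℝ := fun i p =>
    (Λ ∩ c ⁻¹' {i.1}).indicator (fun _ => p.1) p.2 with hJ
  have hJm : ∀ i, Measurable (J i) := by
    intro i
    have : J i = (Prod.snd ⁻¹' (Λ ∩ c ⁻¹' {i.1})).indicator Prod.fst := by
      funext p; simp [hJ, Set.indicator]
    rw [this]
    exact measurable_fst.indicator (measurable_snd (hΛ.inter (c.measurableSet_fiber _)))
  have hJle : ∀ᵐ p ∂m, ∀ i, ‖J i p‖ ≤ (Prod.snd ⁻¹' Λ).indicator (fun _ => C) p := by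
    filter_upwards [habs] with p hp i
    by_cases h1 : p.2 ∈ Λ
    · by_cases h2 : c p.2 = i
      · simpa [hJ, Set.indicator, h1, h2] using hp
      · simpa [hJ, Set.indicator, h1, h2] using (abs_nonneg _).trans hp
    · simp [hJ, Set.indicator, h1]
  have hJi : ∀ i, Integrable (J i) m := fun i =>
    ((integrable_indicator_iff (measurable_snd hΛ)).2
      (integrableOn_const (hΛm.ne))).mono' (hJm i).aestronglyMeasurable
      (hJle.mono fun p hp => hp i)
  have hJB : ∀ i, ∀ᵐ p ∂m, ‖J i p‖ ≤ |C| := fun i => by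
    filter_upwards [hJle] with p hp
    refine (hp i).trans ?_
    by_cases h1 : p.2 ∈ Λ <;> simp [Set.indicator, h1, le_abs_self]
  have hind := hP.iIndepFun_integral hJm hJB hJi (by
    intro p i j hi hj
    simp only [hJ, ne_eq, Set.indicator_apply_eq_zero, Classical.not_imp, Set.mem_inter_iff,
      Set.mem_preimage, Set.mem_singleton_iff] at hi hj
    exact Subtype.ext (hi.1.2.symm.trans hj.1.2))
  have hXm : ∀ i, Measurable fun ω => ∫ p, J i p ∂N ω := fun i =>
    ((hJm i).stronglyMeasurable.integral_kernel).measurable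
  have hdec : ∀ (f : Y → ℝ) (p : ℝ × Y),
      p.1 * Λ.indicator (fun y => f (c y)) p.2 = ∑ i : c.range, f i * J i p := by
    intro f p
    rw [Finset.sum_eq_single ⟨c p.2, c.mem_range_self p.2⟩]
    · by_cases h1 : p.2 ∈ Λ <;> simp [hJ, Set.indicator, h1, mul_comm]
    · intro i _ hi
      have : c p.2 ≠ i := fun h => hi (Subtype.ext h.symm)
      simp [hJ, Set.indicator, this]
    · simp
  -- One null set serves all `f`; this matters because `f = Γ x` is used for all `x` at once.
  have hae : ∀ᵐ ω ∂P, ∀ f : Y → ℝ, ∫ p, p.1 * Λ.indicator (fun y => f (c y)) p.2 ∂N ω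
      = ∑ i : c.range, f i * ∫ p, J i p ∂N ω := by
    filter_upwards [ae_all_iff.2 fun i => hP.ae_integrable (hJi i)] with ω hω f
    simp_rw [hdec f]
    rw [integral_finsetSum _ fun i _ => (hω i).const_mul _]
    simp_rw [integral_const_mul]
  set f : (c.range → ℝ) → ℝ := fun X => H fun l => ∑ i : c.range, h l i * X i with hf
  set k : (c.range → ℝ) → ℝ := fun X =>
    Real.exp (-∫ x, q (∑ i : c.range, Γ x i * X i) ∂γ) with hk
  have hfX : observable N H (fun l => Λ.indicator fun y => h l (c y))
      =ᵐ[P] fun ω => f fun i => ∫ p, J i p ∂N ω := by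
    filter_upwards [hae] with ω hω
    simp only [observable, hf, hω]
  have hkX : boltzmann N γ q (fun x => Λ.indicator fun y => Γ x (c y))
      =ᵐ[P] fun ω => k fun i => ∫ p, J i p ∂N ω := by
    filter_upwards [hae] with ω hω
    simp only [boltzmann, hk, hω]
  have hfm : Measurable f := by
    have : Continuous f := hHc.comp (by fun_prop)
    exact this.measurable
  have hΓ1 : ∀ y, Measurable fun x => Γ x y := fun y => hΓm.comp measurable_prodMk_right
  have hkm : Measurable k := by
    have h1 : Measurable fun a : (c.range → ℝ) × Z => ∑ i : c.range, Γ a.2 i * a.1 i :=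
      Finset.measurable_sum _ fun i _ =>
        ((hΓ1 i).comp measurable_snd).mul ((measurable_pi_apply i).comp measurable_fst)
    exact (((hqc.measurable.comp h1).stronglyMeasurable.integral_prod_right'
      (ν := γ)).measurable.neg).exp
  have hfmono : Monotone f := fun X X' hX => hH fun l =>
    Finset.sum_le_sum fun i _ => mul_le_mul_of_nonneg_left (hX i) (hh l i)
  have hqi : ∀ X : c.range → ℝ, Integrable (fun x => q (∑ i : c.range, Γ x i * X i)) γ := by
    intro X
    have h1 : Integrable (fun x => ∑ i : c.range, Γ x i * X i) γ :=
      integrable_finsetSum _ fun i _ => (hΓi i).mul_const _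
    exact (h1.norm.const_mul L).mono' (hqc.comp_aestronglyMeasurable h1.1)
      (ae_of_all _ fun x => hqL _)
  have hkanti : Antitone k := fun X X' hX => by
    refine Real.exp_le_exp.2 (neg_le_neg (integral_mono (hqi X) (hqi X') fun x => hq ?_))
    exact Finset.sum_le_sum fun i _ => mul_le_mul_of_nonneg_left (hX i) (hΓ x i)
  have hprod := hfX.mul hkX
  rw [integral_congr_ae hfX, integral_congr_ae hkX]
  refine (integral_congr_ae hprod).trans_le (integral_mul_le_of_iIndepFun hXm hind hfm hkm hfmono hkanti
    ((integrable_congr hfX).1 hint1) ((integrable_congr hkX).1 hint2)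
    ((integrable_congr hprod).1 hint3))

end Discrete

/-! ### Convolution kernels and their approximation. -/

section Convolution

variable {d : ℕ} {γ : Measure (E d)} [IsFiniteMeasure γ] {β : ℝ} {G : E d → ℝ}

lemma measurable_sub_kernel (hG : Measurable G) :
    Measurable (Function.uncurry fun x y : E d => G (x - y)) :=
  hG.comp (measurable_fst.sub measurable_snd)

lemma integrable_comp_sub_of_le (hγ : γ ≤ ENNReal.ofReal β • volume) (hG : Integrable G) (y : E d) :
    Integrable (fun x => G (x - y)) γ :=
  ((hG.comp_sub_right y).smul_measure ENNReal.ofReal_ne_top).mono_measure hγ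

lemma integral_comp_sub_le (hβ : 0 ≤ β) (hγ : γ ≤ ENNReal.ofReal β • volume) (hG : Integrable G)
    (hG0 : ∀ x, 0 ≤ G x) (y : E d) : ∫ x, G (x - y) ∂γ ≤ β * ∫ x, G x := by
  refine (integral_mono_measure hγ (ae_of_all _ fun x => hG0 _)
    ((hG.comp_sub_right y).smul_measure ENNReal.ofReal_ne_top)).trans (le_of_eq ?_)
  rw [integral_smul_measure, ENNReal.toReal_ofReal hβ, smul_eq_mul,
    integral_sub_right_eq_self (fun x => G x) y]

/-- Fubini on `γ ⊗ dy`: the integral of `|G (x - y)|` over `y` does not depend on `x`, and `γ` is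
finite. -/
lemma integrable_integral_comp_sub (hG : Integrable G) (hGm : Measurable G) :
    Integrable fun y => ∫ x, G (x - y) ∂γ := by
  have h1 : Integrable (fun a : E d × E d => G (a.1 - a.2)) (γ.prod volume) := by
    refine (integrable_prod_iff (measurable_sub_kernel hGm).aestronglyMeasurable).2
      ⟨ae_of_all _ fun x => hG.comp_sub_left x, ?_⟩
    have : ∀ x, ∫ y, ‖G (x - y)‖ = ∫ y, ‖G y‖ := fun x =>
      integral_sub_left_eq_self (fun y => ‖G y‖) volume x
    simp only [Function.uncurry, this]
    exact integrable_const _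
  exact h1.integral_prod_right

/-- Approximation of an integrable kernel by continuous bounded ones, dominated by an integrable
function. -/
lemma exists_dominated_approx (hG : Integrable G) (hGm : Measurable G) (hG0 : ∀ x, 0 ≤ G x) :
    ∃ (G' : ℕ → E d → ℝ) (Gbar : E d → ℝ), (∀ j, Continuous (G' j)) ∧ (∀ j x, 0 ≤ G' j x) ∧
      (∀ j, ∃ B, ∀ x, G' j x ≤ B) ∧ Measurable Gbar ∧ Integrable Gbar ∧ (∀ x, 0 ≤ Gbar x) ∧
      (∀ᵐ x, ∀ j, G' j x ≤ Gbar x) ∧ ∀ᵐ x, Tendsto (fun j => G' j x) atTop (𝓝 (G x)) := by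
  -- The errors `2^{-j}` are summable, so `∑ |G - u j|` is integrable. This one sum provides the
  -- dominating function and the almost everywhere convergence, without passing to a subsequence.
  choose u hu1 hu2 hu3 hu4 using fun j : ℕ =>
    hG.exists_hasCompactSupport_integral_sub_le (ε := (1 / 2) ^ j) (by positivity)
  set G' : ℕ → E d → ℝ := fun j x => max (u j x) 0 with hG'
  have hc : ∀ j, Continuous (G' j) := fun j => (hu3 j).max continuous_const
  set D : ℕ → E d → ℝ≥0∞ := fun j x => ‖G x - u j x‖ₑ with hD
  have hDm : ∀ j, Measurable (D j) := fun j => (hGm.sub (hu3 j).measurable).enorm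
  have hDi : ∀ j, ∫⁻ x, D j x ≤ ENNReal.ofReal ((1 / 2) ^ j) := fun j => by
    refine (ofReal_integral_norm_eq_lintegral_enorm (hG.sub (hu4 j))).symm.trans_le ?_
    exact ENNReal.ofReal_le_ofReal (hu2 j)
  have hsum : ∫⁻ x, ∑' j, D j x ≠ ∞ := by
    rw [lintegral_tsum fun j => (hDm j).aemeasurable]
    refine ne_top_of_le_ne_top ?_ (ENNReal.tsum_le_tsum hDi)
    rw [← ENNReal.ofReal_tsum_of_nonneg (fun j => by positivity) summable_geometric_two]
    exact ENNReal.ofReal_ne_top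
  have hSm : Measurable fun x => ∑' j, D j x := Measurable.tsum hDm
  have hfin := ae_lt_top hSm hsum
  -- Taking the positive part of `u j` does not move it away from `G`, because `G ≥ 0`.
  have hdiff : ∀ j x, |G x - G' j x| ≤ |G x - u j x| := fun j x => by
    have := abs_max_sub_max_le_abs (G x) (u j x) 0
    rwa [max_eq_left (hG0 x)] at this
  refine ⟨G', fun x => G x + (∑' j, D j x).toReal, hc, fun j x => le_max_right _ _, fun j => ?_,
    hGm.add hSm.ennreal_toReal, hG.add (integrable_toReal_of_lintegral_ne_top hSm.aemeasurable hsum),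
    fun x => add_nonneg (hG0 x) ENNReal.toReal_nonneg, ?_, ?_⟩
  · obtain ⟨B, hB⟩ := (hu3 j).bounded_above_of_compact_support (hu1 j)
    exact ⟨max B 0, fun x => max_le_max ((le_abs_self _).trans (hB x)) le_rfl⟩
  · filter_upwards [hfin] with x hx j
    have h1 : (D j x).toReal ≤ (∑' j, D j x).toReal :=
      ENNReal.toReal_mono hx.ne (ENNReal.le_tsum j)
    have h2 : (D j x).toReal = |G x - u j x| := by simp [hD]
    have h3 := neg_le_of_abs_le ((hdiff j x).trans (h2.symm.trans_le h1))
    linarith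
  · filter_upwards [hfin] with x hx
    have h1 := ENNReal.tendsto_atTop_zero_of_tsum_ne_top hx.ne
    have h2 : Tendsto (fun j => (D j x).toReal) atTop (𝓝 0) :=
      (ENNReal.tendsto_toReal ENNReal.zero_ne_top).comp h1
    have h3 : Tendsto (fun j => G x - G' j x) atTop (𝓝 0) :=
      squeeze_zero_norm (fun j => (hdiff j x).trans_eq (by simp [hD])) h2
    simpa using (tendsto_const_nhds (x := G x)).sub h3

end Convolution

/-! ### The correlation inequality for general data. -/

section FKG

variable {Ω : Type*} [MeasurableSpace Ω] {d : ℕ} {N : Kernel Ω (ℝ × E d)} [IsSFiniteKernel N]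
  {γ : Measure (E d)} [IsFiniteMeasure γ] {m : Measure (ℝ × E d)} {P : Measure Ω} {C β κ K L : ℝ}

/-- The envelope of bounded data in a bounded region. -/
lemma envelope_indicator (habs : ∀ᵐ p ∂m, |p.1| ≤ C) {Λ : Set (E d)} (hΛ : MeasurableSet Λ)
    (hΛm : m (Prod.snd ⁻¹' Λ) < ∞) {B : ℝ} (hB : 0 ≤ B) :
    Envelope m γ C (Λ.indicator fun _ => B) fun _ => Λ.indicator fun _ => B where
  abs_le := habs
  meas_h := measurable_const.indicator hΛ
  nonneg_h y := Set.indicator_nonneg (fun _ _ => hB) y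
  int_h := (integrable_indicator_iff (f := fun _ : ℝ × E d => B) (measurable_snd hΛ)).2
      (integrableOn_const hΛm.ne)
  bdd_h := ⟨B, fun y => Set.indicator_le_self' (fun _ _ => hB) y⟩
  meas_Γ := (measurable_const.indicator hΛ).comp measurable_snd
  nonneg_Γ _ y := Set.indicator_nonneg (fun _ _ => hB) y
  int_Γ := ae_of_all _ fun _ => integrable_const _
  int_u := by
    simp only [integral_const]
    exact ((integrable_indicator_iff (f := fun _ : ℝ × E d => B) (measurable_snd hΛ)).2
      (integrableOn_const hΛm.ne)).smul (γ.real Set.univ)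
  bdd_u := ⟨γ.real Set.univ * B, fun y => by
    rw [integral_const, smul_eq_mul]
    exact mul_le_mul_of_nonneg_left (Set.indicator_le_self' (fun _ _ => hB) y) measureReal_nonneg⟩

/-- The envelope of a convolution kernel. -/
lemma envelope_convolution (hβ : 0 ≤ β) (hγ : γ ≤ ENNReal.ofReal β • volume)
    (habs : ∀ᵐ p ∂m, |p.1| ≤ C)
    (hmi : ∀ f : E d → ℝ, Measurable f → Integrable f → Integrable (fun p => f p.2) m)
    {hbar : E d → ℝ} (hhm : Measurable hbar) (hh0 : ∀ y, 0 ≤ hbar y) (hhi : Integrable hbar)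
    (hhB : ∃ B, ∀ y, hbar y ≤ B) {G : E d → ℝ} (hG : Integrable G) (hGm : Measurable G)
    (hG0 : ∀ x, 0 ≤ G x) : Envelope m γ C hbar fun x y => G (x - y) where
  abs_le := habs
  meas_h := hhm
  nonneg_h := hh0
  int_h := hmi _ hhm hhi
  bdd_h := hhB
  meas_Γ := measurable_sub_kernel hGm
  nonneg_Γ _ _ := hG0 _
  int_Γ := ae_of_all _ fun _ => integrable_comp_sub_of_le hγ hG _
  int_u := hmi (fun y => ∫ x, G (x - y) ∂γ)
    ((((measurable_sub_kernel hGm).comp measurable_swap).stronglyMeasurable.integral_prod_right'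
      (ν := γ)).measurable) (integrable_integral_comp_sub hG hGm)
  bdd_u := ⟨_, integral_comp_sub_le hβ hγ hG hG0⟩

/-- The correlation inequality for bounded continuous data in a bounded region. -/
theorem IsPoisson.integral_mul_le_of_continuous (hP : IsPoisson N m P) (hC : 0 ≤ C)
    (habs : ∀ᵐ p ∂m, |p.1| ≤ C) {Λ : Set (E d)} (hΛ : MeasurableSet Λ)
    (hΛm : m (Prod.snd ⁻¹' Λ) < ∞) {n : ℕ} {H : (Fin n → ℝ) → ℝ} (hHc : Continuous H)
    (hHm : Monotone H) (hκ : 0 ≤ κ) (hK : 0 ≤ K)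
    (hH : ∀ x, |H x| ≤ K * Real.exp (κ * ∑ i, |x i|)) {h : Fin n → E d → ℝ}
    (hhc : ∀ l, Continuous (h l)) (hh : ∀ l y, 0 ≤ h l y) {B : ℝ} (hB : 0 ≤ B)
    (hhB : ∀ l y, h l y ≤ B) {q : ℝ → ℝ}
    (hqc : Continuous q) (hq : Monotone q) (hL : 0 ≤ L) (hqL : ∀ t, |q t| ≤ L * |t|)
    {G : E d → ℝ} (hGc : Continuous G) (hG : ∀ x, 0 ≤ G x) (hGB : ∀ x, G x ≤ B) :
    ∫ ω, observable N H (fun l => Λ.indicator (h l)) ω *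
      boltzmann N γ q (fun x => Λ.indicator fun y => G (x - y)) ω ∂P
      ≤ (∫ ω, observable N H (fun l => Λ.indicator (h l)) ω ∂P) *
        ∫ ω, boltzmann N γ q (fun x => Λ.indicator fun y => G (x - y)) ω ∂P := by
  have env := envelope_indicator (γ := γ) habs hΛ hΛm hB
  -- Simple functions converging to the identity: precomposition with `c j` makes the data constant
  -- on finitely many cells, and continuity recovers the data in the limit.
  set c : ℕ → SimpleFunc (E d) (E d) := fun j =>
    SimpleFunc.approxOn id measurable_id Set.univ 0 (Set.mem_univ _) j with hc
  have hct : ∀ y, Tendsto (fun j => c j y) atTop (𝓝 y) := fun y =>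
    SimpleFunc.tendsto_approxOn measurable_id (Set.mem_univ _) (by simp)
  have hind : ∀ (f : E d → ℝ) y, (∀ y, 0 ≤ f y) → (∀ y, f y ≤ B) →
      |Λ.indicator f y| ≤ Λ.indicator (fun _ => B) y := fun f y h0 h1 => by
    by_cases hy : y ∈ Λ
    · simpa [hy, abs_of_nonneg (h0 y)] using h1 y
    · simp [hy]
  have hindt : ∀ (f : ℕ → E d → ℝ) (f' : E d → ℝ) y, Tendsto (fun j => f j y) atTop (𝓝 (f' y)) →
      Tendsto (fun j => Λ.indicator (f j) y) atTop (𝓝 (Λ.indicator f' y)) := fun f f' y ht => by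
    by_cases hy : y ∈ Λ
    · simpa [hy] using ht
    · simp [hy]
  have hΓm : ∀ c' : E d → E d, Measurable c' →
      Measurable (Function.uncurry fun x : E d => Λ.indicator fun y => G (x - c' y)) := by
    intro c' hc'
    have : (Function.uncurry fun x : E d => Λ.indicator fun y => G (x - c' y))
        = (Prod.snd ⁻¹' Λ).indicator fun a : E d × E d => G (a.1 - c' a.2) := by
      funext a; simp only [Function.uncurry, Set.indicator]; rfl
    rw [this]
    exact (hGc.measurable.comp (measurable_fst.sub (hc'.comp measurable_snd))).indicator
      (measurable_snd hΛ)
  have hhm : ∀ j l, Measurable (Λ.indicator fun y => h l (c j y)) := fun j l =>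
    ((hhc l).measurable.comp (c j).measurable).indicator hΛ
  have hb1 : ∀ j, ∀ᵐ p ∂m, ∀ l, |Λ.indicator (fun y => h l (c j y)) p.2|
      ≤ Λ.indicator (fun _ => B) p.2 := fun j => ae_of_all _ fun p l =>
    hind _ _ (fun y => hh l _) (fun y => hhB l _)
  have hb2 : ∀ j, ∀ᵐ p ∂m, ∀ᵐ x ∂γ, |Λ.indicator (fun y => G (x - c j y)) p.2|
      ≤ Λ.indicator (fun _ => B) p.2 := fun j => ae_of_all _ fun p => ae_of_all _ fun x =>
    hind _ _ (fun y => hG _) (fun y => hGB _)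
  refine env.integral_mul_le_of_tendsto hP hC hκ hK hHc hH hqc hqL hL
    (h' := fun j l => Λ.indicator fun y => h l (c j y)) hhm hb1
    (ae_of_all _ fun p l => hindt _ _ _ (((hhc l).tendsto _).comp (hct _)))
    (Γ' := fun j x => Λ.indicator fun y => G (x - c j y)) (hΓm id measurable_id)
    (fun j => hΓm (c j) (c j).measurable) hb2
    (ae_of_all _ fun p => ae_of_all _ fun x => hindt _ _ _
      ((hGc.tendsto _).comp (tendsto_const_nhds.sub (hct _)))) fun j => ?_
  obtain ⟨i1, i2, i3⟩ := env.integrable_observable_boltzmann hP hC hκ hK hHc hH hqc hqL hL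
    (hhm j) (hb1 j) (hb2 j) (hΓm (c j) (c j).measurable)
  exact hP.integral_mul_le_of_simpleFunc habs (c j) hΛ hΛm hHc hHm hh hqc hq hqL
    (Γ := fun x y => G (x - y)) (fun x y => hG _) (measurable_sub_kernel hGc.measurable)
    (fun y => (integrable_const B).mono' (by fun_prop)
      (ae_of_all _ fun x => by simpa [abs_of_nonneg (hG _)] using hGB _)) i1 i2 i3

/-- The correlation inequality between increasing observables and decreasing Boltzmann factors. -/
theorem IsPoisson.integral_mul_le (hP : IsPoisson N m P) (hC : 0 ≤ C) (hβ : 0 ≤ β)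
    (hγ : γ ≤ ENNReal.ofReal β • volume) (habs : ∀ᵐ p ∂m, |p.1| ≤ C)
    (hmi : ∀ f : E d → ℝ, Measurable f → Integrable f → Integrable (fun p => f p.2) m)
    {n : ℕ} {H : (Fin n → ℝ) → ℝ} (hHc : Continuous H)
    (hHm : Monotone H) (hκ : 0 ≤ κ) (hK : 0 ≤ K)
    (hH : ∀ x, |H x| ≤ K * Real.exp (κ * ∑ i, |x i|)) {h : Fin n → E d → ℝ}
    (hhc : ∀ l, Continuous (h l)) (hh : ∀ l y, 0 ≤ h l y) (hhi : ∀ l, Integrable (h l)) {B : ℝ}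
    (hB : 0 ≤ B) (hhB : ∀ l y, h l y ≤ B) {q : ℝ → ℝ}
    (hqc : Continuous q) (hq : Monotone q) (hL : 0 ≤ L) (hqL : ∀ t, |q t| ≤ L * |t|)
    {G : E d → ℝ} (hGi : Integrable G) (hGm : Measurable G) (hG : ∀ x, 0 ≤ G x) :
    ∫ ω, observable N H h ω * boltzmann N γ q (fun x y => G (x - y)) ω ∂P
      ≤ (∫ ω, observable N H h ω ∂P) * ∫ ω, boltzmann N γ q (fun x y => G (x - y)) ω ∂P := by
  obtain ⟨G', Gbar, hc, h0, hb, hbm, hbi, hb0, hle, ht⟩ := exists_dominated_approx hGi hGm hG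
  choose B' hB' using hb
  have env := envelope_convolution (m := m) hβ hγ habs hmi (hbar := fun y => ∑ l, h l y)
    (Finset.measurable_sum _ fun l _ => (hhc l).measurable)
    (fun y => Finset.sum_nonneg fun l _ => hh l y) (integrable_finsetSum _ fun l _ => hhi l)
    ⟨∑ _l : Fin n, B, fun y => Finset.sum_le_sum fun l _ => hhB l y⟩ hbi hbm hb0
  set Λ : ℕ → Set (E d) := fun j => Metric.ball 0 j with hΛ
  have hΛm : ∀ j, MeasurableSet (Λ j) := fun j => measurableSet_ball
  have hΛfin : ∀ j, m (Prod.snd ⁻¹' Λ j) < ∞ := fun j => by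
    have h1 := hmi ((Λ j).indicator fun _ => (1 : ℝ)) (measurable_const.indicator (hΛm j))
      ((integrable_indicator_iff (hΛm j)).2 (integrableOn_const measure_ball_lt_top.ne))
    have h2 := (integrable_indicator_iff (f := fun _ : ℝ × E d => (1 : ℝ))
      (measurable_snd (hΛm j))).1 h1
    have h3 := (integrable_const_iff (c := (1 : ℝ))).1 h2
    simpa [isFiniteMeasure_iff] using h3
  have hindt : ∀ (f : ℕ → E d → ℝ) (f' : E d → ℝ) y, Tendsto (fun j => f j y) atTop (𝓝 (f' y)) →
      Tendsto (fun j => (Λ j).indicator (f j) y) atTop (𝓝 (f' y)) := fun f f' y ht => by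
    refine ht.congr' ?_
    obtain ⟨k, hk⟩ := exists_nat_gt ‖y‖
    filter_upwards [eventually_ge_atTop k] with j hj
    rw [Set.indicator_of_mem]
    simp only [hΛ, Metric.mem_ball, dist_zero_right]
    exact hk.trans_le (by exact_mod_cast hj)
  -- Lebesgue null sets stay null under translation, and `γ` is absolutely continuous.
  have htrans : ∀ {p : E d → Prop}, (∀ᵐ x, p x) → ∀ y, ∀ᵐ x ∂γ, p (x - y) := fun {p} hp y => by
    have h1 : ∀ᵐ x : E d, p (x - y) :=
      (measurePreserving_sub_right volume y).quasiMeasurePreserving.ae hp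
    exact (hγ.absolutelyContinuous.trans Measure.smul_absolutelyContinuous).ae_le h1
  refine env.integral_mul_le_of_tendsto hP hC hκ hK hHc hH hqc hqL hL
    (h' := fun j l => (Λ j).indicator (h l))
    (fun j l => (hhc l).measurable.indicator (hΛm j))
    (fun j => ae_of_all _ fun p l => ?_)
    (ae_of_all _ fun p l => hindt _ _ _ tendsto_const_nhds)
    (Γ' := fun j x => (Λ j).indicator fun y => G' j (x - y))
    (measurable_sub_kernel hGm) (fun j => ?_) (fun j => ae_of_all _ fun p => ?_)
    (ae_of_all _ fun p => ?_) fun j => ?_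
  · have h1 : h l p.2 ≤ ∑ l, h l p.2 :=
      Finset.single_le_sum (f := fun l => h l p.2) (fun l _ => hh l _) (Finset.mem_univ l)
    by_cases hy : p.2 ∈ Λ j
    · simpa [hy, abs_of_nonneg (hh l _)] using h1
    · simpa [hy] using (hh l _).trans h1
  · have : (Function.uncurry fun x : E d => (Λ j).indicator fun y => G' j (x - y))
        = (Prod.snd ⁻¹' Λ j).indicator fun a : E d × E d => G' j (a.1 - a.2) := by
      funext a; simp only [Function.uncurry, Set.indicator]; rfl
    rw [this]
    exact ((hc j).measurable.comp (measurable_fst.sub measurable_snd)).indicator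
      (measurable_snd (hΛm j))
  · filter_upwards [htrans hle p.2] with x hx
    by_cases hy : p.2 ∈ Λ j
    · simpa [hy, abs_of_nonneg (h0 j _)] using hx j
    · simpa [hy] using hb0 _
  · filter_upwards [htrans ht p.2] with x hx
    exact hindt (fun j y => G' j (x - y)) (fun y => G (x - y)) p.2 hx
  -- The bound on `G' j` may grow with `j`: it is used only for this fixed `j`, while the limit is
  -- dominated through `Gbar`.
  · exact hP.integral_mul_le_of_continuous hC habs (hΛm j) (hΛfin j) hHc hHm hκ hK hH hhc hh
      (B := max B (B' j)) (le_max_of_le_left hB) (fun l y => (hhB l y).trans (le_max_left _ _))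
      hqc hq hL hqL (hc j) (h0 j) fun x => (hB' j x).trans (le_max_right _ _)

end FKG

/-! ### S-finiteness of kernels without a uniform mass bound. -/

section Kernels

/-- A kernel of finite measures is s-finite. -/
lemma isSFiniteKernel_of_finite {α β : Type*} [MeasurableSpace α] [MeasurableSpace β]
    (κ : Kernel α β) (h : ∀ a, κ a Set.univ < ∞) : IsSFiniteKernel κ := by
  -- Splitting the source by the integer part of the total mass makes each piece uniformly bounded.
  set f : α → ℕ := fun a => ⌊(κ a Set.univ).toReal⌋₊ with hf
  have hfm : Measurable f := (κ.measurable_coe MeasurableSet.univ).ennreal_toReal.nat_floor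
  have hs : ∀ j, MeasurableSet (f ⁻¹' {j}) := fun j => hfm (measurableSet_singleton j)
  classical
  set κ' : ℕ → Kernel α β := fun j => Kernel.piecewise (hs j) κ 0 with hκ'
  have hfin : ∀ j, IsFiniteKernel (κ' j) := fun j => by
    refine ⟨⟨ENNReal.ofReal (j + 1), ENNReal.ofReal_lt_top, fun a => ?_⟩⟩
    rw [hκ', Kernel.piecewise_apply']
    split_ifs with ha
    · rw [← ENNReal.ofReal_toReal (h a).ne]
      refine ENNReal.ofReal_le_ofReal ?_
      have := Nat.lt_floor_add_one (κ a Set.univ).toReal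
      rw [show ⌊(κ a Set.univ).toReal⌋₊ = j from ha] at this
      exact this.le
    · simp
  have heq : κ = Kernel.sum κ' := by
    ext a s hs'
    rw [Kernel.sum_apply' _ _ hs', tsum_eq_single (f a)]
    · simp [hκ', Kernel.piecewise_apply']
    · intro j hj
      simp [hκ', Kernel.piecewise_apply', hj.symm]
  rw [heq]
  infer_instance

end Kernels

/-! ### The atoms of a configuration as a measurable kernel. -/

namespace Config

variable {d : ℕ} {C : ℝ}

/-- The sum of the unit masses at the points `(s_y, y)`. -/
def atomsMeasure (η : Config d C) : Measure (ℝ × E d) :=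
  Measure.sum fun y : Function.support η.charge => Measure.dirac (η.charge y, y.1)

lemma finite_inter_ball (η : Config d C) (n : ℕ) :
    (Metric.ball 0 n ∩ Function.support η.charge).Finite :=
  (η.finite_inter (Metric.closedBall 0 n) (isCompact_closedBall 0 n)).subset
    (Set.inter_subset_inter_left _ Metric.ball_subset_closedBall)

/-- The support points in the open ball of radius `n`. -/
def inBall (η : Config d C) (n : ℕ) : Finset (E d) := (η.finite_inter_ball n).toFinset

lemma mem_inBall {η : Config d C} {n : ℕ} {y : E d} :
    y ∈ η.inBall n ↔ y ∈ Metric.ball 0 (n : ℝ) ∧ η.charge y ≠ 0 := by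
  simp [inBall]

lemma countable_support (η : Config d C) : (Function.support η.charge).Countable := by
  have : Function.support η.charge = ⋃ n : ℕ, Metric.ball 0 n ∩ Function.support η.charge := by
    rw [← Set.iUnion_inter, Metric.iUnion_ball_nat, Set.univ_inter]
  rw [this]
  exact Set.countable_iUnion fun n => (η.finite_inter_ball n).countable

lemma lintegral_atomsMeasure (η : Config d C) (f : ℝ × E d → ℝ≥0∞) :
    ∫⁻ p, f p ∂η.atomsMeasure = ∑' y : Function.support η.charge, f (η.charge y, y.1) := by
  rw [atomsMeasure, lintegral_sum_measure]
  exact tsum_congr fun y => lintegral_dirac _ _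

/-- The pairing is an integral with respect to the atoms. -/
lemma pair_eq_integral (η : Config d C) {h : E d → ℝ} (hh : Measurable h) :
    η.pair h = ∫ p, p.1 * h p.2 ∂η.atomsMeasure := by
  have hsupp : Function.support (fun y => η.charge y * h y) ⊆ Function.support η.charge :=
    Function.support_mul_subset_left _ _
  have hsub : η.pair h = ∑' y : Function.support η.charge, η.charge y * h y :=
    (tsum_subtype_eq_of_support_subset hsupp).symm
  have hm : Measurable fun p : ℝ × E d => p.1 * h p.2 :=
    measurable_fst.mul (hh.comp measurable_snd)
  by_cases hi : Integrable (fun p : ℝ × E d => p.1 * h p.2) η.atomsMeasure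
  · rw [hsub]
    have := hasSum_integral_measure hi
    simp only [integral_dirac] at this
    exact this.tsum_eq
  -- Both sides default to `0` here, since a real series is summable exactly when its norms are.
  · rw [integral_undef hi, hsub, tsum_eq_zero_of_not_summable]
    intro hs
    refine hi ⟨hm.aestronglyMeasurable, ?_⟩
    rw [HasFiniteIntegral, lintegral_atomsMeasure, lt_top_iff_ne_top]
    exact tsum_enorm_ne_top_iff_summable_norm.2 hs.norm

lemma pair_eq_sum (η : Config d C) {n : ℕ} {f : E d → ℝ}
    (hf : ∀ y, f y ≠ 0 → y ∈ Metric.ball 0 (n : ℝ)) :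
    η.pair f = ∑ y ∈ η.inBall n, η.charge y * f y := by
  refine tsum_eq_sum fun y hy => ?_
  by_contra hne
  obtain ⟨h1, h2⟩ := mul_ne_zero_iff.1 hne
  exact hy (mem_inBall.2 ⟨hf y h2, h1⟩)

lemma measurable_pair_schwartz (f : 𝓢(E d, ℝ)) : Measurable fun η : Config d C => η.pair f := by
  rw [measurable_iff_comap_le]
  exact le_iSup (fun f : 𝓢(E d, ℝ) =>
    MeasurableSpace.comap (fun η : Config d C => η.pair f) inferInstance) f

/-- The total charge of `B` in the open ball of radius `n`. -/
def total (n : ℕ) (B : Set (E d)) (η : Config d C) : ℝ :=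
  ∑ y ∈ η.inBall n, η.charge y * B.indicator 1 y

/-- The indicator of `U ∩ ball` is a pointwise limit of smooth compactly supported functions, built
from a smooth `f` whose support is exactly this set. On one configuration only finitely many points
matter. -/
lemma measurable_total_isOpen (n : ℕ) {U : Set (E d)} (hU : IsOpen U) :
    Measurable (total n U : Config d C → ℝ) := by
  obtain ⟨f, hfs, hfc, hfr⟩ := (hU.inter (Metric.isOpen_ball (x := (0 : E d)) (ε := n))).exists_contDiff_support_eq
    (n := ⊤)
  set F : ℕ → E d → ℝ := fun k y => Real.smoothTransition (k * f y) with hF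
  have hFs : ∀ k, Function.support (F k) ⊆ U ∩ Metric.ball 0 n := fun k y hy => by
    rw [← hfs]
    intro h0
    apply hy
    simp only [hF, h0, mul_zero, Real.smoothTransition.zero]
  have hFc : ∀ k, HasCompactSupport (F k) := fun k =>
    HasCompactSupport.of_support_subset_isCompact (isCompact_closedBall (0 : E d) n)
      ((hFs k).trans (Set.inter_subset_right.trans Metric.ball_subset_closedBall))
  have hFd : ∀ k, ContDiff ℝ ((⊤ : ℕ∞) : WithTop ℕ∞) (F k) := fun k =>
    Real.smoothTransition.contDiff.comp (contDiff_const.mul hfc)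
  refine measurable_of_tendsto_metrizable (f := fun k (η : Config d C) => η.pair (F k))
    (fun k => ?_) ?_
  · exact measurable_pair_schwartz ((hFc k).toSchwartzMap (hFd k))
  · rw [tendsto_pi_nhds]
    intro η
    have h1 : ∀ k, η.pair (F k) = ∑ y ∈ η.inBall n, η.charge y * F k y := fun k =>
      η.pair_eq_sum fun y hy => (hFs k hy).2
    simp_rw [h1]
    refine tendsto_finsetSum _ fun y hy => Tendsto.const_mul _ ?_
    have hyb := (mem_inBall.1 hy).1
    by_cases hyU : y ∈ U
    · rw [Set.indicator_of_mem hyU, Pi.one_apply]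
      have hfy : f y ≠ 0 := by
        have : y ∈ Function.support f := by rw [hfs]; exact ⟨hyU, hyb⟩
        exact this
      have hfp : 0 < f y := lt_of_le_of_ne (hfr ⟨y, rfl⟩).1 hfy.symm
      refine tendsto_const_nhds.congr' ?_
      obtain ⟨k, hk⟩ := exists_nat_gt (1 / f y)
      filter_upwards [eventually_ge_atTop k] with j hj
      refine (Real.smoothTransition.one_of_one_le ?_).symm
      have : 1 / f y ≤ j := hk.le.trans (by exact_mod_cast hj)
      rwa [div_le_iff₀ hfp] at this
    · rw [Set.indicator_of_notMem hyU]
      refine tendsto_const_nhds.congr fun k => ?_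
      by_contra hne
      exact hyU (hFs k (Ne.symm hne)).1

lemma measurable_total (n : ℕ) {B : Set (E d)} (hB : MeasurableSet B) :
    Measurable (total n B : Config d C → ℝ) := by
  induction B, hB using MeasurableSpace.induction_on_inter
    (BorelSpace.measurable_eq (α := E d)) isPiSystem_isOpen with
  | empty =>
    have : (total n ∅ : Config d C → ℝ) = fun _ => 0 := by
      funext η; simp [total]
    rw [this]; exact measurable_const
  | basic U hU => exact measurable_total_isOpen n hU
  | compl B hB ih =>
    have : (total n Bᶜ : Config d C → ℝ) = fun η => total n Set.univ η - total n B η := by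
      funext η
      simp only [total, ← Finset.sum_sub_distrib, ← mul_sub]
      refine Finset.sum_congr rfl fun y _ => ?_
      by_cases hy : y ∈ B <;> simp [hy]
    rw [this]
    exact (measurable_total_isOpen n isOpen_univ).sub ih
  | iUnion f hd hm ih =>
    refine measurable_of_tendsto_metrizable
      (f := fun k (η : Config d C) => ∑ i ∈ Finset.range k, total n (f i) η)
      (fun k => Finset.measurable_sum _ fun i _ => ih i) ?_
    rw [tendsto_pi_nhds]
    intro η
    have : ∀ y, HasSum (fun i => η.charge y * (f i).indicator (1 : E d → ℝ) y)
        (η.charge y * (⋃ i, f i).indicator 1 y) := by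
      intro y
      refine HasSum.mul_left _ ?_
      by_cases hy : y ∈ ⋃ i, f i
      · obtain ⟨i, hi⟩ := Set.mem_iUnion.1 hy
        rw [Set.indicator_of_mem hy]
        have h1 := hasSum_single (f := fun j => (f j).indicator (1 : E d → ℝ) y) i fun j hj =>
          Set.indicator_of_notMem (fun hyj => Set.disjoint_left.1 (hd hj) hyj hi) _
        simpa [Set.indicator_of_mem hi] using h1
      · rw [Set.indicator_of_notMem hy]
        have : (fun i => (f i).indicator (1 : E d → ℝ) y) = fun _ => 0 := by
          funext i
          exact Set.indicator_of_notMem (fun h => hy (Set.mem_iUnion.2 ⟨i, h⟩)) _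
        rw [this]; exact hasSum_zero
    exact (hasSum_sum fun y _ => this y).tendsto_sum_nat

/-- The atoms in the open ball of radius `n`. -/
def atomsIn (n : ℕ) (η : Config d C) : Measure (ℝ × E d) :=
  ∑ y ∈ η.inBall n, Measure.dirac (η.charge y, y)

instance (n : ℕ) (η : Config d C) : IsFiniteMeasure (atomsIn n η) := by
  unfold atomsIn; infer_instance

/-- The first `k` binary digits of a point. -/
def digits (d k : ℕ) (y : E d) : Fin k → Bool := fun i => MeasurableSpace.mapNatBool (E d) y i

lemma measurable_digits (d k : ℕ) : Measurable (digits d k) :=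
  measurable_pi_lambda _ fun i =>
    (measurable_pi_apply (i : ℕ)).comp (MeasurableSpace.measurable_mapNatBool (E d))

/-- The full binary code is injective, so finitely many digits separate the finitely many pairs of
points. -/
lemma eventually_injOn_digits (F : Finset (E d)) :
    ∀ᶠ k in atTop, Set.InjOn (digits d k) F := by
  have h1 : ∀ x ∈ F, ∀ y ∈ F, ∀ᶠ k in atTop, digits d k x = digits d k y → x = y := by
    intro x _ y _
    by_cases hxy : x = y
    · exact Eventually.of_forall fun k _ => hxy
    · have := (MeasurableSpace.injective_mapNatBool (α := E d)).ne hxy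
      obtain ⟨i, hi⟩ := Function.ne_iff.1 this
      filter_upwards [eventually_gt_atTop i] with k hk heq
      exact absurd (congrFun heq ⟨i, hk⟩) hi
  have h2 := (Finset.eventually_all F).2 fun x hx => (Finset.eventually_all F).2 (h1 x hx)
  filter_upwards [h2] with k hk x hx y hy hxy using hk x hx y hy hxy

/-- Once the digit cells separate the points of the ball, the total charge of a cell is the charge
of its only atom. Counting the cells whose total charge lies in `I` therefore counts atoms. -/
lemma measurable_atomsIn_prod (n : ℕ) {I : Set ℝ} (hI : MeasurableSet I) {B : Set (E d)}
    (hB : MeasurableSet B) : Measurable fun η : Config d C => atomsIn n η (I ×ˢ B) := by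
  classical
  -- The value `0` is removed because empty cells have total charge `0`, whereas atoms never do.
  set φ : ℝ → ℝ≥0∞ := (I \ {0}).indicator 1 with hφ
  have hφm : Measurable φ := measurable_one.indicator (hI.diff (measurableSet_singleton 0))
  refine measurable_of_tendsto_metrizable (f := fun k (η : Config d C) =>
    ∑ σ : Fin k → Bool, φ (total n (B ∩ digits d k ⁻¹' {σ}) η)) (fun k => ?_) ?_
  · exact Finset.measurable_sum _ fun σ _ => hφm.comp (measurable_total n
      (hB.inter (measurable_digits d k (measurableSet_singleton σ))))
  · rw [tendsto_pi_nhds]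
    intro η
    refine tendsto_const_nhds.congr' ?_
    filter_upwards [eventually_injOn_digits (η.inBall n)] with k hk
    set F := (η.inBall n).filter (· ∈ B) with hF
    have hkF : Set.InjOn (digits d k) F := hk.mono (Finset.coe_subset.2 (Finset.filter_subset _ _))
    have ht : ∀ σ, total n (B ∩ digits d k ⁻¹' {σ}) η
        = ∑ y ∈ F.filter (fun y => digits d k y = σ), η.charge y := by
      intro σ
      rw [total, Finset.sum_filter, Finset.sum_filter]
      refine Finset.sum_congr rfl fun y _ => ?_
      by_cases h1 : y ∈ B <;> by_cases h2 : digits d k y = σ <;> simp [h1, h2]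
    have h1 : ∑ σ : Fin k → Bool, φ (total n (B ∩ digits d k ⁻¹' {σ}) η)
        = ∑ σ ∈ F.image (digits d k), φ (total n (B ∩ digits d k ⁻¹' {σ}) η) := by
      refine (Finset.sum_subset (Finset.subset_univ _) fun σ _ hσ => ?_).symm
      have : F.filter (fun y => digits d k y = σ) = ∅ :=
        Finset.filter_eq_empty_iff.2 fun y hy h => hσ (h ▸ Finset.mem_image_of_mem _ hy)
      rw [ht, this]
      simp [hφ]
    rw [h1, Finset.sum_image hkF]
    have h2 : ∀ y ∈ F, φ (total n (B ∩ digits d k ⁻¹' {digits d k y}) η)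
        = I.indicator 1 (η.charge y) := by
      intro y hy
      have : F.filter (fun x => digits d k x = digits d k y) = {y} := by
        ext x
        simp only [Finset.mem_filter, Finset.mem_singleton]
        exact ⟨fun h => hkF h.1 hy h.2, fun h => ⟨h ▸ hy, by rw [h]⟩⟩
      rw [ht, this, Finset.sum_singleton]
      have hne : η.charge y ≠ 0 := (mem_inBall.1 (Finset.mem_filter.1 hy).1).2
      by_cases hI' : η.charge y ∈ I <;> simp [hφ, hI', hne, Set.indicator]
    rw [Finset.sum_congr rfl h2, hF, Finset.sum_filter, atomsIn, Measure.finsetSum_apply]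
    refine Finset.sum_congr rfl fun y _ => ?_
    rw [Measure.dirac_apply' _ (hI.prod hB)]
    by_cases h1 : η.charge y ∈ I <;> by_cases h2 : y ∈ B <;> simp [h1, h2]

lemma measurable_atomsIn (n : ℕ) : Measurable (atomsIn n : Config d C → Measure (ℝ × E d)) := by
  refine Measurable.measure_of_isPiSystem generateFrom_prod.symm isPiSystem_prod ?_ ?_
  · rintro _ ⟨I, hI, B, hB, rfl⟩
    exact measurable_atomsIn_prod n hI hB
  · rw [← Set.univ_prod_univ]
    exact measurable_atomsIn_prod n MeasurableSet.univ MeasurableSet.univ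

lemma atomsIn_eq_restrict (n : ℕ) (η : Config d C) :
    atomsIn n η = η.atomsMeasure.restrict (Prod.snd ⁻¹' Metric.ball 0 (n : ℝ)) := by
  have hm : MeasurableSet (Prod.snd ⁻¹' Metric.ball (0 : E d) (n : ℝ) : Set (ℝ × E d)) :=
    measurable_snd measurableSet_ball
  refine Measure.ext_of_lintegral _ fun f hf => ?_
  rw [← lintegral_indicator hm, lintegral_atomsMeasure, atomsIn, lintegral_finsetSum_measure]
  simp only [lintegral_dirac]
  have : ∑' y : Function.support η.charge,
      (Prod.snd ⁻¹' Metric.ball (0 : E d) (n : ℝ)).indicator f (η.charge y, y.1)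
      = ∑' y, (if y ∈ η.inBall n then f (η.charge y, y) else 0) := by
    rw [← tsum_subtype_eq_of_support_subset (s := Function.support η.charge)]
    · refine tsum_congr fun y => ?_
      have hy : η.charge y ≠ 0 := y.2
      by_cases h1 : y.1 ∈ Metric.ball 0 (n : ℝ)
      · rw [if_pos (mem_inBall.2 ⟨h1, hy⟩), Set.indicator_of_mem (by exact h1)]
      · rw [if_neg (fun h => h1 (mem_inBall.1 h).1), Set.indicator_of_notMem (by exact h1)]
    · intro y hy
      by_contra h
      apply hy
      exact if_neg fun h' => h (mem_inBall.1 h').2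
  rw [this, tsum_eq_sum (s := η.inBall n)]
  · exact Finset.sum_congr rfl fun y hy => by simp [hy]
  · intro y hy; simp [hy]

lemma atomsMeasure_apply (η : Config d C) {A : Set (ℝ × E d)} (hA : MeasurableSet A) :
    η.atomsMeasure A = ⨆ n : ℕ, atomsIn n η A := by
  simp_rw [atomsIn_eq_restrict, Measure.restrict_apply hA]
  rw [← Monotone.measure_iUnion, ← Set.inter_iUnion, ← Set.preimage_iUnion, Metric.iUnion_ball_nat,
    Set.preimage_univ, Set.inter_univ]
  intro n k hnk
  exact Set.inter_subset_inter_right _ (Set.preimage_mono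
    (Metric.ball_subset_ball (by exact_mod_cast hnk)))

/-- The kernel of the atoms of a configuration. -/
def atoms (d : ℕ) (C : ℝ) : Kernel (Config d C) (ℝ × E d) where
  toFun := atomsMeasure
  measurable' := Measure.measurable_of_measurable_coe _ fun A hA => by
    simp_rw [fun η : Config d C => η.atomsMeasure_apply hA]
    exact Measurable.iSup fun n => (Measure.measurable_coe hA).comp (measurable_atomsIn n)

lemma atoms_apply (η : Config d C) : atoms d C η = η.atomsMeasure := rfl

/-- Each configuration has finitely many atoms in each shell, but their number is not bounded
uniformly over configurations; hence `isSFiniteKernel_of_finite` on every shell. -/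
instance : IsSFiniteKernel (atoms d C) := by
  set s : ℕ → Set (ℝ × E d) := disjointed fun n : ℕ => Prod.snd ⁻¹' Metric.ball 0 (n : ℝ) with hs
  have hsm : ∀ n, MeasurableSet (s n) := fun n => MeasurableSet.disjointed
    (fun n => measurable_snd measurableSet_ball) n
  have hsu : ⋃ n, s n = Set.univ := by
    rw [hs, iUnion_disjointed, ← Set.preimage_iUnion, Metric.iUnion_ball_nat, Set.preimage_univ]
  have heq : atoms d C = Kernel.sum fun n => (atoms d C).restrict (hsm n) := by
    ext η A hA
    rw [Kernel.sum_apply' _ _ hA]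
    simp_rw [Kernel.restrict_apply' _ _ _ hA]
    rw [← measure_iUnion (fun i j hij => ((disjoint_disjointed _ hij).mono
      Set.inter_subset_right Set.inter_subset_right)) fun n => hA.inter (hsm n),
      ← Set.inter_iUnion, hsu, Set.inter_univ]
  have hfin : ∀ n, IsSFiniteKernel ((atoms d C).restrict (hsm n)) := fun n => by
    refine isSFiniteKernel_of_finite _ fun η => ?_
    rw [Kernel.restrict_apply' _ _ _ MeasurableSet.univ, Set.univ_inter, atoms_apply]
    refine (measure_mono (disjointed_subset _ n)).trans_lt ?_
    have := measure_lt_top (atomsIn n η) Set.univ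
    rwa [atomsIn_eq_restrict, Measure.restrict_apply MeasurableSet.univ, Set.univ_inter] at this
  rw [heq]
  infer_instance

lemma pair_eq_integral_atoms (η : Config d C) {h : E d → ℝ} (hh : Measurable h) :
    η.pair h = ∫ p, p.1 * h p.2 ∂atoms d C η := η.pair_eq_integral hh

end Config

/-! ### Fast falling functions are integrable and pair absolutely with configurations. -/

section FastFalling

variable {d : ℕ}

/-- The exponent is that of `Config.summable_weight` at `ε = 1`, and it also makes the bound
Lebesgue integrable. -/
lemma FastFalling.exists_le_rpow {h : E d → ℝ} (hh : FastFalling h) :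
    ∃ B : ℝ, ∀ y, |h y| ≤ B * (1 + ‖y‖ ^ 2) ^ (-((d : ℝ) + 1) / 2) := by
  obtain ⟨B, hB⟩ := hh.2 (d + 1)
  refine ⟨B, fun y => ?_⟩
  have h1 : (1 : ℝ) ≤ 1 + ‖y‖ ^ 2 := by nlinarith [sq_nonneg ‖y‖]
  have h0 : (0 : ℝ) < 1 + ‖y‖ ^ 2 := by linarith
  have h2 : (1 + ‖y‖ ^ 2) ^ (((d : ℝ) + 1) / 2) ≤ (1 + ‖y‖ ^ 2) ^ (d + 1) := by
    rw [← Real.rpow_natCast (1 + ‖y‖ ^ 2) (d + 1)]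
    refine Real.rpow_le_rpow_of_exponent_le h1 ?_
    push_cast
    have : (0 : ℝ) ≤ d := d.cast_nonneg
    linarith
  have h3 := hB y
  rw [abs_mul, abs_of_pos (by positivity)] at h3
  have h4 : (1 + ‖y‖ ^ 2) ^ (((d : ℝ) + 1) / 2) * |h y| ≤ B :=
    (mul_le_mul_of_nonneg_right h2 (abs_nonneg _)).trans h3
  rw [neg_div, Real.rpow_neg h0.le, ← div_eq_mul_inv, le_div_iff₀ (by positivity), mul_comm]
  exact h4

lemma FastFalling.exists_abs_le {h : E d → ℝ} (hh : FastFalling h) : ∃ B : ℝ, 0 ≤ B ∧ ∀ y, |h y| ≤ B := by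
  obtain ⟨B, hB⟩ := hh.2 0
  exact ⟨B, (abs_nonneg _).trans (hB 0), fun y => by simpa using hB y⟩

lemma FastFalling.integrable {h : E d → ℝ} (hh : FastFalling h) : Integrable h := by
  obtain ⟨B, hB⟩ := hh.exists_le_rpow
  have h1 : Integrable fun y : E d => (1 + ‖y‖ ^ 2) ^ (-((d : ℝ) + 1) / 2) :=
    integrable_rpow_neg_one_add_norm_sq (by simp)
  exact (h1.const_mul B).mono' hh.1.aestronglyMeasurable (ae_of_all _ hB)

lemma fastFalling_schwartz (f : 𝓢(E d, ℝ)) : FastFalling f := by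
  refine ⟨f.continuous, fun N => ?_⟩
  obtain ⟨B, hB⟩ : ∃ B : ℝ, ∀ x, (1 + ‖x‖) ^ (2 * N) * ‖f x‖ ≤ B := by
    have := fun x => SchwartzMap.one_add_le_sup_seminorm_apply (𝕜 := ℝ) (m := (2 * N, 0)) (k := 2 * N)
      (n := 0) le_rfl le_rfl f x
    simp only [norm_iteratedFDeriv_zero] at this
    exact ⟨_, this⟩
  refine ⟨B, fun x => (hB x).trans' ?_⟩
  rw [abs_mul, abs_of_pos (by positivity), ← Real.norm_eq_abs, pow_mul]
  gcongr
  nlinarith [norm_nonneg x]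

lemma Config.summable_pair {C : ℝ} (η : Config d C) {h : E d → ℝ} (hh : FastFalling h) :
    Summable fun y => η.charge y * h y := by
  obtain ⟨B, hB⟩ := hh.exists_le_rpow
  refine Summable.of_norm_bounded ((η.summable_weight 1 one_pos).mul_left B) fun y => ?_
  rw [norm_mul, Real.norm_eq_abs, Real.norm_eq_abs, mul_comm, ← mul_assoc]
  exact mul_le_mul_of_nonneg_right (hB y) (abs_nonneg _)

end FastFalling

/-! ### The characteristic functional determines the measure. -/

section Uniqueness

variable {d : ℕ} {C : ℝ}

/-- All pairings with Schwartz functions. -/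
def Config.pairings (η : Config d C) (f : 𝓢(E d, ℝ)) : ℝ := η.pair f

/-- As a pullback of the product sigma algebra, it lets a measure be recovered from the joint law of
all pairings. -/
lemma Config.measurableSpace_eq_comap : (Config.instMeasurableSpace : MeasurableSpace (Config d C))
    = MeasurableSpace.comap Config.pairings MeasurableSpace.pi := by
  rw [MeasurableSpace.pi, MeasurableSpace.comap_iSup]
  refine iSup_congr fun f => ?_
  rw [MeasurableSpace.comap_comp]
  rfl

lemma Config.measurable_pairings : Measurable (Config.pairings : Config d C → _) :=
  measurable_pi_lambda _ fun f => Config.measurable_pair_schwartz f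

lemma Config.pair_sum (η : Config d C) {ι : Type*} (s : Finset ι) (c : ι → ℝ) (f : ι → 𝓢(E d, ℝ)) :
    η.pair (∑ i ∈ s, c i • f i : 𝓢(E d, ℝ)) = ∑ i ∈ s, c i * η.pair (f i) := by
  simp only [Config.pair]
  have h1 : ∀ i, HasSum (fun y => c i * (η.charge y * f i y)) (c i * ∑' y, η.charge y * f i y) :=
    fun i => (η.summable_pair (fastFalling_schwartz (f i))).hasSum.mul_left _
  rw [← (hasSum_sum fun i (_ : i ∈ s) => h1 i).tsum_eq]
  refine tsum_congr fun y => ?_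
  have : (∑ i ∈ s, c i • f i : 𝓢(E d, ℝ)) y = ∑ i ∈ s, c i * f i y := by
    induction s using Finset.cons_induction with
    | empty => simp
    | cons a s ha ih => simp [Finset.sum_cons, ih]
  rw [this, Finset.mul_sum]
  exact Finset.sum_congr rfl fun i _ => by ring

/-- A probability measure on configurations is determined by its characteristic functional. -/
theorem Config.measure_ext {μ ν : Measure (Config d C)} [IsProbabilityMeasure μ]
    [IsProbabilityMeasure ν] (h : ∀ f : 𝓢(E d, ℝ),
      ∫ η, Complex.exp (Complex.I * (η.pair f : ℂ)) ∂μ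
        = ∫ η, Complex.exp (Complex.I * (η.pair f : ℂ)) ∂ν) : μ = ν := by
  have hm := Config.measurable_pairings (d := d) (C := C)
  have hmap : μ.map Config.pairings = ν.map Config.pairings := by
    have : IsProbabilityMeasure (ν.map (Config.pairings (d := d) (C := C))) :=
      Measure.isProbabilityMeasure_map hm.aemeasurable
    have : IsProbabilityMeasure (μ.map (Config.pairings (d := d) (C := C))) :=
      Measure.isProbabilityMeasure_map hm.aemeasurable
    refine IsProjectiveLimit.unique (P := fun I => (ν.map Config.pairings).map I.restrict)
      (fun I => ?_) fun I => rfl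
    have hr : Measurable (I.restrict : (𝓢(E d, ℝ) → ℝ) → I → ℝ) := Finset.measurable_restrict I
    have : IsProbabilityMeasure ((ν.map (Config.pairings (d := d) (C := C))).map I.restrict) :=
      Measure.isProbabilityMeasure_map hr.aemeasurable
    have : IsProbabilityMeasure ((μ.map (Config.pairings (d := d) (C := C))).map I.restrict) :=
      Measure.isProbabilityMeasure_map hr.aemeasurable
    refine Measure.ext_of_charFunDual (funext fun L => ?_)
    classical
    -- A linear functional of finitely many pairings is the pairing with one Schwartz function, so
    -- the characteristic functional gives the Fourier transform of every finite-dimensional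
    -- marginal.
    have hL : ∀ η : Config d C, L (I.restrict η.pairings)
        = η.pair (∑ i : I, L (Pi.single i 1) • (i : 𝓢(E d, ℝ)) : 𝓢(E d, ℝ)) := by
      intro η
      rw [Config.pair_sum]
      have : I.restrict η.pairings = ∑ i : I, η.pair (i : 𝓢(E d, ℝ)) • Pi.single i (1 : ℝ) := by
        ext j
        simp [Finset.sum_apply, Pi.single_apply, Config.pairings]
      rw [this, map_sum]
      refine Finset.sum_congr rfl fun i _ => ?_
      rw [map_smul, smul_eq_mul, mul_comm]
    have hcomp : ∀ ρ : Measure (Config d C),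
        charFunDual ((ρ.map Config.pairings).map I.restrict) L
        = ∫ η, Complex.exp (Complex.I * (η.pair
          (∑ i : I, L (Pi.single i 1) • (i : 𝓢(E d, ℝ)) : 𝓢(E d, ℝ)) : ℂ)) ∂ρ := by
      intro ρ
      rw [charFunDual_apply, Measure.map_map hr hm,
        integral_map (hr.comp hm).aemeasurable (by fun_prop)]
      refine integral_congr_ae (ae_of_all _ fun η => ?_)
      simp only [Function.comp_apply, hL, mul_comm]
    rw [hcomp, hcomp, h]
  ext A hA
  have hA' : MeasurableSet[MeasurableSpace.comap Config.pairings MeasurableSpace.pi] A := by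
    rw [← Config.measurableSpace_eq_comap]; exact hA
  obtain ⟨B, hB, rfl⟩ := hA'
  rw [← Measure.map_apply hm hB, hmap, Measure.map_apply hm hB]

end Uniqueness

/-! ### The intensity measure of the free gas. -/

section Intensity

variable {d : ℕ} {C z : ℝ} {r : Measure ℝ}

/-- The intensity `z r ⊗ dy` of the free gas. -/
def intensity (d : ℕ) (z : ℝ) (r : Measure ℝ) : Measure (ℝ × E d) :=
  (ENNReal.ofReal z • r).prod volume

lemma IsChargeLaw.isFinite (hr : IsChargeLaw C r) (z : ℝ) :
    IsFiniteMeasure (ENNReal.ofReal z • r) :=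
  have := hr.prob
  Measure.smul_finite r ENNReal.ofReal_ne_top

lemma IsChargeLaw.ae_intensity (hr : IsChargeLaw C r) (d : ℕ) (z : ℝ) :
    ∀ᵐ p ∂intensity d z r, |p.1| ≤ C ∧ p.1 ≠ 0 := by
  have := hr.isFinite z
  have h1 : ∀ᵐ s ∂r, |s| ≤ C ∧ s ≠ 0 := by
    have h2 : ∀ᵐ s ∂r, s ∈ Set.Icc (-C) C := hr.supp
    have h3 : ∀ᵐ s ∂r, s ≠ 0 := by
      rw [ae_iff]; simpa using hr.zero
    filter_upwards [h2, h3] with s hs hs'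
    exact ⟨abs_le.2 hs, hs'⟩
  exact Measure.quasiMeasurePreserving_fst.ae (Measure.ae_smul_measure h1 _)

lemma IsChargeLaw.integrable_intensity (hr : IsChargeLaw C r) (z : ℝ) {f : E d → ℝ}
    (hf : Integrable f) : Integrable (fun p => f p.2) (intensity d z r) := by
  have := hr.isFinite z
  exact hf.comp_snd _

lemma IsChargeLaw.integrable_mul_intensity (hr : IsChargeLaw C r) (z : ℝ) {f : E d → ℝ}
    (hf : Integrable f) : Integrable (fun p => p.1 * f p.2) (intensity d z r) := by
  have h1 := hr.integrable_intensity z hf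
  refine (h1.norm.const_mul C).mono' (measurable_fst.aestronglyMeasurable.mul h1.1) ?_
  filter_upwards [hr.ae_intensity d z] with p hp
  rw [norm_mul]
  exact mul_le_mul_of_nonneg_right hp.1 (norm_nonneg _)

end Intensity

/-! ### Configurations from lists of charged points. -/

section Construction

variable {d : ℕ} {C : ℝ}

/-- The configuration with the charges and positions `pt i`. -/
def Config.ofPoints {I : Type*} (hC : 0 ≤ C) (pt : I → ℝ × E d)
    (hinj : Function.Injective fun i => (pt i).2) (hs : ∀ i, |(pt i).1| ≤ C)
    (hfin : ∀ n : ℕ, {i | (pt i).2 ∈ Metric.ball 0 (n : ℝ)}.Finite)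
    (hsum : ∀ ε : ℝ, 0 < ε →
      Summable fun i => (1 + ‖(pt i).2‖ ^ 2) ^ (-((d : ℝ) + ε) / 2) * |(pt i).1|) : Config d C where
  charge := Function.extend (fun i => (pt i).2) (fun i => (pt i).1) 0
  finite_inter K hK := by
    obtain ⟨R, hR⟩ := hK.isBounded.subset_ball (0 : E d)
    obtain ⟨n, hn⟩ := exists_nat_ge R
    refine ((hfin n).image fun i => (pt i).2).subset fun y hy => ?_
    by_cases h : ∃ i, (pt i).2 = y
    · obtain ⟨i, rfl⟩ := h
      exact ⟨i, Metric.ball_subset_ball hn (hR hy.1), rfl⟩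
    · exact absurd (Function.extend_apply' _ _ _ h) hy.2
  abs_charge_le y := by
    by_cases h : ∃ i, (pt i).2 = y
    · obtain ⟨i, rfl⟩ := h
      rw [hinj.extend_apply (fun i => (pt i).1)]
      exact hs i
    · rw [Function.extend_apply' _ _ _ h]
      simpa using hC
  summable_weight ε hε := by
    refine (hinj.summable_iff fun y hy => ?_).1 ((hsum ε hε).congr fun i => ?_)
    · rw [Function.extend_apply' _ _ _ (by simpa using hy)]
      simp
    · simp only [Function.comp_apply]
      rw [hinj.extend_apply (fun i => (pt i).1)]

/-- Distinct positions and nonzero charges identify the index set with the support of the charge, so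
no atom is merged or lost. -/
lemma Config.atomsMeasure_ofPoints {I : Type*} (hC : 0 ≤ C) (pt : I → ℝ × E d)
    (hinj : Function.Injective fun i => (pt i).2) (hs : ∀ i, |(pt i).1| ≤ C)
    (hfin : ∀ n : ℕ, {i | (pt i).2 ∈ Metric.ball 0 (n : ℝ)}.Finite)
    (hsum : ∀ ε : ℝ, 0 < ε →
      Summable fun i => (1 + ‖(pt i).2‖ ^ 2) ^ (-((d : ℝ) + ε) / 2) * |(pt i).1|)
    (hne : ∀ i, (pt i).1 ≠ 0) :
    (Config.ofPoints hC pt hinj hs hfin hsum).atomsMeasure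
      = Measure.sum fun i => Measure.dirac (pt i) := by
  set η := Config.ofPoints hC pt hinj hs hfin hsum with hη
  have hch : ∀ i, η.charge (pt i).2 = (pt i).1 := fun i =>
    hinj.extend_apply (fun i => (pt i).1) _ _
  have hsupp : ∀ i, (pt i).2 ∈ Function.support η.charge := fun i => by
    rw [Function.mem_support, hch]; exact hne i
  have hbij : Function.Bijective (fun i => (⟨(pt i).2, hsupp i⟩ : Function.support η.charge)) := by
    refine ⟨fun i j h => hinj (congrArg Subtype.val h), fun y => ?_⟩
    by_contra h
    have : ¬∃ i, (pt i).2 = y.1 := fun ⟨i, hi⟩ => h ⟨i, Subtype.ext hi⟩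
    exact y.2 (show η.charge y.1 = 0 from
      Function.extend_apply' (fun i => (pt i).1) (0 : E d → ℝ) y.1 this)
  refine Measure.ext_of_lintegral _ fun f _ => ?_
  rw [Config.lintegral_atomsMeasure, lintegral_sum_measure,
    ← (Equiv.ofBijective _ hbij).tsum_eq]
  refine tsum_congr fun i => ?_
  simp [hch]

end Construction

/-! ### Points of the Poisson process; absence of coincidences. -/

section PointProcess

variable {X : Type*} [MeasurableSpace X]

/-- The point measure of a sequence of finite configurations, as a kernel. -/
def pointsKernel (X : Type*) [MeasurableSpace X] : Kernel (ℕ → FinSeq X) X where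
  toFun := points
  measurable' := Measure.measurable_of_measurable_coe _ fun A hA => by
    have h := measurable_lintegral_points (X := X) (measurable_one.indicator hA)
    simpa [lintegral_indicator_one hA] using h

lemma pointsKernel_apply (ω : ℕ → FinSeq X) : pointsKernel X ω = points ω := rfl

lemma isPoisson_pointsKernel (m : ℕ → Measure X) [∀ k, IsFiniteMeasure (m k)] :
    IsPoisson (pointsKernel X) (Measure.sum m) (poissonLaw m) where
  prob := inferInstance
  ae_lintegral_lt_top f hf hfi := by
    rw [← lintegral_lintegral_points m hf] at hfi
    exact ae_lt_top (measurable_lintegral_points hf) hfi.ne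
  laplace f hf hi := integral_cexp_points m hf hi

/-- The points of a sequence of finite configurations. -/
def pointAt (ω : ℕ → FinSeq X) (i : Σ k, Fin (ω k).1) : X := (ω i.1).2 i.2

lemma points_eq_sum_dirac (ω : ℕ → FinSeq X) :
    points ω = Measure.sum fun i => Measure.dirac (pointAt ω i) := by
  refine Measure.ext_of_lintegral _ fun f hf => ?_
  rw [lintegral_points ω hf, lintegral_sum_measure]
  refine Eq.trans ?_ (ENNReal.tsum_sigma' _).symm
  refine tsum_congr fun k => ?_
  rw [tsum_fintype]
  exact Finset.sum_congr rfl fun i _ => (lintegral_dirac' _ hf).symm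

lemma lintegral_points_eq_tsum (ω : ℕ → FinSeq X) {f : X → ℝ≥0∞} (hf : Measurable f) :
    ∫⁻ x, f x ∂points ω = ∑' i, f (pointAt ω i) := by
  rw [points_eq_sum_dirac, lintegral_sum_measure]
  exact tsum_congr fun i => lintegral_dirac' _ hf

lemma forall_pointAt_of_ae {ω : ℕ → FinSeq X} {p : X → Prop} (hp : MeasurableSet {x | p x})
    (h : ∀ᵐ x ∂points ω, p x) (i : Σ k, Fin (ω k).1) : p (pointAt ω i) := by
  rw [points_eq_sum_dirac, Measure.ae_sum_iff] at h
  exact (ae_dirac_iff hp).1 (h i)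

lemma ae_poissonCell_of_ae (m : Measure X) [IsFiniteMeasure m] {p : X → Prop}
    (hpm : MeasurableSet {x | p x}) (hp : ∀ᵐ x ∂m, p x) :
    ∀ᵐ c ∂poissonCell m, ∀ i, p (c.2 i) := by
  have hf : Measurable ({x | p x}ᶜ.indicator (1 : X → ℝ≥0∞)) := measurable_one.indicator hpm.compl
  have h := lintegral_sum_poissonCell m hf
  rw [lintegral_indicator_one hpm.compl, show m {x | p x}ᶜ = 0 from hp,
    lintegral_eq_zero_iff (measurable_sum_cell hf)] at h
  filter_upwards [h] with c hc i
  by_contra hi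
  have := (Finset.sum_eq_zero_iff.1 hc) i (Finset.mem_univ i)
  rw [Set.indicator_of_mem (by exact hi)] at this
  exact one_ne_zero this

/-- With all coordinates but the `i`-th fixed, `π (c i)` must hit one prescribed value, a null
event. -/
lemma pi_eq_null {Y : Type*} [MeasurableSpace Y] [MeasurableEq Y] (m : Measure X)
    [IsFiniteMeasure m] {π : X → Y} (hπ : Measurable π) (hm : ∀ y, m (π ⁻¹' {y}) = 0) {n : ℕ}
    {i j : Fin n} (hij : i ≠ j) :
    Measure.pi (fun _ : Fin n => m) {c | π (c i) = π (c j)} = 0 := by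
  obtain _ | n := n
  · exact i.elim0
  obtain ⟨j, rfl⟩ := Fin.exists_succAbove_eq hij.symm
  have hs : MeasurableSet {q : X × (Fin n → X) | π q.1 = π (q.2 j)} :=
    measurableSet_eq_fun (hπ.comp measurable_fst)
      (hπ.comp ((measurable_pi_apply j).comp measurable_snd))
  have h := (measurePreserving_piFinSuccAbove (fun _ : Fin (n + 1) => m) i).measure_preimage
    hs.nullMeasurableSet
  have h2 : (m.prod (Measure.pi fun _ : Fin n => m)) {q | π q.1 = π (q.2 j)} = 0 := by
    rw [Measure.prod_apply_symm hs]
    simp only [lintegral_eq_zero_iff (measurable_measure_prodMk_right hs)]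
    exact ae_of_all _ fun c => hm (π (c j))
  exact h.trans h2

/-- The number of coinciding pairs has mean zero. -/
lemma ae_poissonCell_injective {Y : Type*} [MeasurableSpace Y] [MeasurableEq Y] (m : Measure X)
    [IsFiniteMeasure m] {π : X → Y} (hπ : Measurable π) (hm : ∀ y, m (π ⁻¹' {y}) = 0) :
    ∀ᵐ c ∂poissonCell m, Function.Injective fun i => π (c.2 i) := by
  classical
  set F : FinSeq X → ℝ≥0∞ := fun c => ∑ i, ∑ j, if i ≠ j ∧ π (c.2 i) = π (c.2 j) then 1 else 0
  have hset : ∀ (n : ℕ) (i j : Fin n), MeasurableSet {c : Fin n → X | i ≠ j ∧ π (c i) = π (c j)} :=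
    fun n i j => MeasurableSet.inter (MeasurableSet.const _)
      (measurableSet_eq_fun (hπ.comp (measurable_pi_apply i)) (hπ.comp (measurable_pi_apply j)))
  have hF : Measurable F := by
    refine measurable_of_comp_sigma_mk fun n => ?_
    have h (i j : Fin n) : Measurable fun c : Fin n → X =>
        if i ≠ j ∧ π (c i) = π (c j) then (1 : ℝ≥0∞) else 0 := Measurable.ite (hset n i j) measurable_const measurable_const
    change Measurable fun c : Fin n → X =>
      ∑ i, ∑ j, if i ≠ j ∧ π (c i) = π (c j) then (1 : ℝ≥0∞) else 0
    exact Finset.measurable_fun_sum _ fun i _ => Finset.measurable_fun_sum _ fun j _ => h i j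
  have h : ∫⁻ c, F c ∂poissonCell m = 0 := by
    rw [lintegral_poissonCell m hF]
    refine mul_eq_zero_of_right _ (ENNReal.tsum_eq_zero.2 fun n => mul_eq_zero_of_right _ ?_)
    refine (lintegral_eq_zero_iff' (hF.comp (measurable_sigma_mk n)).aemeasurable).2 ?_
    have h0 : ∀ᵐ c ∂Measure.pi (fun _ : Fin n => m), ∀ i j : Fin n, i ≠ j → π (c i) ≠ π (c j) := by
      refine ae_all_iff.2 fun i => ae_all_iff.2 fun j => ?_
      by_cases hij : i = j
      · simp [hij]
      · have := pi_eq_null m hπ hm hij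
        filter_upwards [compl_mem_ae_iff.2 this] with c hc _ using hc
    filter_upwards [h0] with c hc
    refine Finset.sum_eq_zero fun i _ => Finset.sum_eq_zero fun j _ => if_neg ?_
    exact fun hij => hc i j hij.1 hij.2
  rw [lintegral_eq_zero_iff hF] at h
  filter_upwards [h] with c hc i j hij
  by_contra hne
  have h1 := (Finset.sum_eq_zero_iff.1 hc) i (Finset.mem_univ i)
  have h2 := (Finset.sum_eq_zero_iff.1 h1) j (Finset.mem_univ j)
  rw [if_pos ⟨hne, hij⟩] at h2
  exact one_ne_zero h2

lemma ae_poissonLaw {m : ℕ → Measure X} [∀ k, IsFiniteMeasure (m k)] {p : ℕ → FinSeq X → Prop}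
    (h : ∀ k, ∀ᵐ c ∂poissonCell (m k), p k c) : ∀ᵐ ω ∂poissonLaw m, ∀ k, p k (ω k) :=
  ae_all_iff.2 fun k =>
    (measurePreserving_eval_infinitePi (fun k => poissonCell (m k)) k).quasiMeasurePreserving.ae
      (h k)

/-- Coincidences within a cell are null; across cells the disjoint sets `S k` exclude them. -/
lemma ae_injective_pointAt {Y : Type*} [MeasurableSpace Y] [MeasurableEq Y]
    {m : ℕ → Measure X} [∀ k, IsFiniteMeasure (m k)] {π : X → Y} (hπ : Measurable π)
    (hm : ∀ k y, m k (π ⁻¹' {y}) = 0) {S : ℕ → Set Y} (hS : ∀ k, MeasurableSet (S k))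
    (hd : Pairwise (Function.onFun Disjoint S)) (hmS : ∀ k, ∀ᵐ x ∂m k, π x ∈ S k) :
    ∀ᵐ ω ∂poissonLaw m, Function.Injective fun i => π (pointAt ω i) := by
  filter_upwards [ae_poissonLaw fun k => ae_poissonCell_injective (m k) hπ (hm k),
    ae_poissonLaw fun k => ae_poissonCell_of_ae (m k) (hπ (hS k)) (hmS k)] with ω h1 h2
  rintro ⟨k, i⟩ ⟨l, j⟩ h
  by_cases hkl : k = l
  · subst hkl
    exact congrArg (Sigma.mk k) (h1 k h)
  · have h' : π ((ω k).2 i) = π ((ω l).2 j) := h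
    have := h2 l j
    rw [← h'] at this
    exact absurd this (Set.disjoint_left.1 (hd hkl) (h2 k i))

end PointProcess

/-! ### Existence, uniqueness and Poisson property of the free gas. -/

section FreeGas

variable {d : ℕ} {C z : ℝ} {r : Measure ℝ}

/-- The conditions under which a sequence of finite sequences of charged points forms a
configuration. -/
def IsAdmissible (d : ℕ) (C : ℝ) (ω : ℕ → FinSeq (ℝ × E d)) : Prop :=
  (Function.Injective fun i => (pointAt ω i).2) ∧
  (∀ i, |(pointAt ω i).1| ≤ C ∧ (pointAt ω i).1 ≠ 0) ∧
  (∀ n : ℕ, {i | (pointAt ω i).2 ∈ Metric.ball 0 (n : ℝ)}.Finite) ∧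
  ∀ ε : ℝ, 0 < ε → Summable fun i =>
    (1 + ‖(pointAt ω i).2‖ ^ 2) ^ (-((d : ℝ) + ε) / 2) * |(pointAt ω i).1|

/-- The disjoint cells of space. -/
def shell (d k : ℕ) : Set (E d) := disjointed (fun n : ℕ => Metric.ball 0 (n : ℝ)) k

lemma measurableSet_shell (d k : ℕ) : MeasurableSet (shell d k) :=
  MeasurableSet.disjointed (fun _ => measurableSet_ball) k

lemma pairwise_disjoint_shell (d : ℕ) : Pairwise (Function.onFun Disjoint (shell d)) :=
  disjoint_disjointed _

lemma iUnion_shell (d : ℕ) : ⋃ k, shell d k = Set.univ := by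
  simp only [shell]
  rw [iUnion_disjointed, Metric.iUnion_ball_nat]

/-- The intensity of the free gas in one cell. -/
def cellIntensity (d : ℕ) (z : ℝ) (r : Measure ℝ) (k : ℕ) : Measure (ℝ × E d) :=
  (intensity d z r).restrict (Prod.snd ⁻¹' shell d k)

lemma sum_cellIntensity (d : ℕ) (z : ℝ) (r : Measure ℝ) :
    Measure.sum (cellIntensity d z r) = intensity d z r := by
  change Measure.sum (fun k => (intensity d z r).restrict (Prod.snd ⁻¹' shell d k)) = _
  rw [← Measure.restrict_iUnion
    (fun i j hij => (pairwise_disjoint_shell d hij).preimage (Prod.snd : ℝ × E d → E d))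
    fun k => measurable_snd (measurableSet_shell d k), ← Set.preimage_iUnion, iUnion_shell,
    Set.preimage_univ, Measure.restrict_univ]

lemma intensity_preimage_snd_lt_top (hr : IsChargeLaw C r) (z : ℝ) {B : Set (E d)}
    (hB : volume B < ∞) : intensity d z r (Prod.snd ⁻¹' B) < ∞ := by
  have := hr.isFinite z
  rw [intensity, ← Set.univ_prod, Measure.prod_prod]
  exact ENNReal.mul_lt_top (measure_lt_top _ _) hB

lemma IsChargeLaw.isFinite_cellIntensity (hr : IsChargeLaw C r) (d : ℕ) (z : ℝ) (k : ℕ) :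
    IsFiniteMeasure (cellIntensity d z r k) := by
  refine ⟨?_⟩
  rw [cellIntensity, Measure.restrict_apply_univ]
  exact intensity_preimage_snd_lt_top hr z
    ((measure_mono (disjointed_subset _ k)).trans_lt measure_ball_lt_top)

lemma finite_of_lintegral_points_lt_top {X : Type*} [MeasurableSpace X] {ω : ℕ → FinSeq X}
    {A : Set X} (hA : MeasurableSet A)
    (h : ∫⁻ x, A.indicator 1 x ∂points ω < ∞) : {i | pointAt ω i ∈ A}.Finite := by
  rw [lintegral_points_eq_tsum ω (measurable_one.indicator hA)] at h
  refine (ENNReal.finite_const_le_of_tsum_ne_top h.ne one_ne_zero).subset fun i hi => ?_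
  have hi' : pointAt ω i ∈ A := hi
  simp [Set.indicator_of_mem hi']

lemma summable_pointAt {X : Type*} [MeasurableSpace X] {ω : ℕ → FinSeq X} {f : X → ℝ}
    (hf : Measurable f) (h0 : ∀ x, 0 ≤ f x)
    (h : ∫⁻ x, ENNReal.ofReal (f x) ∂points ω < ∞) : Summable fun i => f (pointAt ω i) := by
  rw [lintegral_points_eq_tsum ω hf.ennreal_ofReal] at h
  exact (ENNReal.summable_toReal h.ne).congr fun i => ENNReal.toReal_ofReal (h0 _)

lemma ae_isAdmissible (hd : 1 ≤ d) (hr : IsChargeLaw C r) (z : ℝ) :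
    haveI := hr.isFinite_cellIntensity d z
    ∀ᵐ ω ∂poissonLaw (cellIntensity d z r), IsAdmissible d C ω := by
  have := hr.isFinite_cellIntensity d z
  have := hr.isFinite z
  -- Dimension at least one ensures that Lebesgue measure has no atoms.
  have : Nonempty (Fin d) := ⟨⟨0, hd⟩⟩
  have hP := isPoisson_pointsKernel (cellIntensity d z r)
  rw [sum_cellIntensity] at hP
  have h1 : ∀ᵐ ω ∂poissonLaw (cellIntensity d z r),
      Function.Injective fun i => (pointAt ω i).2 := by
    refine ae_injective_pointAt measurable_snd (fun k y => ?_) (measurableSet_shell d)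
      (pairwise_disjoint_shell d) fun k =>
        ae_restrict_mem (measurable_snd (measurableSet_shell d k))
    refine nonpos_iff_eq_zero.1 ((Measure.restrict_apply_le _ _).trans_eq ?_)
    rw [intensity, ← Set.univ_prod, Measure.prod_prod, measure_singleton, mul_zero]
  have h2 : ∀ᵐ ω ∂poissonLaw (cellIntensity d z r), ∀ n : ℕ,
      ∫⁻ p, (Prod.snd ⁻¹' Metric.ball (0 : E d) (n : ℝ)).indicator 1 p ∂pointsKernel _ ω < ∞ := by
    refine ae_all_iff.2 fun n => ?_
    have hA : MeasurableSet (Prod.snd ⁻¹' Metric.ball (0 : E d) (n : ℝ) : Set (ℝ × E d)) :=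
      measurable_snd measurableSet_ball
    refine hP.ae_lintegral_lt_top _ (measurable_one.indicator hA) ?_
    rw [lintegral_indicator_one hA]
    exact intensity_preimage_snd_lt_top hr z measure_ball_lt_top
  have hw : ∀ ε : ℝ, Measurable fun p : ℝ × E d =>
      (1 + ‖p.2‖ ^ 2) ^ (-((d : ℝ) + ε) / 2) * |p.1| := fun ε => by fun_prop
  -- The weights decrease in `ε`, so the countably many values `1 / (n + 1)` cover all `ε > 0` with
  -- one null set.
  have h3 : ∀ᵐ ω ∂poissonLaw (cellIntensity d z r), ∀ n : ℕ,
      ∫⁻ p, ENNReal.ofReal ((1 + ‖p.2‖ ^ 2) ^ (-((d : ℝ) + 1 / ((n : ℝ) + 1)) / 2) * |p.1|)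
        ∂pointsKernel _ ω < ∞ := by
    refine ae_all_iff.2 fun n => hP.ae_lintegral_lt_top _ (hw _).ennreal_ofReal ?_
    have hi : Integrable fun y : E d => (1 + ‖y‖ ^ 2) ^ (-((d : ℝ) + 1 / ((n : ℝ) + 1)) / 2) := by
      refine integrable_rpow_neg_one_add_norm_sq ?_
      have : (0 : ℝ) < 1 / ((n : ℝ) + 1) := by positivity
      simpa using this
    have := (hr.integrable_mul_intensity z hi).2
    rw [HasFiniteIntegral] at this
    refine lt_of_le_of_lt (lintegral_mono fun p => ?_) this
    rw [← Real.enorm_of_nonneg (by positivity), enorm_mul, enorm_mul, mul_comm, Real.enorm_abs]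
  filter_upwards [h1, hP.ae_ae (hr.ae_intensity d z), h2, h3] with ω ha hb hc hd'
  have hs : MeasurableSet {p : ℝ × E d | |p.1| ≤ C ∧ p.1 ≠ 0} :=
    (measurableSet_le (f := fun p : ℝ × E d => |p.1|) (by fun_prop) measurable_const).inter
      (measurable_fst (measurableSet_singleton 0).compl)
  refine ⟨ha, forall_pointAt_of_ae hs hb, fun n =>
    finite_of_lintegral_points_lt_top (measurable_snd measurableSet_ball) (hc n), fun ε hε => ?_⟩
  obtain ⟨n, hn⟩ := exists_nat_one_div_lt hε
  refine (summable_pointAt (hw _) (fun p => by positivity) (hd' n)).of_nonneg_of_le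
    (fun i => by positivity) fun i => mul_le_mul_of_nonneg_right ?_ (abs_nonneg _)
  refine Real.rpow_le_rpow_of_exponent_le (by nlinarith [sq_nonneg ‖(pointAt ω i).2‖]) ?_
  linarith

/-- The free gas is a Poisson process: there is a measure on the configuration space under which
the atoms have Poisson law. -/
theorem exists_isPoisson_atoms (hd : 1 ≤ d) (hC : 0 < C) (hr : IsChargeLaw C r) (z : ℝ) :
    ∃ μ : Measure (Config d C), IsPoisson (Config.atoms d C) (intensity d z r) μ := by
  classical
  have := hr.isFinite_cellIntensity d z
  have hP := isPoisson_pointsKernel (cellIntensity d z r)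
  rw [sum_cellIntensity] at hP
  set P := poissonLaw (cellIntensity d z r) with hPdef
  have hadm := ae_isAdmissible hd hr z
  -- Inadmissible samples are enlarged to a measurable null set, on which the empty configuration is
  -- used; this keeps the map `T` measurable.
  set bad := toMeasurable P {ω | ¬IsAdmissible d C ω} with hbad
  have hbadm : MeasurableSet bad := measurableSet_toMeasurable _ _
  have hbad0 : P bad = 0 := by rw [hbad, measure_toMeasurable]; exact hadm
  have hgood : ∀ ω, ω ∉ bad → IsAdmissible d C ω := fun ω hω => by
    by_contra h
    exact hω (subset_toMeasurable P _ h)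
  let η₀ : Config d C := ⟨0, by simp, by simpa using hC.le, by simp [summable_zero]⟩
  let T : (ℕ → FinSeq (ℝ × E d)) → Config d C := fun ω =>
    if h : ω ∈ bad then η₀ else
      Config.ofPoints hC.le (pointAt ω) (hgood ω h).1 (fun i => ((hgood ω h).2.1 i).1)
        (hgood ω h).2.2.1 (hgood ω h).2.2.2
  have hT : ∀ ω, ω ∉ bad → Config.atoms d C (T ω) = pointsKernel _ ω := by
    intro ω h
    simp only [T, dif_neg h]
    rw [Config.atoms_apply, Config.atomsMeasure_ofPoints _ _ _ _ _ _
      fun i => ((hgood ω h).2.1 i).2, pointsKernel_apply, points_eq_sum_dirac]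
  have hTae : ∀ᵐ ω ∂P, Config.atoms d C (T ω) = pointsKernel _ ω := by
    filter_upwards [compl_mem_ae_iff.2 hbad0] with ω hω using hT ω hω
  have hTm : Measurable T := by
    rw [measurable_iff_comap_le, Config.instMeasurableSpace, MeasurableSpace.comap_iSup]
    refine iSup_le fun f => ?_
    rw [MeasurableSpace.comap_comp, ← measurable_iff_comap_le]
    have hf : Measurable fun p : ℝ × E d => p.1 * f p.2 :=
      measurable_fst.mul (f.continuous.measurable.comp measurable_snd)
    have heq : (fun η : Config d C => η.pair f) ∘ T = fun ω =>
        if ω ∈ bad then η₀.pair f else ∫ p, p.1 * f p.2 ∂pointsKernel _ ω := by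
      funext ω
      by_cases h : ω ∈ bad
      · simp [T, h]
      · rw [if_neg h, Function.comp_apply, Config.pair_eq_integral_atoms _ f.continuous.measurable,
          hT ω h]
    rw [heq]
    exact Measurable.ite hbadm measurable_const
      (hf.stronglyMeasurable.integral_kernel (κ := pointsKernel _)).measurable
  refine ⟨P.map T, Measure.isProbabilityMeasure_map hTm.aemeasurable, fun f hf hfi => ?_,
    fun f hf hfi => ?_⟩
  · rw [ae_map_iff hTm.aemeasurable (measurableSet_lt hf.lintegral_kernel measurable_const)]
    filter_upwards [hTae, hP.ae_lintegral_lt_top f hf hfi] with ω h1 h2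
    rwa [h1]
  · rw [integral_map hTm.aemeasurable, ← hP.laplace f hf hfi]
    · refine integral_congr_ae ?_
      filter_upwards [hTae] with ω h
      rw [h]
    · exact (Complex.measurable_exp.comp
        (hf.stronglyMeasurable.integral_kernel (κ := Config.atoms d C)).measurable).aestronglyMeasurable

/-- The characteristic functional of the Poisson law. -/
theorem IsPoisson.isFreeGas (hz : 0 < z) (hr : IsChargeLaw C r) {μ : Measure (Config d C)}
    (h : IsPoisson (Config.atoms d C) (intensity d z r) μ) : IsFreeGas z r μ where
  prob := h.prob
  charFun_eq f := by
    have := hr.isFinite z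
    have hf : Measurable fun p : ℝ × E d => Complex.I * ((p.1 * f p.2 : ℝ) : ℂ) :=
      (Complex.measurable_ofReal.comp (measurable_fst.mul
        (f.continuous.measurable.comp measurable_snd))).const_mul _
    have hfi : Integrable (fun p : ℝ × E d => Complex.I * ((p.1 * f p.2 : ℝ) : ℂ))
        (intensity d z r) :=
      (hr.integrable_mul_intensity z f.integrable).ofReal.const_mul _
    obtain ⟨B, hB0, hB⟩ := (fastFalling_schwartz f).exists_abs_le
    have hi : Integrable (fun p : ℝ × E d =>
        Real.exp ‖Complex.I * ((p.1 * f p.2 : ℝ) : ℂ)‖ - 1) (intensity d z r) := by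
      refine integrable_exp_norm_sub_one (B := C * B) ?_ hfi
      filter_upwards [hr.ae_intensity d z] with p hp
      rw [norm_mul, Complex.norm_I, one_mul, Complex.norm_real, norm_mul, Real.norm_eq_abs,
        Real.norm_eq_abs]
      exact mul_le_mul hp.1 (hB _) (abs_nonneg _) ((abs_nonneg _).trans hp.1)
    have hl := h.laplace _ hf hi
    have h1 : ∀ η : Config d C,
        ∫ p, Complex.I * ((p.1 * f p.2 : ℝ) : ℂ) ∂Config.atoms d C η
          = Complex.I * (η.pair f : ℂ) := fun η => by
      rw [integral_const_mul, integral_complex_ofReal,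
        Config.pair_eq_integral_atoms _ f.continuous.measurable]
    simp_rw [h1] at hl
    rw [hl, intensity, integral_prod_symm _ (Integrable.cexp_sub_one hf hi)]
    congr 1
    refine integral_congr_ae (ae_of_all _ fun y => ?_)
    simp only [levyChar]
    rw [integral_smul_measure, ENNReal.toReal_ofReal hz.le, Complex.real_smul]
    congr 1
    refine integral_congr_ae (ae_of_all _ fun s => ?_)
    push_cast
    ring_nf

theorem existsUnique_isFreeGas (hd : 1 ≤ d) (hC : 0 < C) (hz : 0 < z) (hr : IsChargeLaw C r) :
    ∃! μ : Measure (Config d C), IsFreeGas z r μ := by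
  obtain ⟨μ, hμ⟩ := exists_isPoisson_atoms hd hC hr z
  have h := hμ.isFreeGas hz hr
  refine ⟨μ, h, fun ν hν => ?_⟩
  have := h.prob
  have := hν.prob
  exact Config.measure_ext fun f => (hν.charFun_eq f).trans (h.charFun_eq f).symm

/-- Uniqueness identifies the given measure with the constructed one, which is Poissonian. -/
theorem IsFreeGas.isPoisson (hd : 1 ≤ d) (hC : 0 < C) (hz : 0 < z) (hr : IsChargeLaw C r)
    {μ : Measure (Config d C)} (h : IsFreeGas z r μ) :
    IsPoisson (Config.atoms d C) (intensity d z r) μ := by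
  obtain ⟨ν, hν⟩ := exists_isPoisson_atoms hd hC hr z
  rwa [(existsUnique_isFreeGas hd hC hz hr).unique h (hν.isFreeGas hz hr)]

end FreeGas

/-! ### The cutoff measure and measurable versions of the kernel. -/

section Cutoff

variable {d : ℕ} {C β b : ℝ} {g : E d → ℝ} {v : ℝ → ℝ}

/-- The measure `g(x) dx`. -/
def cutoffMeasure (g : E d → ℝ) : Measure (E d) :=
  volume.withDensity fun x => ENNReal.ofReal (g x)

lemma IsCutoff.isFiniteMeasure (hg : IsCutoff β g) : IsFiniteMeasure (cutoffMeasure g) :=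
  isFiniteMeasure_withDensity_ofReal
    (hg.continuous.integrable_of_hasCompactSupport hg.compactSupport).2

lemma IsCutoff.cutoffMeasure_le (hg : IsCutoff β g) :
    cutoffMeasure g ≤ ENNReal.ofReal β • volume := by
  rw [← withDensity_const]
  exact withDensity_mono (ae_of_all _ fun x => ENNReal.ofReal_le_ofReal (hg.le x))

lemma IsCutoff.integral_cutoffMeasure (hg : IsCutoff β g) (f : E d → ℝ) :
    ∫ x, f x ∂cutoffMeasure g = ∫ x, f x * g x := by
  rw [cutoffMeasure, integral_withDensity_eq_integral_toReal_smul
    hg.continuous.measurable.ennreal_ofReal (ae_of_all _ fun x => ENNReal.ofReal_lt_top)]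
  refine integral_congr_ae (ae_of_all _ fun x => ?_)
  simp only [ENNReal.toReal_ofReal (hg.nonneg x), smul_eq_mul, mul_comm]

/-- The field does not depend on the version of the kernel, up to null sets. -/
lemma ae_field_eq {G G' : E d → ℝ} (hGG : G =ᵐ[volume] G') (hG' : Measurable G') (η : Config d C) :
    ∀ᵐ x, field G η x = ∫ p, p.1 * G' (x - p.2) ∂Config.atoms d C η := by
  set A := toMeasurable volume {x | ¬G x = G' x} with hA
  have hAm : MeasurableSet A := measurableSet_toMeasurable _ _
  have hA0 : ∀ᵐ x, x ∉ A := by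
    refine compl_mem_ae_iff.2 ?_
    rw [hA, measure_toMeasurable]
    exact hGG
  have h1 : ∀ᵐ p ∂Config.atoms d C η, ∀ᵐ x, x - p.2 ∉ A := ae_of_all _ fun p =>
    (measurePreserving_sub_right volume p.2).quasiMeasurePreserving.ae hA0
  have hm : MeasurableSet {a : (ℝ × E d) × E d | a.2 - a.1.2 ∉ A} :=
    (hAm.preimage (f := fun a : (ℝ × E d) × E d => a.2 - a.1.2) (by fun_prop)).compl
  filter_upwards [(Measure.ae_ae_comm hm).1 h1] with x hx
  rw [← Config.pair_eq_integral_atoms η (h := fun y => G' (x - y)) (hG'.comp (by fun_prop))]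
  refine tsum_congr fun y => ?_
  by_cases hy : η.charge y = 0
  · simp [hy]
  · rw [Config.atoms_apply, Config.atomsMeasure] at hx
    have : Countable (Function.support η.charge) := η.countable_support.to_subtype
    -- The support is countable and each of its points is an atom, so an almost everywhere statement
    -- holds at every one of them.
    have hx' := Measure.ae_sum_iff.1 hx ⟨y, hy⟩
    have hms : MeasurableSet {p : ℝ × E d | x - p.2 ∉ A} :=
      (hAm.preimage (f := fun p : ℝ × E d => x - p.2) (by fun_prop)).compl
    have hxA : x - y ∉ A := (ae_dirac_iff hms).1 hx'
    have : G (x - y) = G' (x - y) := by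
      by_contra h
      exact hxA (subset_toMeasurable _ _ h)
    exact congrArg (η.charge y * ·) this

lemma potential_eq {G G' : E d → ℝ} (hGG : G =ᵐ[volume] G') (hG' : Measurable G')
    (hg : IsCutoff β g) (v : ℝ → ℝ) (η : Config d C) :
    potential G v g η
      = ∫ x, v (∫ p, p.1 * G' (x - p.2) ∂Config.atoms d C η) ∂cutoffMeasure g := by
  rw [hg.integral_cutoffMeasure, potential]
  refine integral_congr_ae ?_
  filter_upwards [ae_field_eq hGG hG' η] with x hx
  rw [hx]

/-- An integrable `G` is measurable only up to a null set; the positive part of a measurable version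
is nonnegative everywhere. -/
lemma exists_measurable_version {G : E d → ℝ} (hG : IsKernel G) :
    ∃ G' : E d → ℝ, Measurable G' ∧ (∀ x, 0 ≤ G' x) ∧ G =ᵐ[volume] G' := by
  obtain ⟨G₁, hm, he⟩ := hG.integrable.1
  refine ⟨fun x => max (G₁ x) 0, hm.measurable.max measurable_const, fun x => le_max_right _ _, ?_⟩
  filter_upwards [he] with x hx
  rw [← hx, max_eq_left (hG.nonneg x)]

end Cutoff

/-! ### Linear bounds and monotonicity for energy densities. -/

section EnergyDensity

variable {b : ℝ} {v : ℝ → ℝ}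

lemma IsEnergyDensity.differentiable (hv : IsEnergyDensity b v) : Differentiable ℝ v :=
  hv.contDiff.differentiable (by norm_num)

lemma IsEnergyDensity.abs_le (hv : IsEnergyDensity b v) (t : ℝ) : |v t| ≤ b * |t| := by
  have h := Convex.norm_image_sub_le_of_norm_deriv_le (f := v) (s := Set.univ) (x := 0) (y := t)
    (fun x _ => hv.differentiable x) (fun x _ => (hv.abs_deriv_lt x).le) convex_univ
    (Set.mem_univ _) (Set.mem_univ _)
  simpa [hv.zero] using h

/-- The derivative `v' + b` is positive because `|v'| < b`. This makes the remaining Boltzmann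
factor decreasing. -/
lemma IsEnergyDensity.monotone_add (hv : IsEnergyDensity b v) : Monotone fun t => v t + b * t := by
  have hd : ∀ t, HasDerivAt (fun t => v t + b * t) (deriv v t + b) t := fun t => by
    have h := (hv.differentiable t).hasDerivAt.add ((hasDerivAt_id t).const_mul b)
    rwa [mul_one] at h
  refine monotone_of_deriv_nonneg (fun t => (hd t).differentiableAt) fun t => ?_
  rw [(hd t).deriv]
  linarith [(abs_lt.1 (hv.abs_deriv_lt t)).1]

lemma IsEnergyDensity.abs_add_mul_le (hb : 0 ≤ b) (hv : IsEnergyDensity b v) (t : ℝ) :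
    |v t + b * t| ≤ 2 * b * |t| := by
  refine (abs_add_le _ _).trans ?_
  rw [abs_mul, abs_of_nonneg hb]
  linarith [hv.abs_le t]

end EnergyDensity

/-! ### Linear energies and exponential bounds. -/

section Linear

variable {Ω Y Z : Type*} [MeasurableSpace Ω] [MeasurableSpace Y] [MeasurableSpace Z]
variable {N : Kernel Ω (ℝ × Y)} [IsSFiniteKernel N] {γ : Measure Z} [IsFiniteMeasure γ]
variable {m : Measure (ℝ × Y)} {P : Measure Ω} {C : ℝ} {hbar : Y → ℝ} {Γ : Z → Y → ℝ}

/-- Fubini turns the integrated field into a linear functional of the atoms, the form of exponent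
required by `IsPoisson.tilted`. -/
lemma Envelope.ae_integrable_field (e : Envelope m γ C hbar Γ) (hP : IsPoisson N m P) :
    ∀ᵐ ω ∂P, Integrable (fun x => ∫ p, p.1 * Γ x p.2 ∂N ω) γ ∧
      ∫ x, ∫ p, p.1 * Γ x p.2 ∂N ω ∂γ = ∫ p, p.1 * ∫ x, Γ x p.2 ∂γ ∂N ω := by
  filter_upwards [e.ae_integrable_prod hP, hP.ae_ae e.abs_le] with ω h1 h2
  have h3 : Integrable (Function.uncurry fun (p : ℝ × Y) x => p.1 * Γ x p.2) ((N ω).prod γ) := by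
    refine (h1.const_mul C).mono' ((measurable_fst.comp measurable_fst).mul
      (e.meas_Γ.comp (f := fun a : (ℝ × Y) × Z => (a.2, a.1.2)) (by fun_prop))).aestronglyMeasurable
      ?_
    filter_upwards [Measure.quasiMeasurePreserving_fst.ae h2] with a ha
    rw [Function.uncurry, norm_mul, Real.norm_of_nonneg (e.nonneg_Γ _ _)]
    exact mul_le_mul_of_nonneg_right ha (e.nonneg_Γ _ _)
  refine ⟨h3.integral_prod_right, ?_⟩
  rw [← integral_integral_swap h3]
  simp_rw [integral_const_mul]

lemma Envelope.ae_integral_add_mul (e : Envelope m γ C hbar Γ) (hP : IsPoisson N m P)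
    {v : ℝ → ℝ} (hvc : Continuous v) {b : ℝ} (hv : ∀ t, |v t| ≤ b * |t|) :
    ∀ᵐ ω ∂P, ∫ x, (v (∫ p, p.1 * Γ x p.2 ∂N ω) + b * ∫ p, p.1 * Γ x p.2 ∂N ω) ∂γ
      = ∫ x, v (∫ p, p.1 * Γ x p.2 ∂N ω) ∂γ + ∫ p, b * (p.1 * ∫ x, Γ x p.2 ∂γ) ∂N ω := by
  filter_upwards [e.ae_integrable_field hP] with ω hω
  have hφm : StronglyMeasurable fun x => ∫ p, p.1 * Γ x p.2 ∂N ω :=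
    (stronglyMeasurable_field (N := N) e.meas_Γ).comp_measurable measurable_prodMk_left
  have hvi : Integrable (fun x => v (∫ p, p.1 * Γ x p.2 ∂N ω)) γ :=
    (hω.1.norm.const_mul b).mono' (hvc.comp_stronglyMeasurable hφm).aestronglyMeasurable
      (ae_of_all _ fun x => hv _)
  rw [integral_add hvi (hω.1.const_mul b), integral_const_mul, hω.2, integral_const_mul]

/-- The exponential bound on the expectation of an observable. -/
lemma Envelope.integral_observable_le (e : Envelope m γ C hbar Γ) (hP : IsPoisson N m P)
    {n : ℕ} {H : (Fin n → ℝ) → ℝ} {κ K : ℝ} (hC : 0 ≤ C) (hκ : 0 ≤ κ) (hK : 0 ≤ K)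
    (hH : ∀ x, |H x| ≤ K * Real.exp (κ * ∑ i, |x i|)) {h : Fin n → Y → ℝ}
    (hh : ∀ l y, |h l y| ≤ hbar y) (hi : Integrable (observable N H h) P) {m₀ : Measure (ℝ × Y)}
    {c : ℝ} (hc : 0 ≤ c) (hm : m ≤ ENNReal.ofReal c • m₀)
    (hm₀ : Integrable (fun p => Real.exp (κ * n * C * hbar p.2) - 1) m₀) :
    ∫ ω, observable N H h ω ∂P
      ≤ K * Real.exp (c * ∫ p, (Real.exp (κ * n * C * hbar p.2) - 1) ∂m₀) := by
  have hc0 : 0 ≤ κ * n * C := by positivity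
  have h0 : ∀ y, 0 ≤ κ * n * C * hbar y := fun y => mul_nonneg hc0 (e.nonneg_h y)
  have hfm : Measurable fun p : ℝ × Y => κ * n * C * hbar p.2 :=
    (e.meas_h.comp measurable_snd).const_mul _
  have hm₀' := (hm₀.smul_measure (c := ENNReal.ofReal c) ENNReal.ofReal_ne_top)
  have hfe : Integrable (fun p : ℝ × Y => Real.exp ‖κ * n * C * hbar p.2‖ - 1) m := by
    simp_rw [Real.norm_of_nonneg (h0 _)]
    exact hm₀'.mono_measure hm
  have hle := e.ae_abs_observable_le hP hκ hK hH (ae_of_all _ fun p l => hh l p.2)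
  refine (integral_mono_ae hi ((hP.integrable_exp hfm hfe).const_mul K)
    (hle.mono fun η hη => (le_abs_self _).trans hη)).trans ?_
  rw [integral_const_mul, hP.integral_exp hfm hfe]
  refine mul_le_mul_of_nonneg_left (Real.exp_le_exp.2 ?_) hK
  refine (integral_mono_measure hm (ae_of_all _ fun p => ?_) hm₀').trans (le_of_eq ?_)
  · simpa using h0 p.2
  · rw [integral_smul_measure, ENNReal.toReal_ofReal hc, smul_eq_mul]

end Linear

/-! ### Comparison of the two Gibbs measures. -/

section Gibbs

variable {d : ℕ} {C z b β A : ℝ} {r : Measure ℝ} {n : ℕ} {H : (Fin n → ℝ) → ℝ}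
  {h : Fin n → E d → ℝ} {κ K : ℝ}

/-- The bound on the expectation of an observable in the linear Gibbs measures. -/
def expectationBound (z C b β A : ℝ) (κ K : ℝ) (h : Fin n → E d → ℝ) : ℝ :=
  K * Real.exp (Real.exp (b * (C * (β * A))) *
    (z * ∫ y, (Real.exp (κ * n * C * ∑ l, h l y) - 1)))

/-- The comparison of the Gibbs measures for a Poisson process. -/
theorem gibbs_comparison (hz : 0 < z) (hC : 0 < C) (hb : 0 < b) (hβ : 0 < β)
    (hr : IsChargeLaw C r) {μ : Measure (Config d C)}
    (hP : IsPoisson (Config.atoms d C) (intensity d z r) μ) (hHc : Continuous H)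
    (hHm : Monotone H) (hκ : 0 ≤ κ) (hK : 0 ≤ K)
    (hH : ∀ x, |H x| ≤ K * Real.exp (κ * ∑ i, |x i|)) (hh : ∀ l, FastFalling (h l))
    (hh0 : ∀ l y, 0 ≤ h l y) {G : E d → ℝ} (hG : IsKernel G) (hA : ∫ x, ‖G x‖ = A)
    {v : ℝ → ℝ} (hv : IsEnergyDensity b v) {g : E d → ℝ} (hg : IsCutoff β g) :
    IsProbabilityMeasure (gibbs μ G v g) ∧ IsProbabilityMeasure (linearGibbs μ G b g) ∧
    Integrable (fun η : Config d C => H fun l => η.pair (h l)) (gibbs μ G v g) ∧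
    Integrable (fun η : Config d C => H fun l => η.pair (h l)) (linearGibbs μ G b g) ∧
    ∫ η, (H fun l => η.pair (h l)) ∂gibbs μ G v g
      ≤ ∫ η, (H fun l => η.pair (h l)) ∂linearGibbs μ G b g ∧
    ∫ η, (H fun l => η.pair (h l)) ∂linearGibbs μ G b g
      ≤ expectationBound z C b β A κ K h := by
  obtain ⟨G', hGm, hG0, hGG⟩ := exists_measurable_version hG
  have hGi : Integrable G' := hG.integrable.congr hGG
  have hA' : ∫ x, G' x = A := by
    rw [← hA]
    refine integral_congr_ae ?_
    filter_upwards [hGG] with x hx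
    rw [← hx, Real.norm_of_nonneg (hG.nonneg x)]
  have := hr.isFinite z
  have := hr.prob
  have := hg.isFiniteMeasure
  have := hP.prob
  have hγ := hg.cutoffMeasure_le
  set γ := cutoffMeasure g with hγdef
  set N := Config.atoms d C with hN
  have hF : (fun η : Config d C => H fun l => η.pair (h l)) = observable N H h := by
    funext η
    rw [observable]
    congr 1
    funext l
    exact Config.pair_eq_integral_atoms η (hh l).1.measurable
  simp only [hF]
  -- the functions entering the estimates
  set hbar : E d → ℝ := fun y => ∑ l, h l y with hbardef
  have hbm : Measurable hbar := Finset.measurable_fun_sum _ fun l _ => (hh l).1.measurable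
  have hb0 : ∀ y, 0 ≤ hbar y := fun y => Finset.sum_nonneg fun l _ => hh0 l y
  have hbi : Integrable hbar := integrable_finsetSum _ fun l _ => (hh l).integrable
  choose B hB0 hB using fun l => (hh l).exists_abs_le
  have hBs : ∀ l y, h l y ≤ ∑ l, B l := fun l y => ((le_abs_self _).trans (hB l y)).trans
    (Finset.single_le_sum (fun i _ => hB0 i) (Finset.mem_univ l))
  have hbB : ∀ y, hbar y ≤ ∑ l, B l := fun y =>
    Finset.sum_le_sum fun l _ => (le_abs_self _).trans (hB l y)
  have hle : ∀ l y, |h l y| ≤ hbar y := fun l y => by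
    rw [abs_of_nonneg (hh0 l y)]
    exact Finset.single_le_sum (f := fun l => h l y) (fun i _ => hh0 i y) (Finset.mem_univ l)
  have env := envelope_convolution hβ.le hγ ((hr.ae_intensity d z).mono fun p hp => hp.1)
    (fun f _ hf => hr.integrable_intensity z hf) hbm hb0 hbi ⟨_, hbB⟩ hGi hGm hG0
  -- the linear Gibbs measure is again Poissonian
  set u : E d → ℝ := fun y => ∫ x, G' (x - y) ∂γ with hu
  have hu0 : ∀ y, 0 ≤ u y := fun y => integral_nonneg fun x => hG0 _
  have huA : ∀ y, u y ≤ β * A := fun y => by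
    rw [← hA']; exact integral_comp_sub_le hβ.le hγ hGi hG0 y
  have hum : Measurable u := ((measurable_sub_kernel hGm).comp
    measurable_swap).stronglyMeasurable.integral_prod_right'.measurable
  have hui : Integrable u := integrable_integral_comp_sub hGi hGm
  set w : ℝ × E d → ℝ := fun p => b * (p.1 * u p.2) with hw
  have hwm : Measurable w := (measurable_fst.mul (hum.comp measurable_snd)).const_mul b
  have hwi : Integrable w (intensity d z r) := (hr.integrable_mul_intensity z hui).const_mul b
  have hwB : ∀ᵐ p ∂intensity d z r, ‖w p‖ ≤ b * (C * (β * A)) := by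
    filter_upwards [hr.ae_intensity d z] with p hp
    rw [hw, norm_mul, norm_mul, Real.norm_of_nonneg hb.le, Real.norm_of_nonneg (hu0 _)]
    exact mul_le_mul_of_nonneg_left (mul_le_mul hp.1 (huA _) (hu0 _) hC.le) hb.le
  have hQ := hP.tilted hwm hwB hwi
  have hwexp := hP.integrable_exp hwm (integrable_exp_norm_sub_one hwB hwi)
  set m' := (intensity d z r).withDensity fun p => ENNReal.ofReal (Real.exp (w p)) with hm'
  set Q := μ.tilted fun η => ∫ p, w p ∂N η with hQdef
  have hfield := env.ae_integrable_field hP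
  have hlin : linearGibbs μ G b g = Q := by
    refine tilted_congr ?_
    filter_upwards [hfield] with η hη
    rw [potential_eq hGG hGm hg, integral_const_mul, hη.2, hw, integral_const_mul]
    ring
  -- From `|s| ≤ C` and `u ≤ βA`: the bound on the tilted intensity depends on `g` only through `β`.
  have hm'le : m' ≤ ENNReal.ofReal (Real.exp (b * (C * (β * A)))) • intensity d z r := by
    rw [hm', ← withDensity_const]
    refine withDensity_mono ?_
    filter_upwards [hwB] with p hp
    exact ENNReal.ofReal_le_ofReal (Real.exp_le_exp.2 ((le_abs_self _).trans hp))
  have habs' : ∀ᵐ p ∂m', |p.1| ≤ C :=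
    (withDensity_absolutelyContinuous _ _).ae_le ((hr.ae_intensity d z).mono fun p hp => hp.1)
  have hmi' : ∀ f : E d → ℝ, Measurable f → Integrable f → Integrable (fun p => f p.2) m' :=
    fun f _ hf =>
      ((hr.integrable_intensity z hf).smul_measure ENNReal.ofReal_ne_top).mono_measure hm'le
  have env' := envelope_convolution hβ.le hγ habs' hmi' hbm hb0 hbi ⟨_, hbB⟩ hGi hGm hG0
  have hΓle : ∀ᵐ p ∂m', ∀ᵐ x ∂γ, |G' (x - p.2)| ≤ G' (x - p.2) :=
    ae_of_all _ fun p => ae_of_all _ fun x => (abs_of_nonneg (hG0 _)).le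
  -- the Gibbs measure in terms of the linear one
  set q : ℝ → ℝ := fun t => v t + b * t with hq
  have hqc : Continuous q := hv.contDiff.continuous.add (by fun_prop)
  set k := boltzmann N γ q fun x y => G' (x - y) with hk
  have hL : 0 ≤ 2 * b := by positivity
  have hhm : ∀ l, Measurable (h l) := fun l => (hh l).1.measurable
  have hqL : ∀ t, |q t| ≤ 2 * b * |t| := hv.abs_add_mul_le hb.le
  have hhle : ∀ᵐ p ∂m', ∀ l, |h l p.2| ≤ hbar p.2 := ae_of_all _ fun p l => hle l p.2
  have hint := env'.integrable_observable_boltzmann (N := N) (P := Q) (H := H) (q := q) (L := 2 * b)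
    (h := h) (Γ := fun x y => G' (x - y)) hQ hC.le hκ hK hHc hH hqc hqL hL hhm hhle hΓle
    (measurable_sub_kernel hGm)
  have iF : Integrable (observable N H h) Q := hint.1
  have ik : Integrable k Q := hint.2.1
  have iFk : Integrable (fun η => observable N H h η * k η) Q := hint.2.2
  have := hQ.prob
  -- Since `-v = bφ - q`, the Gibbs tilt is the linear tilt followed by the tilt with `-∫ q dγ`.
  have hgibbs : gibbs μ G v g
      = Q.tilted fun η => -∫ x, q (∫ p, p.1 * G' (x - p.2) ∂N η) ∂γ := by
    rw [hQdef, tilted_tilted hwexp]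
    refine tilted_congr ?_
    filter_upwards [env.ae_integral_add_mul hP hv.contDiff.continuous hv.abs_le] with η hη
    rw [potential_eq hGG hGm hg, Pi.add_apply]
    linarith
  have hk0 : 0 < ∫ η, k η ∂Q := integral_exp_pos ik
  have hQF : ∫ η, observable N H h η ∂gibbs μ G v g
      = (∫ η, observable N H h η * k η ∂Q) / ∫ η, k η ∂Q := by
    rw [hgibbs, integral_tilted, ← integral_div]
    refine integral_congr_ae (ae_of_all _ fun η => ?_)
    simp only [hk, boltzmann, smul_eq_mul]
    ring
  refine ⟨?_, ?_, ?_, ?_, ?_, ?_⟩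
  · rw [hgibbs]; exact isProbabilityMeasure_tilted ik
  · rw [hlin]; infer_instance
  · rw [hgibbs, integrable_tilted_iff ik]
    exact iFk.congr (ae_of_all _ fun η => mul_comm _ _)
  · rw [hlin]; exact iF
  -- After multiplication by the normalisation, the comparison is exactly the negative correlation
  -- of the observable and `k` under `Q`.
  · rw [hQF, hlin, div_le_iff₀ hk0]
    exact hQ.integral_mul_le hC.le hβ.le hγ habs' hmi' hHc hHm hκ hK hH (fun l => (hh l).1) hh0
      (fun l => (hh l).integrable) (Finset.sum_nonneg fun i _ => hB0 i) hBs hqc hv.monotone_add hL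
      (hv.abs_add_mul_le hb.le) hGi hGm hG0
  · rw [hlin]
    have hye : Integrable fun y => Real.exp (κ * n * C * hbar y) - 1 := by
      have hnorm : ∀ y, ‖κ * n * C * hbar y‖ = κ * n * C * hbar y := fun y =>
        Real.norm_of_nonneg (mul_nonneg (by positivity) (hb0 y))
      simpa only [hnorm] using integrable_exp_norm_sub_one
        (ae_of_all _ fun y => (hnorm y).trans_le (mul_le_mul_of_nonneg_left (hbB y) (by positivity)))
        (hbi.const_mul (κ * n * C))
    refine (env'.integral_observable_le hQ hC.le hκ hK hH hle iF (Real.exp_pos _).le hm'le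
      (hr.integrable_intensity z hye)).trans (le_of_eq ?_)
    rw [expectationBound, intensity, integral_fun_snd fun y => Real.exp (κ * n * C * hbar y) - 1]
    simp [measureReal_def, hz.le, hbardef]

end Gibbs

end WeakGas

end

theorem proposition4p2 (d : ℕ) (hd : 1 ≤ d) (z C b A β : ℝ)
    (hz : 0 < z) (hC : 0 < C) (hb : 0 < b) (hβ : 0 < β)
    (F : WeakGas.Config d C → ℝ) (hF : WeakGas.IsIncreasingObservable F) :
    ∃ M : ℝ, ∀ r : Measure ℝ, WeakGas.IsChargeLaw C r →
      (∃! μ₀ : Measure (WeakGas.Config d C), WeakGas.IsFreeGas z r μ₀) ∧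
      ∀ μ₀ : Measure (WeakGas.Config d C), WeakGas.IsFreeGas z r μ₀ →
      ∀ G : WeakGas.E d → ℝ, WeakGas.IsKernel G → (∫ x, ‖G x‖) = A →
      ∀ v : ℝ → ℝ, WeakGas.IsEnergyDensity b v →
      ∀ g : WeakGas.E d → ℝ, WeakGas.IsCutoff β g →
        IsProbabilityMeasure (WeakGas.gibbs μ₀ G v g) ∧
        IsProbabilityMeasure (WeakGas.linearGibbs μ₀ G b g) ∧
        Integrable F (WeakGas.gibbs μ₀ G v g) ∧
        Integrable F (WeakGas.linearGibbs μ₀ G b g) ∧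
        ∫ η, F η ∂(WeakGas.gibbs μ₀ G v g) ≤ ∫ η, F η ∂(WeakGas.linearGibbs μ₀ G b g) ∧
        ∫ η, F η ∂(WeakGas.linearGibbs μ₀ G b g) < M := by
  obtain ⟨n, H, h, hHc, ⟨κ, K, hκ, hK, hH⟩, hHm, hh, hh0, hFH⟩ := hF
  obtain rfl : F = fun η => H fun l => η.pair (h l) := funext hFH
  -- The bound is fixed before `r`, `G`, `v` and `g`, with `G` entering only through its norm `A`;
  -- adding `1` makes the inequality strict.
  refine ⟨WeakGas.expectationBound z C b β A κ K h + 1, fun r hr =>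
    ⟨WeakGas.existsUnique_isFreeGas hd hC hz hr, fun μ₀ hμ₀ G hG hA v hv g hg => ?_⟩⟩
  obtain ⟨h1, h2, h3, h4, h5, h6⟩ := WeakGas.gibbs_comparison hz hC hb hβ hr
    (hμ₀.isPoisson hd hC hz hr) hHc (WeakGas.monotone_of_monotone_update hHm) hκ.le hK.le hH hh
    hh0 hG hA hv hg
  exact ⟨h1, h2, h3, h4, h5, h6.trans_lt (lt_add_one _)⟩
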